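/- **Setting.** For $m\ge 1$ let $I_{2,m}=\mathrm{diag}(-1,-1,1,\dots,1)$, let $G=SO_0(2,m)$ be the identity component of $\{g\in SL(m+2,\mathbb R): g^tI_{2,m}g=I_{2,m}\}$, $\mathfrak g_0=\{X: X^tI_{2,m}+I_{2,m}X=0\}$ its Lie algebra, $\mathfrak g=\mathfrak g_0\otimes\mathbb C$, and $\theta(g)=I_{2,m}\,g\,I_{2,m}^{-1}$ the Cartan involution, with $\mathfrak g_0=\mathfrak k_0\oplus\mathfrak p_0$, $\mathfrak g=\mathfrak k\oplus\mathfrak p$. Write $m=2l-1$ or $m=2l-2$, and let $F_{ij}=E_{ij}-E_{ji}$, $H_j=F_{2j-1,2j}$. *Roots.* Let $\mathfrak t_0=\sum_{j=1}^l\mathbb RH_j$ and $e_j(H_k)=-i\delta_{jk}$. With respect to $\mathfrak h=\mathfrak t_0^{\mathbb C}$ the positive roots are $e_j\pm e_k$ $(j<k)$ and, if $m=2l-1$, also the $e_j$. The simple roots $\Phi$ are $\phi_j=e_j-e_{j+1}$ $(j<l)$, and $\phi_l=e_l$ if $m=2l-1$, $\phi_l=e_{l-1}+e_l$ if $m=2l-2$;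 $\delta=e_1+e_2$ is the highest root ($\delta=e_1$ if $m=1$; not used if $m=2$). A root $\alpha$ is compact if $\mathfrak g^\alpha\subset\mathfrak k$ and non-compact if $\mathfrak g^\alpha\subset\mathfrak p$, i.e. if it involves $e_1$. If $m=2l-2$, let $\mathfrak t_0'=\mathbb RH_1+\sum_{j=2}^l\mathbb RF_{1+j,l+j}$, with $\epsilon_1(H_1)=-i$, $\epsilon_j(F_{1+j,l+j})=i$ $(j\ge2)$ and all other values $0$, and let $\Phi'$, $\delta'$ and the positive roots be defined by the same formulas with $\epsilon_j$ in place of $e_j$. *Root vectors.* Let $f$ be the isomorphism $\mathfrak{so}(m+2,\mathbb C)\to\mathfrak g$ multiplying the upper right $2\times m$ block by $i$ and the lower left $m\times 2$ block by $-i$. For $\mathfrak t_0$ take $$E_{e_j\mp e_k}=\tfrac12 f\bigl(\pm F_{2j-1,2k-1}+F_{2j,2k}+i(F_{2j-1,2k}\mp F_{2j,2k-1})\bigr),\qquad E_{e_j}=f(-F_{2j-1,2l+1}+iF_{2j,2l+1}).$$ For $\mathfrak t_0'$ take $$E_{\epsilon_1\mp\epsilon_k}=\tfrac12 f\bigl(\pm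 F_{1,l+k}+F_{2,1+k}+i(F_{1,1+k}\mp F_{2,l+k})\bigr),$$ $$E_{\epsilon_j\mp\epsilon_k}=\tfrac12\bigl(-F_{1+j,1+k}\mp F_{l+j,l+k}+i(\pm F_{1+j,l+k}+F_{1+k,l+j})\bigr)\quad(2\le j<k).$$ Put $E_{-\alpha}=\overline{E_\alpha}$ for $\alpha$ positive non-compact and $E_{-\alpha}=-\overline{E_\alpha}$ for $\alpha$ positive compact, $X_\alpha=E_\alpha-E_{-\alpha}$, $Y_\alpha=i(E_\alpha+E_{-\alpha})$, and let $H^*_\alpha$ be the coroot of $\alpha$. *Lattices.* Let $K$ be a totally real number field of degree $>1$ with a fixed embedding $K\subset\mathbb R$, $\mathcal O$ its ring of integers, and $u\in K$ with $u>0$, $s(u)<0$ for every other embedding $s:K\to\mathbb R$, and $K=\mathbb Q(u)$; let $v=\sqrt u$. Then $\Gamma$ is the set of those automorphisms of $\mathfrak g_0$ whose matrix lies in $GL(N,\mathcal O)$, $N=\dim\mathfrak g_0$, with respect to the basis of $\mathfrak g_0$ consisting of $iH^*_\phi$ ($\phi\in\Phi$), $X_\alpha,Y_\alpha$ ($\alpha$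 positive compact), and $v\,iX_\alpha,v\,iY_\alpha$ ($\alpha$ positive non-compact), formed with $\mathfrak t_0$. For $m=2l-2$, $\Gamma'$ is defined in the same way with $\mathfrak t_0'$. *Diagrams.* The vertices of the affine diagram are $\Phi\cup\{-\delta\}$ if $m\ne2$, and $\pm\phi_1,\pm\phi_2$ if $m=2$; edges are given by the Cartan integers, and non-compact vertices are black. An almost double Vogan diagram is this diagram with a colour-preserving diagram automorphism $d$ of order $1$ or $2$ and a set of circled vertices, all fixed by $d$. An automorphism $s$ of $\mathfrak g_0$ has this diagram with respect to $(\mathfrak t_0,\Phi)$ if $s(\mathfrak t_0)=\mathfrak t_0$, $s$ maps each vertex $\psi$ to $d(\psi)$ (i.e. $\psi\circ s^{-1}=d(\psi)$ on $\mathfrak t_0$), and on $\mathfrak g^\psi$, for each vertex $\psi$ fixed by $d$, $s$ is $-\mathrm{id}$ if $\psi$ is circled and $+\mathrm{id}$ if not. Likewise for $(\mathfrak t_0',\Phi')$, with $\phi_j,\delta$ replaced by $\phi_j',\delta'$. Consider the following diagrams ("circled" lists all circled vertices; $\phi_1$ is never circled by the phrase "$\phi_p$ circled if $p\ge2$"). 1.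 $m=2l-1$, $l\ge1$. - $d=\mathrm{id}$: circled $\phi_p$; circled $\phi_p,\phi_1,-\delta$ $(2\le p\le l)$. - $d:\phi_1\leftrightarrow-\delta$: $\phi_p$ circled if $p\ge2$, none if $p=1$ $(1\le p\le l)$. 2. $m=2l-2$, $l\ge3$. - $d=\mathrm{id}$: circled $\phi_p$; circled $\phi_p,\phi_1,-\delta$ $(2\le p\le l-2)$; circled $\phi_l,\phi_1$; circled $\phi_l,-\delta$; circled $\phi_{l-1},\phi_1$; circled $\phi_{l-1},-\delta$; and, for $l=3$, circled $\phi_2,\phi_3$; circled all four vertices. - $d:\phi_1\leftrightarrow-\delta$: $\phi_p$ circled if $p\ge2$, none if $p=1$ $(1\le p\le l-2)$; and, for $l=3$, circled $\phi_2,\phi_3$. - $d:\phi_{l-1}\leftrightarrow\phi_l$: $\phi_p$ circled if $p\ge2$, none if $p=1$; and the same with $\phi_1,-\delta$ circled in addition $(1\le p\le l-2)$. - $d:\phi_1\leftrightarrow-\delta,\ \phi_{l-1}\leftrightarrow\phi_l$: $\phi_p$ circled if $p\ge2$, none if $p=1$ $(1\le p\le l-2)$. 3. $m=2$. - $d=\mathrm{id}$: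 circled $\pm\phi_1$; circled $\pm\phi_2$. - $d:\phi_1\leftrightarrow-\phi_1$: none circled; circled $\pm\phi_2$. - $d:\phi_2\leftrightarrow-\phi_2$: none circled; circled $\pm\phi_1$. - None circled: $d=-1$ (both sign changes); $d:\pm\phi_1\leftrightarrow\pm\phi_2$; $d:\pm\phi_1\leftrightarrow\mp\phi_2$. **Proposition.** For each of these diagrams there is a Lie group automorphism $\sigma$ of $G=SO_0(2,m)$ of order two, commuting with $\theta$ and given by conjugation by a matrix in $GL(m+2,\mathbb R)$, whose differential $d\sigma$ at the identity satisfies: if $m=2l-1$, then $d\sigma\in\Gamma$ and $d\sigma$ has the given diagram with respect to $(\mathfrak t_0,\Phi)$; if $m=2l-2$, then either $d\sigma\in\Gamma$ and $d\sigma$ has the given diagram with respect to $(\mathfrak t_0,\Phi)$, or $d\sigma\in\Gamma'$ and $d\sigma$ has the given diagram with respect to $(\mathfrak t_0',\Phi')$. -/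

import Mathlib

open scoped Matrix NumberField

-- the commutator bracket on matrices
attribute [local instance] LieRing.ofAssociativeRing

namespace SO2m

/-! ### The group `SO₀(2,m)`, its Lie algebra and the Cartan involution -/

/-- `I_{2,m} = diag(-1,-1,1,…,1)`. -/
def formMatrix (R : Type*) [CommRing R] (m : ℕ) : Matrix (Fin (m + 2)) (Fin (m + 2)) R :=
  Matrix.diagonal fun i => if i.val < 2 then -1 else 1

theorem formMatrix_mul_self (R : Type*) [CommRing R] (m : ℕ) :
    formMatrix R m * formMatrix R m = 1 := by
  rw [formMatrix, Matrix.diagonal_mul_diagonal, ← Matrix.diagonal_one]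
  congr 1
  funext i
  split_ifs <;> simp

theorem formMatrix_det (R : Type*) [CommRing R] (m : ℕ) : (formMatrix R m).det = 1 := by
  rw [formMatrix, Matrix.det_diagonal, Fin.prod_univ_succ, Fin.prod_univ_succ]
  simp

/-- `SO(2,m) = {g ∈ SL(m+2,ℝ) : gᵗ I_{2,m} g = I_{2,m}}`. -/
def SO (m : ℕ) : Subgroup (Matrix.SpecialLinearGroup (Fin (m + 2)) ℝ) where
  carrier := {g | g.1ᵀ * formMatrix ℝ m * g.1 = formMatrix ℝ m}
  one_mem' := by simp
  mul_mem' := by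
    intro a b ha hb
    simp only [Set.mem_ofPred_eq] at ha hb ⊢
    calc (a * b).1ᵀ * formMatrix ℝ m * (a * b).1
        = b.1ᵀ * (a.1ᵀ * formMatrix ℝ m * a.1) * b.1 := by
          rw [Matrix.SpecialLinearGroup.coe_mul, Matrix.transpose_mul]
          simp only [Matrix.mul_assoc]
      _ = formMatrix ℝ m := by rw [ha, hb]
  inv_mem' := by
    intro a ha
    simp only [Set.mem_ofPred_eq] at ha ⊢
    have h1 : a.1 * (a⁻¹).1 = 1 := by
      rw [← Matrix.SpecialLinearGroup.coe_mul, mul_inv_cancel, Matrix.SpecialLinearGroup.coe_one]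
    have h2 : (a⁻¹).1ᵀ * a.1ᵀ = 1 := by rw [← Matrix.transpose_mul, h1, Matrix.transpose_one]
    calc (a⁻¹).1ᵀ * formMatrix ℝ m * (a⁻¹).1
        = (a⁻¹).1ᵀ * (a.1ᵀ * formMatrix ℝ m * a.1) * (a⁻¹).1 := by rw [ha]
      _ = ((a⁻¹).1ᵀ * a.1ᵀ) * formMatrix ℝ m * (a.1 * (a⁻¹).1) := by
          simp only [Matrix.mul_assoc]
      _ = formMatrix ℝ m := by rw [h1, h2, Matrix.one_mul, Matrix.mul_one]

/-- `SO₀(2,m)`, the identity component of `SO(2,m)`. -/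
def SO0 (m : ℕ) : Subgroup (SO m) := Subgroup.connectedComponentOfOne (SO m)

/-- The underlying real matrix of an element of `SO₀(2,m)`. -/
def mat {m : ℕ} (g : SO0 m) : Matrix (Fin (m + 2)) (Fin (m + 2)) ℝ := g.1.1.1

/-- `I_{2,m}` as an element of `SO(2,m)`. -/
def formElt (m : ℕ) : SO m :=
  ⟨⟨formMatrix ℝ m, formMatrix_det ℝ m⟩, by
    change (formMatrix ℝ m)ᵀ * formMatrix ℝ m * formMatrix ℝ m = formMatrix ℝ m
    rw [Matrix.mul_assoc, formMatrix_mul_self, Matrix.mul_one, formMatrix,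
      Matrix.diagonal_transpose]⟩

theorem conj_mem_SO0 {m : ℕ} (a : SO m) (g : SO m) (hg : g ∈ SO0 m) : a * g * a⁻¹ ∈ SO0 m := by
  have hc : Continuous fun x : SO m => a * x * a⁻¹ := by fun_prop
  have h := hc.image_connectedComponent_subset 1
  have h1 : a * 1 * a⁻¹ = 1 := by simp
  rw [h1] at h
  exact h ⟨g, hg, rfl⟩

/-- The Cartan involution `θ` of `SO₀(2,m)`: conjugation by `I_{2,m}`. -/
def theta {m : ℕ} (g : SO0 m) : SO0 m :=
  ⟨formElt m * g.1 * (formElt m)⁻¹, conj_mem_SO0 _ _ g.2⟩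

/-- The Lie algebra `{X : Xᵗ I_{2,m} + I_{2,m} X = 0}`: this is `𝔤₀ = 𝔰𝔬(2,m)` for `R = ℝ`, and
its complexification `𝔤` for `R = ℂ`. -/
abbrev so (R : Type*) [CommRing R] (m : ℕ) :
    LieSubalgebra R (Matrix (Fin (m + 2)) (Fin (m + 2)) R) :=
  skewAdjointMatricesLieSubalgebra (formMatrix R m)

/-- An involution of `SO₀(2,m)`: an automorphism of the Lie group of order two. -/
def IsInvolution {m : ℕ} (σ : SO0 m ≃ₜ* SO0 m) : Prop :=
  (∃ g, σ g ≠ g) ∧ ∀ g, σ (σ g) = g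

/-- `s` is the differential of `σ` at the identity: `σ (exp tX) = exp (t s(X))` for all `X ∈ 𝔤₀`
and all real `t`. -/
def IsDifferential {m : ℕ} (σ : SO0 m ≃ₜ* SO0 m) (s : so ℝ m ≃ₗ⁅ℝ⁆ so ℝ m) : Prop :=
  ∀ (X : so ℝ m) (t : ℝ), ∃ g : SO0 m,
    mat g = NormedSpace.exp (t • X.1) ∧ mat (σ g) = NormedSpace.exp (t • (s X).1)

/-- `σ` is the conjugation by some real invertible matrix. -/
def IsMatrixConjugation {m : ℕ} (σ : SO0 m ≃ₜ* SO0 m) : Prop :=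
  ∃ A : GL (Fin (m + 2)) ℝ, ∀ g, mat (σ g) = A.1 * mat g * (A⁻¹).1

/-- The element `X + iY` of `𝔤`; every element of `𝔤` is uniquely of this form with
`X, Y ∈ 𝔤₀`. -/
noncomputable def cplx {m : ℕ} (X Y : so ℝ m) : Matrix (Fin (m + 2)) (Fin (m + 2)) ℂ :=
  X.1.map Complex.ofReal + Complex.I • Y.1.map Complex.ofReal

/-! ### Roots as integer vectors, and diagrams

A root of `𝔤` is written as the vector of its coordinates with respect to `e₁, …, e_l`. -/

/-- `e_j` (numbered from `1`); it is zero if `j` is not in `1, …, l`. -/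
def e (l j : ℕ) : Fin l → ℤ := fun i => if i.val + 1 = j then 1 else 0

/-- The invariant inner product of roots, up to a positive scalar. -/
def pairing {l : ℕ} (α β : Fin l → ℤ) : ℤ := ∑ i, α i * β i

/-- The Cartan integer `2(α,β)/(β,β)`; the division is exact when `α`, `β` are roots. -/
def cartanInt {l : ℕ} (α β : Fin l → ℤ) : ℤ := 2 * pairing α β / pairing β β

/-- A root is non-compact (its root space lies in `𝔭`) iff its `e₁`-coordinate is non-zero. -/
def IsNoncompact {l : ℕ} (α : Fin l → ℤ) : Prop := ∃ i : Fin l, i.val = 0 ∧ α i ≠ 0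

/-- The vertices of the affine diagram for `m = 2l-1`. The vertex `j ≥ 1` is the simple root
`φ_j`, that is `e_j - e_{j+1}` for `j < l` and `e_l` for `j = l`; the vertex `0` is `-δ`, where
`δ = e₁ + e₂` for `l ≥ 2` and `δ = e₁` for `l = 1` (where `e l 2 = 0`). -/
def rootB (l : ℕ) (v : Fin (l + 1)) : Fin l → ℤ :=
  if v.val = 0 then -(e l 1 + e l 2)
  else if v.val < l then e l v.val - e l (v.val + 1)
  else e l l

/-- The vertices of the affine diagram for `m = 2l-2`, `l ≥ 3`. The vertex `j ≥ 1` is the simple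
root `φ_j`, that is `e_j - e_{j+1}` for `j < l` and `e_{l-1} + e_l` for `j = l`; the vertex `0` is
`-δ`, where `δ = e₁ + e₂`. -/
def rootD (l : ℕ) (v : Fin (l + 1)) : Fin l → ℤ :=
  if v.val = 0 then -(e l 1 + e l 2)
  else if v.val < l then e l v.val - e l (v.val + 1)
  else e l (l - 1) + e l l

/-- The vertices of the affine diagram for `m = 2`: with `φ₁ = e₁ - e₂`, `φ₂ = e₁ + e₂` they are
`(0, true) = φ₁`, `(0, false) = -φ₁`, `(1, true) = φ₂`, `(1, false) = -φ₂`. -/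
def rootD2 (v : Fin 2 × Bool) : Fin 2 → ℤ :=
  (if v.2 then (1 : ℤ) else -1) • (if v.1 = 0 then e 2 1 - e 2 2 else e 2 1 + e 2 2)

/-- An almost double Vogan diagram on the affine Vogan diagram whose vertices are the roots
`root v` (with edges given by the Cartan integers, black vertices being the non-compact roots):
a diagram automorphism of order `1` or `2` preserving the colours, together with a set of circled
vertices, all fixed by the automorphism. -/
@[ext] structure AlmostDoubleVoganDiagram {l : ℕ} {V : Type} (root : V → Fin l → ℤ) where
  aut : Equiv.Perm V
  aut_aut : ∀ v, aut (aut v) = v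
  cartan_aut : ∀ v w, cartanInt (root (aut v)) (root (aut w)) = cartanInt (root v) (root w)
  color_aut : ∀ v, IsNoncompact (root (aut v)) ↔ IsNoncompact (root v)
  circled : Set V
  circled_fixed : ∀ v ∈ circled, aut v = v

/-- A permutation of the vertices induced by sign changes of the `e_j` defines a diagram. -/
def mkDiagram {l : ℕ} {V : Type} {root : V → Fin l → ℤ} (aut : Equiv.Perm V)
    (aut_aut : ∀ v, aut (aut v) = v)
    (sgn : Fin l → ℤ) (hsgn : ∀ i, sgn i = 1 ∨ sgn i = -1)
    (h : ∀ v i, root (aut v) i = sgn i * root v i)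
    (circled : Set V) (circled_fixed : ∀ v ∈ circled, aut v = v) :
    AlmostDoubleVoganDiagram root where
  aut := aut
  aut_aut := aut_aut
  cartan_aut := by
    have key : ∀ v w, pairing (root (aut v)) (root (aut w)) = pairing (root v) (root w) := by
      intro v w
      refine Finset.sum_congr rfl fun i _ => ?_
      rw [h, h]
      rcases hsgn i with hs | hs <;> rw [hs] <;> ring
    intro v w
    simp only [cartanInt, key]
  color_aut := by
    intro v
    refine exists_congr fun i => and_congr_right fun _ => ?_
    rw [h]
    rcases hsgn i with hs | hs <;> rw [hs] <;> simp
  circled := circled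
  circled_fixed := circled_fixed

/-- The diagram with trivial automorphism and the given circled vertices. -/
def fixDiagram {l : ℕ} {V : Type} {root : V → Fin l → ℤ} (circled : Set V) :
    AlmostDoubleVoganDiagram root :=
  mkDiagram 1 (fun _ => rfl) (fun _ => 1) (fun _ => Or.inl rfl) (fun _ _ => by simp) circled
    (fun _ _ => rfl)

/-- The transposition of the vertices `-δ` and `φ₁`. -/
def swapBlack (l : ℕ) : Equiv.Perm (Fin (l + 1)) :=
  Equiv.swap ⟨0, Nat.succ_pos l⟩ (Fin.ofNat (l + 1) 1)

/-- The transposition of the vertices `φ_{l-1}` and `φ_l`. -/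
def swapEnd (l : ℕ) : Equiv.Perm (Fin (l + 1)) :=
  Equiv.swap ⟨l - 1, Nat.lt_succ_of_le (Nat.sub_le l 1)⟩ (Fin.last l)


theorem swapBlack_ne {l : ℕ} (v : Fin (l + 1)) (h : 2 ≤ v.val) : swapBlack l v = v := by
  apply Equiv.swap_apply_of_ne_of_ne
  · intro h0
    rw [h0] at h
    simp at h
  · intro h1
    rw [h1] at h
    have := Nat.mod_le 1 (l + 1)
    simp at h
    omega

theorem swapEnd_ne {l : ℕ} (v : Fin (l + 1)) (h : v.val + 1 < l) : swapEnd l v = v := by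
  apply Equiv.swap_apply_of_ne_of_ne
  · intro h0
    rw [h0] at h
    simp at h
    omega
  · intro h1
    rw [h1] at h
    simp at h

theorem swap_swap_apply {V : Type} [DecidableEq V] (a b v : V) :
    Equiv.swap a b (Equiv.swap a b v) = v := Equiv.swap_apply_self a b v

/-- The sign change of `e₁`. -/
def sgnFirst (l : ℕ) : Fin l → ℤ := fun i => if i.val = 0 then -1 else 1

/-- The sign change of `e_l`. -/
def sgnLast (l : ℕ) : Fin l → ℤ := fun i => if i.val + 1 = l then -1 else 1

theorem sgnFirst_or {l : ℕ} (i : Fin l) : sgnFirst l i = 1 ∨ sgnFirst l i = -1 := by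
  unfold sgnFirst; split_ifs <;> simp

theorem sgnLast_or {l : ℕ} (i : Fin l) : sgnLast l i = 1 ∨ sgnLast l i = -1 := by
  unfold sgnLast; split_ifs <;> simp

theorem swapBlack_val {l : ℕ} (hl : 1 ≤ l) (v : Fin (l + 1)) :
    (swapBlack l v).val = if v.val = 0 then 1 else if v.val = 1 then 0 else v.val := by
  have h1 : 1 % (l + 1) = 1 := Nat.mod_eq_of_lt (by omega)
  unfold swapBlack
  rw [Equiv.swap_apply_def]
  simp only [Fin.ext_iff, Fin.val_ofNat, h1]
  split_ifs <;> simp only [Fin.val_ofNat, h1]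

theorem swapEnd_val {l : ℕ} (v : Fin (l + 1)) :
    (swapEnd l v).val = if v.val = l - 1 then l else if v.val = l then l - 1 else v.val := by
  unfold swapEnd
  rw [Equiv.swap_apply_def]
  simp only [Fin.ext_iff, Fin.val_last]
  split_ifs <;> simp only [Fin.val_last]

theorem e_apply (l j : ℕ) (i : Fin l) : e l j i = if i.val + 1 = j then 1 else 0 := rfl

theorem sgnFirst_mul_e {l : ℕ} (j : ℕ) (i : Fin l) :
    sgnFirst l i * e l j i = if j = 1 then -e l j i else e l j i := by
  rw [sgnFirst, e_apply]
  by_cases hi : i.val = 0 <;> by_cases hj : j = 1 <;> simp [hi, hj]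
  omega

theorem sgnLast_mul_e {l : ℕ} (j : ℕ) (i : Fin l) :
    sgnLast l i * e l j i = if j = l then -e l j i else e l j i := by
  rw [sgnLast, e_apply]
  by_cases hi : i.val + 1 = l <;> by_cases hj : j = l <;> simp [hi, hj]
  omega

theorem rootB_swapBlack {l : ℕ} (hl : 1 ≤ l) (v : Fin (l + 1)) (i : Fin l) :
    rootB l (swapBlack l v) i = sgnFirst l i * rootB l v i := by
  have hv := v.isLt
  have hi := i.isLt
  unfold rootB
  rw [swapBlack_val hl]
  generalize v.val = n at hv
  have he : l = 1 → e l 2 i = 0 := fun h => by rw [e_apply, if_neg (by omega)]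
  rcases Nat.lt_trichotomy n 1 with h | h | h
  · obtain rfl : n = 0 := by omega
    rcases Nat.lt_or_ge 1 l with h1 | h1
    · simp [h1, mul_add, sgnFirst_mul_e]
      ring
    · obtain rfl : l = 1 := by omega
      simp [sgnFirst_mul_e, he]
  · subst h
    rcases Nat.lt_or_ge 1 l with h1 | h1
    · simp [h1, mul_sub, sgnFirst_mul_e]
      ring
    · obtain rfl : l = 1 := by omega
      simp [sgnFirst_mul_e, he]
  · have h0 : n ≠ 0 := by omega
    have h1 : n ≠ 1 := by omega
    have h2 : l ≠ 1 := by omega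
    rcases Nat.lt_or_ge n l with h3 | h3
    · simp [h0, h1, h3, mul_sub, sgnFirst_mul_e]
    · simp [h0, h1, h2, Nat.not_lt.mpr h3, sgnFirst_mul_e]

theorem rootD_swapBlack {l : ℕ} (hl : 3 ≤ l) (v : Fin (l + 1)) (i : Fin l) :
    rootD l (swapBlack l v) i = sgnFirst l i * rootD l v i := by
  have hv := v.isLt
  have h5 : 1 < l := by omega
  have h6 : l - 1 ≠ 1 := by omega
  have h2 : l ≠ 1 := by omega
  unfold rootD
  rw [swapBlack_val h5.le]
  generalize v.val = n at hv
  rcases Nat.lt_trichotomy n 1 with h | h | h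
  · obtain rfl : n = 0 := by omega
    simp [h5, mul_add, sgnFirst_mul_e]
    ring
  · subst h
    simp [h5, mul_sub, sgnFirst_mul_e]
    ring
  · have h0 : n ≠ 0 := by omega
    have h1 : n ≠ 1 := by omega
    rcases Nat.lt_or_ge n l with h3 | h3
    · simp [h0, h1, h3, mul_sub, sgnFirst_mul_e]
    · simp [h0, h1, h2, h6, Nat.not_lt.mpr h3, mul_add, sgnFirst_mul_e]

theorem rootD_swapEnd {l : ℕ} (hl : 3 ≤ l) (v : Fin (l + 1)) (i : Fin l) :
    rootD l (swapEnd l v) i = sgnLast l i * rootD l v i := by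
  have hv := v.isLt
  have h0 : l ≠ 0 := by omega
  have h1 : l - 1 ≠ 0 := by omega
  have h2 : l - 1 < l := by omega
  have h3 : l - 1 + 1 = l := by omega
  have h4 : 1 ≠ l := by omega
  have h5 : 2 ≠ l := by omega
  have h6 : l ≠ l - 1 := by omega
  have h7 : l - 1 ≠ l := by omega
  have h8 : 0 ≠ l - 1 := by omega
  have h9 : 0 ≠ l := by omega
  unfold rootD
  rw [swapEnd_val]
  generalize v.val = n at hv
  rcases Nat.lt_trichotomy n (l - 1) with h | h | h
  · have g1 : n ≠ l - 1 := by omega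
    have g2 : n ≠ l := by omega
    have g3 : n < l := by omega
    have g4 : n + 1 ≠ l := by omega
    by_cases g0 : n = 0
    · subst g0
      simp [h8, h9, h4, h5, mul_add, sgnLast_mul_e]
    · simp [g0, g1, g2, g3, g4, mul_sub, sgnLast_mul_e]
  · subst h
    rw [if_pos rfl, if_neg h0, if_neg (lt_irrefl l), if_neg h1, if_pos h2, h3]
    simp [mul_sub, sgnLast_mul_e, h7]
  · obtain rfl : n = l := by omega
    rw [if_neg h6, if_pos rfl, if_neg h1, if_pos h2, if_neg h0, if_neg (lt_irrefl n), h3]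
    simp [mul_add, sgnLast_mul_e, h7]
    ring

/-- `m = 2l-1`: the diagram interchanging `-δ` and `φ₁`. -/
def blackDiagramB {l : ℕ} (hl : 1 ≤ l) (circled : Set (Fin (l + 1)))
    (hc : ∀ v ∈ circled, 2 ≤ v.val) : AlmostDoubleVoganDiagram (rootB l) :=
  mkDiagram (swapBlack l) (swap_swap_apply _ _) (sgnFirst l) sgnFirst_or (rootB_swapBlack hl)
    circled fun v hv => swapBlack_ne v (hc v hv)

/-- `m = 2l-2`: the diagram interchanging `-δ` and `φ₁`. -/
def blackDiagramD {l : ℕ} (hl : 3 ≤ l) (circled : Set (Fin (l + 1)))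
    (hc : ∀ v ∈ circled, 2 ≤ v.val) : AlmostDoubleVoganDiagram (rootD l) :=
  mkDiagram (swapBlack l) (swap_swap_apply _ _) (sgnFirst l) sgnFirst_or (rootD_swapBlack hl)
    circled fun v hv => swapBlack_ne v (hc v hv)

/-- `m = 2l-2`: the diagram interchanging `φ_{l-1}` and `φ_l`. -/
def endDiagramD {l : ℕ} (hl : 3 ≤ l) (circled : Set (Fin (l + 1)))
    (hc : ∀ v ∈ circled, v.val + 1 < l) : AlmostDoubleVoganDiagram (rootD l) :=
  mkDiagram (swapEnd l) (swap_swap_apply _ _) (sgnLast l) sgnLast_or (rootD_swapEnd hl)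
    circled fun v hv => swapEnd_ne v (hc v hv)

theorem swapBoth_apply {l : ℕ} (hl : 3 ≤ l) (v : Fin (l + 1)) :
    (swapBlack l * swapEnd l) ((swapBlack l * swapEnd l) v) = v := by
  have hl' : 1 ≤ l := by omega
  have hv := v.isLt
  apply Fin.ext
  simp only [Equiv.Perm.mul_apply, swapBlack_val hl', swapEnd_val]
  split_ifs <;> first | omega | (exfalso; omega)

/-- `m = 2l-2`: the diagram interchanging `-δ` and `φ₁` as well as `φ_{l-1}` and `φ_l`. -/
def bothDiagramD {l : ℕ} (hl : 3 ≤ l) (circled : Set (Fin (l + 1)))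
    (hc : ∀ v ∈ circled, 2 ≤ v.val ∧ v.val + 1 < l) : AlmostDoubleVoganDiagram (rootD l) :=
  mkDiagram (swapBlack l * swapEnd l) (swapBoth_apply hl) (fun i => sgnFirst l i * sgnLast l i)
    (fun i => by
      rcases sgnFirst_or i with h | h <;> rcases sgnLast_or i with h' | h' <;> simp [h, h'])
    (fun v i => by rw [Equiv.Perm.mul_apply, rootD_swapBlack hl, rootD_swapEnd hl, mul_assoc])
    circled fun v hv => by
      rw [Equiv.Perm.mul_apply, swapEnd_ne v (hc v hv).2, swapBlack_ne v (hc v hv).1]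

/-- The almost double Vogan diagrams of involutions of `𝔰𝔬(2,2l-1)`, `l ≥ 1`. -/
inductive EntryB (l : ℕ) : Type
  | sigma (p : ℕ) (h : 2 ≤ p ∧ p ≤ l)
  | sigmaTheta (p : ℕ) (h : 2 ≤ p ∧ p ≤ l)
  | tau (p : ℕ) (h : 1 ≤ p ∧ p ≤ l)

/-- The diagrams: `σ_p` has `φ_p` circled; `σ_pθ` has `φ_p, φ₁, -δ` circled; `τ_p` (and `τ_pθ`)
interchanges `φ₁` and `-δ`, with `φ_p` circled if `p ≥ 2` and no circle if `p = 1`. -/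
def EntryB.diagram {l : ℕ} : EntryB l → AlmostDoubleVoganDiagram (rootB l)
  | .sigma p _ => fixDiagram {v | v.val = p}
  | .sigmaTheta p _ => fixDiagram {v | v.val = p ∨ v.val = 1 ∨ v.val = 0}
  | .tau p h => blackDiagramB (h.1.trans h.2) {v | v.val = p ∧ 2 ≤ p} fun _ hv => hv.1 ▸ hv.2

/-- The almost double Vogan diagrams of involutions of `𝔰𝔬(2,2l-2)`, `l ≥ 3`. -/
inductive EntryD (l : ℕ) : Type
  | sigma (p : ℕ) (h : 2 ≤ p ∧ p + 2 ≤ l)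
  | sigmaTheta (p : ℕ) (h : 2 ≤ p ∧ p + 2 ≤ l)
  | tau (p : ℕ) (h : 1 ≤ p ∧ p + 2 ≤ l)
  | mu (p : ℕ) (h : 1 ≤ p ∧ p + 2 ≤ l)
  | tau' (p : ℕ) (h : 1 ≤ p ∧ p + 2 ≤ l)
  | tau'Theta (p : ℕ) (h : 1 ≤ p ∧ p + 2 ≤ l)
  | sigmaLast (h : 3 ≤ l)
  | sigmaLastTheta (h : 3 ≤ l)
  | sigmaPrelast (h : 3 ≤ l)
  | sigmaPrelastTheta (h : 3 ≤ l)
  | sigma0 (h : l = 3)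
  | sigma0Theta (h : l = 3)
  | sigma0' (h : l = 3)

/-- The diagrams. Trivial automorphism: `σ_p`, `σ_pθ` as before; `σ_l` has `φ_l, φ₁` circled and
`σ_lθ` has `φ_l, -δ` circled; likewise `σ_{l-1}` and `σ_{l-1}θ` with `φ_{l-1}`; for `l = 3`, `σ₀`
has `φ₂, φ₃` circled and `σ₀θ` has all vertices circled. Interchanging `φ₁` and `-δ`: `τ_p` with
`φ_p` circled if `p ≥ 2`, and, for `l = 3`, `σ₀'` with `φ₂, φ₃` circled. Interchanging `φ_{l-1}`
and `φ_l`: `τ'_p` with `φ_p` circled if `p ≥ 2`, and `τ'_pθ` with in addition `φ₁, -δ` circled.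
Both interchanges: `μ_p` with `φ_p` circled if `p ≥ 2`. -/
def EntryD.diagram {l : ℕ} : EntryD l → AlmostDoubleVoganDiagram (rootD l)
  | .sigma p _ => fixDiagram {v | v.val = p}
  | .sigmaTheta p _ => fixDiagram {v | v.val = p ∨ v.val = 1 ∨ v.val = 0}
  | .tau p h => blackDiagramD (by omega) {v | v.val = p ∧ 2 ≤ p} fun _ hv => hv.1 ▸ hv.2
  | .mu p h => bothDiagramD (by omega) {v | v.val = p ∧ 2 ≤ p} fun v hv => by
      obtain ⟨h1, h2⟩ := hv
      omega
  | .tau' p h => endDiagramD (by omega) {v | v.val = p ∧ 2 ≤ p} fun v hv => by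
      obtain ⟨h1, h2⟩ := hv
      omega
  | .tau'Theta p h => endDiagramD (by omega) {v | (v.val = p ∧ 2 ≤ p) ∨ v.val = 1 ∨ v.val = 0}
      fun v hv => by
        rcases hv with ⟨h1, h2⟩ | h1 | h1 <;> omega
  | .sigmaLast _ => fixDiagram {v | v.val = l ∨ v.val = 1}
  | .sigmaLastTheta _ => fixDiagram {v | v.val = l ∨ v.val = 0}
  | .sigmaPrelast _ => fixDiagram {v | v.val = l - 1 ∨ v.val = 1}
  | .sigmaPrelastTheta _ => fixDiagram {v | v.val = l - 1 ∨ v.val = 0}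
  | .sigma0 _ => fixDiagram {v | v.val = 2 ∨ v.val = 3}
  | .sigma0Theta _ => fixDiagram Set.univ
  | .sigma0' h => blackDiagramD (by omega) {v | v.val = 2 ∨ v.val = 3} fun v hv => by
      rcases hv with h1 | h1 <;> omega

/-- The almost double Vogan diagrams of involutions of `𝔰𝔬(2,2)`. -/
inductive EntryD2 : Type
  | sigma1 | sigma1Theta | eta1 | eta1Theta | eta2 | eta2Theta | mu1 | tau1' | tau1

/-- `φ₁ ↔ -φ₁`, the other two vertices fixed. -/
def negFirst : Equiv.Perm (Fin 2 × Bool) := Equiv.swap (0, true) (0, false)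

/-- `φ₂ ↔ -φ₂`, the other two vertices fixed. -/
def negSecond : Equiv.Perm (Fin 2 × Bool) := Equiv.swap (1, true) (1, false)

/-- `φ₁ ↔ φ₂` and `-φ₁ ↔ -φ₂`. -/
def exchange : Equiv.Perm (Fin 2 × Bool) :=
  Equiv.swap (0, true) (1, true) * Equiv.swap (0, false) (1, false)

/-- `φ₁ ↔ -φ₂` and `-φ₁ ↔ φ₂`. -/
def exchangeNeg : Equiv.Perm (Fin 2 × Bool) :=
  Equiv.swap (0, true) (1, false) * Equiv.swap (0, false) (1, true)

/-- The diagram interchanging `φ₁` and `-φ₁`, with `±φ₂` circled according to `c`. -/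
def negFirstDiagram (c : Prop) : AlmostDoubleVoganDiagram rootD2 where
  aut := negFirst
  aut_aut := by decide
  cartan_aut := by decide
  color_aut := by unfold IsNoncompact; decide
  circled := {v | v.1 = 1 ∧ c}
  circled_fixed := fun v hv => by
    have h : ∀ w : Fin 2 × Bool, w.1 = 1 → negFirst w = w := by decide
    exact h v hv.1

/-- The diagram interchanging `φ₂` and `-φ₂`, with `±φ₁` circled according to `c`. -/
def negSecondDiagram (c : Prop) : AlmostDoubleVoganDiagram rootD2 where
  aut := negSecond
  aut_aut := by decide
  cartan_aut := by decide
  color_aut := by unfold IsNoncompact; decide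
  circled := {v | v.1 = 0 ∧ c}
  circled_fixed := fun v hv => by
    have h : ∀ w : Fin 2 × Bool, w.1 = 0 → negSecond w = w := by decide
    exact h v hv.1

/-- The diagrams: `σ₁` fixes all vertices, with `±φ₁` circled, and `σ₁θ` the same with `±φ₂`
circled; `η₁`, `η₁θ`, `η₂`, `η₂θ`; `μ₁` exchanges `φ₁, -φ₁` and `φ₂, -φ₂`; `τ₁'` exchanges
`φ₁, φ₂` and `-φ₁, -φ₂`; `τ₁` exchanges `φ₁, -φ₂` and `-φ₁, φ₂`. -/
def EntryD2.diagram : EntryD2 → AlmostDoubleVoganDiagram rootD2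
  | .sigma1 => fixDiagram {v | v.1 = 0}
  | .sigma1Theta => fixDiagram {v | v.1 = 1}
  | .eta1 => negFirstDiagram False
  | .eta1Theta => negFirstDiagram True
  | .eta2 => negSecondDiagram False
  | .eta2Theta => negSecondDiagram True
  | .mu1 =>
    { aut := negFirst * negSecond
      aut_aut := by decide
      cartan_aut := by decide
      color_aut := by unfold IsNoncompact; decide
      circled := ∅
      circled_fixed := by simp }
  | .tau1' =>
    { aut := exchange
      aut_aut := by decide
      cartan_aut := by decide
      color_aut := by unfold IsNoncompact; decide
      circled := ∅
      circled_fixed := by simp }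
  | .tau1 =>
    { aut := exchangeNeg
      aut_aut := by decide
      cartan_aut := by decide
      color_aut := by unfold IsNoncompact; decide
      circled := ∅
      circled_fixed := by simp }

/-! ### The Cartan subalgebras, the root vectors and the diagram of an automorphism -/

/-- The elementary matrix `E_{ij}`, with rows and columns numbered from `1`. -/
def E (R : Type*) [CommRing R] (n i j : ℕ) : Matrix (Fin n) (Fin n) R :=
  Matrix.of fun a b => if a.val + 1 = i ∧ b.val + 1 = j then 1 else 0

/-- `F_{ij} = E_{ij} - E_{ji}`. -/
def F (R : Type*) [CommRing R] (n i j : ℕ) : Matrix (Fin n) (Fin n) R := E R n i j - E R n j i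

theorem F_mem (R : Type*) [CommRing R] (m i j : ℕ) (h : i ≤ 2 ↔ j ≤ 2) :
    F R (m + 2) i j ∈ so R m := by
  rw [mem_skewAdjointMatricesLieSubalgebra, mem_skewAdjointMatricesSubmodule]
  change (F R (m + 2) i j)ᵀ * formMatrix R m = formMatrix R m * -(F R (m + 2) i j)
  ext a b
  rw [formMatrix, Matrix.mul_diagonal, Matrix.diagonal_mul]
  simp only [F, E, Matrix.transpose_apply, Matrix.sub_apply, Matrix.neg_apply, Matrix.of_apply]
  split_ifs <;> first | (exfalso; omega) | simp

/-- A Cartan subalgebra of `𝔤` inside `𝔨`, given by a basis `T_j` of the maximal abelian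
subalgebra `𝔱₀ = ∑ ℝ T_j` of `𝔨₀` and by the numbers `κ_j = e_j(T_j)` (with `e_j(T_k) = 0` for
`j ≠ k`), and explicit root vectors `E_α` for the positive roots `α`, indexed by `P`. -/
structure CartanData (m l : ℕ) (P : Type) where
  T : Fin l → so ℝ m
  kappa : Fin l → ℂ
  simple : Fin l → Fin l → ℤ
  posRoot : P → Fin l → ℤ
  rootVec : P → Matrix (Fin (m + 2)) (Fin (m + 2)) ℂ

namespace CartanData

variable {m l : ℕ} {P : Type} (C : CartanData m l P)

/-- The element `∑ c_j T_j` of `𝔱₀`. -/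
noncomputable def torusElt (c : Fin l → ℝ) : so ℝ m := ∑ j, c j • C.T j

/-- The value of the root `α` at `∑ c_j T_j`. -/
noncomputable def rootVal (α : Fin l → ℤ) (c : Fin l → ℝ) : ℂ :=
  ∑ j, (α j : ℂ) * (c j : ℂ) * C.kappa j

/-- `X + iY` lies in the root space `𝔤^α`: `[H, X + iY] = α(H)(X + iY)` for all `H ∈ 𝔱₀`. -/
def InRootSpace (α : Fin l → ℤ) (X Y : so ℝ m) : Prop :=
  ∀ c : Fin l → ℝ, ⁅cplx (C.torusElt c) 0, cplx X Y⁆ = C.rootVal α c • cplx X Y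

/-- The automorphism `s` of `𝔤₀` has the almost double Vogan diagram `D`: it preserves `𝔱₀`, it
acts on the vertices through `D.aut` (the root `D.aut ψ` is `ψ ∘ s⁻¹`), and its complex linear
extension `X + iY ↦ s(X) + i s(Y)` is `-id`, respectively `id`, on the root space of each fixed
vertex that is circled, respectively uncircled. -/
def HasDiagram (s : so ℝ m ≃ₗ⁅ℝ⁆ so ℝ m) {V : Type} {root : V → Fin l → ℤ}
    (D : AlmostDoubleVoganDiagram root) : Prop :=
  (∀ c : Fin l → ℝ, ∃ c' : Fin l → ℝ, s (C.torusElt c) = C.torusElt c' ∧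
    ∀ v, C.rootVal (root (D.aut v)) c' = C.rootVal (root v) c) ∧
  (∀ v, D.aut v = v → v ∈ D.circled → ∀ X Y : so ℝ m, C.InRootSpace (root v) X Y →
    cplx (s X) (s Y) = -cplx X Y) ∧
  (∀ v, D.aut v = v → v ∉ D.circled → ∀ X Y : so ℝ m, C.InRootSpace (root v) X Y →
    cplx (s X) (s Y) = cplx X Y)

/-! ### The basis of `𝔤₀` and the arithmetic lattice -/

/-- `E_{-α}` for a positive root `α`: the complex conjugate of `E_α`, with the sign `-1` if `α` is
compact. -/
noncomputable def negRootVec (p : P) : Matrix (Fin (m + 2)) (Fin (m + 2)) ℂ :=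
  open Classical in
  (if IsNoncompact (C.posRoot p) then (1 : ℂ) else -1) • (C.rootVec p).map (starRingEnd ℂ)

/-- `H_α^* = 2H_α/α(H_α)`, the element `H` of `𝔥` with `β(H) = 2(β,α)/(α,α)` for all roots `β`. -/
noncomputable def coroot (α : Fin l → ℤ) : Matrix (Fin (m + 2)) (Fin (m + 2)) ℂ :=
  ∑ j, (2 * (α j : ℂ) / (pairing α α : ℂ) * (C.kappa j)⁻¹) • (C.T j).1.map Complex.ofReal

/-- The basis `B_𝔨 ∪ v B_n` of `𝔤₀`, where `B_𝔨` consists of the `i H_φ^*` for `φ` simple and of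
`X_α, Y_α` for `α` positive compact, and `B_n` consists of `iX_α, iY_α` for `α` positive
non-compact; here `X_α = E_α - E_{-α}` and `Y_α = i(E_α + E_{-α})`. In the index, `true` stands
for `X` and `false` for `Y`. -/
noncomputable def basisVec (v : ℝ) : Fin l ⊕ P × Bool → Matrix (Fin (m + 2)) (Fin (m + 2)) ℂ
  | .inl j => Complex.I • C.coroot (C.simple j)
  | .inr (p, b) =>
    open Classical in
    (if IsNoncompact (C.posRoot p) then (v : ℂ) * Complex.I else 1) •
      (if b then C.rootVec p - C.negRootVec p
        else Complex.I • (C.rootVec p + C.negRootVec p))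

/-- The arithmetic lattice in `Aut(𝔤₀)`: the automorphisms whose matrix with respect to the basis
`B_𝔨 ∪ v B_n`, `v = √u`, lies in `GL(N, 𝒪)`, where `𝒪` is the ring of integers of the number
field `K`, viewed as a subfield of `ℝ` through `ι`. -/
def lattice [Fintype P] [DecidableEq P] {K : Type*} [Field K] (ι : K →+* ℝ) (u : K) :
    Set (so ℝ m ≃ₗ⁅ℝ⁆ so ℝ m) :=
  {a | ∃ b : Fin l ⊕ P × Bool → so ℝ m, (∀ i, cplx (b i) 0 = C.basisVec (Real.sqrt (ι u)) i) ∧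
    ∃ M : GL (Fin l ⊕ P × Bool) (𝓞 K), ∀ j, a (b j) = ∑ i, ι (M.1 i j : K) • b i}

end CartanData

/-- The isomorphism `f : 𝔰𝔬(m+2,ℂ) → 𝔤` multiplying the upper right `2 × m` block by `i` and the
lower left `m × 2` block by `-i`. -/
noncomputable def f {m : ℕ} (Z : Matrix (Fin (m + 2)) (Fin (m + 2)) ℂ) :
    Matrix (Fin (m + 2)) (Fin (m + 2)) ℂ :=
  Matrix.of fun a b =>
    if a.val < 2 ∧ 2 ≤ b.val then Complex.I * Z a b
    else if 2 ≤ a.val ∧ b.val < 2 then -Complex.I * Z a b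
    else Z a b

/-- The pairs `j < k`; together with a sign they index the positive roots `e_j ± e_k`
(`true` for `+`). -/
abbrev LongRoot (l : ℕ) : Type := {q : Fin l × Fin l // q.1 < q.2} × Bool

/-- The root `e_j ± e_k`. -/
def longRoot {l : ℕ} (p : LongRoot l) : Fin l → ℤ :=
  if p.2 then e l (p.1.1.1.val + 1) + e l (p.1.1.2.val + 1)
  else e l (p.1.1.1.val + 1) - e l (p.1.1.2.val + 1)

/-- `H_j = F_{2j-1,2j}` as an element of `𝔤₀`; here `j` is numbered from `0`. -/
def H {l : ℕ} (m : ℕ) (j : Fin l) : so ℝ m :=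
  ⟨F ℝ (m + 2) (2 * j.val + 1) (2 * j.val + 2), F_mem ℝ m _ _ (by omega)⟩

/-- `G_{jk}^+`, spanning the root space of `e_j - e_k`; `j < k` are numbered from `1`. -/
noncomputable def Gplus (m j k : ℕ) : Matrix (Fin (m + 2)) (Fin (m + 2)) ℂ :=
  f (F ℂ (m + 2) (2 * j - 1) (2 * k - 1) + F ℂ (m + 2) (2 * j) (2 * k) +
    Complex.I • (F ℂ (m + 2) (2 * j - 1) (2 * k) - F ℂ (m + 2) (2 * j) (2 * k - 1)))

/-- `G_{jk}^-`, spanning the root space of `e_j + e_k`; `j < k` are numbered from `1`. -/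
noncomputable def Gminus (m j k : ℕ) : Matrix (Fin (m + 2)) (Fin (m + 2)) ℂ :=
  f (-F ℂ (m + 2) (2 * j - 1) (2 * k - 1) + F ℂ (m + 2) (2 * j) (2 * k) +
    Complex.I • (F ℂ (m + 2) (2 * j - 1) (2 * k) + F ℂ (m + 2) (2 * j) (2 * k - 1)))

/-- `D_j^+` for `m = 2l-1`, spanning the root space of `e_j`; `j` is numbered from `1`. -/
noncomputable def Dplus (m l j : ℕ) : Matrix (Fin (m + 2)) (Fin (m + 2)) ℂ :=
  f (-F ℂ (m + 2) (2 * j - 1) (2 * l + 1) + Complex.I • F ℂ (m + 2) (2 * j) (2 * l + 1))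

/-- The root vector `½ G_{jk}^±` of a root `e_j ∓ e_k`. -/
noncomputable def longVec (m : ℕ) {l : ℕ} (p : LongRoot l) :
    Matrix (Fin (m + 2)) (Fin (m + 2)) ℂ :=
  (1 / 2 : ℂ) • (if p.2 then Gminus m (p.1.1.1.val + 1) (p.1.1.2.val + 1)
    else Gplus m (p.1.1.1.val + 1) (p.1.1.2.val + 1))

/-- The data for `m = 2l-1` and `𝔱₀ = ∑ ℝ H_j`, with `e_j(H_j) = -i`. -/
noncomputable def dataB (m l : ℕ) : CartanData m l (LongRoot l ⊕ Fin l) where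
  T := H m
  kappa := fun _ => -Complex.I
  simple := fun j => rootB l j.succ
  posRoot := Sum.elim longRoot fun j => e l (j.val + 1)
  rootVec := Sum.elim (longVec m) fun j => Dplus m l (j.val + 1)

/-- The data for `m = 2l-2` and `𝔱₀ = ∑ ℝ H_j`, with `e_j(H_j) = -i`. -/
noncomputable def dataD (m l : ℕ) : CartanData m l (LongRoot l) where
  T := H m
  kappa := fun _ => -Complex.I
  simple := fun j => rootD l j.succ
  posRoot := longRoot
  rootVec := longVec m

/-- The basis `H_1, F_{1+j,l+j}` (`2 ≤ j ≤ l`) of `𝔱₀'` for `m = 2l-2`; here `j` is numbered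
from `0`. -/
def H' {l : ℕ} (m : ℕ) (j : Fin l) : so ℝ m :=
  if h : j.val = 0 then ⟨F ℝ (m + 2) 1 2, F_mem ℝ m _ _ (by omega)⟩
  else ⟨F ℝ (m + 2) (j.val + 2) (l + j.val + 1), F_mem ℝ m _ _ (by omega)⟩

/-- `G'_{jk}^+`, spanning the root space of `ε_j - ε_k`; `j < k` are numbered from `1`. -/
noncomputable def Gplus' (m l j k : ℕ) : Matrix (Fin (m + 2)) (Fin (m + 2)) ℂ :=
  if j = 1 then
    f (F ℂ (m + 2) 1 (l + k) + F ℂ (m + 2) 2 (1 + k) +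
      Complex.I • (F ℂ (m + 2) 1 (1 + k) - F ℂ (m + 2) 2 (l + k)))
  else
    -F ℂ (m + 2) (1 + j) (1 + k) - F ℂ (m + 2) (l + j) (l + k) +
      Complex.I • (F ℂ (m + 2) (1 + j) (l + k) + F ℂ (m + 2) (1 + k) (l + j))

/-- `G'_{jk}^-`, spanning the root space of `ε_j + ε_k`; `j < k` are numbered from `1`. -/
noncomputable def Gminus' (m l j k : ℕ) : Matrix (Fin (m + 2)) (Fin (m + 2)) ℂ :=
  if j = 1 then
    f (-F ℂ (m + 2) 1 (l + k) + F ℂ (m + 2) 2 (1 + k) +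
      Complex.I • (F ℂ (m + 2) 1 (1 + k) + F ℂ (m + 2) 2 (l + k)))
  else
    -F ℂ (m + 2) (1 + j) (1 + k) + F ℂ (m + 2) (l + j) (l + k) +
      Complex.I • (-F ℂ (m + 2) (1 + j) (l + k) + F ℂ (m + 2) (1 + k) (l + j))

/-- The root vector `½ G'_{jk}^±` of a root `ε_j ∓ ε_k`. -/
noncomputable def longVec' (m : ℕ) {l : ℕ} (p : LongRoot l) :
    Matrix (Fin (m + 2)) (Fin (m + 2)) ℂ :=
  (1 / 2 : ℂ) • (if p.2 then Gminus' m l (p.1.1.1.val + 1) (p.1.1.2.val + 1)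
    else Gplus' m l (p.1.1.1.val + 1) (p.1.1.2.val + 1))

/-- The data for `m = 2l-2` and `𝔱₀' = ℝ H_1 + ∑ ℝ F_{1+j,l+j}`, with `ε_1(H_1) = -i` and
`ε_j(F_{1+j,l+j}) = i` for `j ≥ 2`; coordinates of roots are with respect to the `ε_j`. -/
noncomputable def dataD' (m l : ℕ) : CartanData m l (LongRoot l) where
  T := H' m
  kappa := fun j => if j.val = 0 then -Complex.I else Complex.I
  simple := fun j => rootD l j.succ
  posRoot := longRoot
  rootVec := longVec' m

end SO2m

namespace SO2m

/-! ### Conjugation by signed permutation matrices -/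

/-! Every diagram is realised with respect to `𝔱₀` by conjugation with a signed permutation matrix
`A`, where `A² = ±1` and `A I_{2,m} Aᵗ = ± I_{2,m}`. These two sign conditions make the conjugation
an involution of `SO₀(2,m)` commuting with `θ`. Its differential is the same conjugation on `𝔤₀`,
since conjugation commutes with the exponential. What remains is to choose `A`, to read off the
diagram and to check integrality.

Three families of matrices suffice. A diagonal sign matrix (`diagPerm`) multiplies `H_j` by the
product of the two signs in the `j`-th coordinate plane, so it acts on roots by sign changes of the
`e_j`. It multiplies the entry `(a,b)` by `ε_a ε_b`. A root space lives only on the entries joining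
the two coordinate blocks that the root involves (`InRootSpace.support`), so on a vertex fixed by
`d` the sign is read off from `ε` (`diagPerm_hasDiagram`).

For `m + 2 = 2l` the matrix `A = ∑ c_j H_j` with `c_j = ±1` (`rotPerm`) lies in `𝔱₀` and satisfies
`A² = -1`. It centralises `𝔱₀`. It commutes with `𝔤^α` if `∑ α_j c_j = 0` and anticommutes with it
otherwise, so the circled vertices are those with `∑ α_j c_j ≠ 0` (`rotPerm_hasDiagram`). This gives
the diagrams in which just one of `φ_{l-1}, φ_l` is circled.

For `m = 2` the two coordinate planes have equal dimension and may be exchanged by a matrix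
anticommuting with `I_{2,2}` (`swapPerm`). This gives the diagrams that negate one of `φ₁, φ₂` and
fix the other.

Integrality (`CartanData.mem_lattice`) holds because `A` carries each `E_α` to `± E_{±β}` with `α`,
`β` both compact or both non-compact. Hence the vectors `X_α, Y_α`, with or without the factor `v
i`, are permuted up to sign. On the coroots `A` acts by an integral involution preserving the coroot
lattice, and such a map has a unimodular matrix (`exists_unimodular`). The whole matrix thus has
integer entries and an integer inverse, so it lies in `GL(N, 𝒪)`. -/

/-- The diagonal entries of `I_{2,m}`. -/
def formUnit {n : ℕ} (a : Fin n) : ℤˣ := if a.val < 2 then -1 else 1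

theorem formMatrix_eq (R : Type*) [CommRing R] (m : ℕ) :
    formMatrix R m = Matrix.diagonal fun i => ((formUnit i : ℤ) : R) := by
  unfold formMatrix formUnit
  congr 1
  funext i
  split_ifs <;> simp

theorem cast_unit_mul_self (R : Type*) [CommRing R] (x : ℤˣ) :
    ((x : ℤ) : R) * ((x : ℤ) : R) = 1 := by
  rw [← Int.cast_mul, ← Units.val_mul, Int.units_mul_self, Units.val_one, Int.cast_one]

/-- The data of a signed permutation matrix which squares to `±1` and commutes or anticommutes
with `I_{2,m}`. -/
structure SignedPerm (m : ℕ) where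
  perm : Fin (m + 2) → Fin (m + 2)
  sign : Fin (m + 2) → ℤˣ
  perm_perm : Function.Involutive perm
  square : ℤˣ
  sign_mul : ∀ a, sign a * sign (perm a) = square
  formSign : ℤˣ
  form_perm : ∀ a, formUnit (perm a) = formSign * formUnit a

namespace SignedPerm

variable {m : ℕ} (S : SignedPerm m) (R : Type*) [CommRing R]

/-- The signed permutation matrix. -/
def toMatrix : Matrix (Fin (m + 2)) (Fin (m + 2)) R :=
  Matrix.of fun a b => if S.perm a = b then ((S.sign a : ℤ) : R) else 0

theorem perm_eq_comm {a b : Fin (m + 2)} : S.perm a = b ↔ a = S.perm b :=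
  S.perm_perm.eq_iff

theorem toMatrix_mul_apply (Z : Matrix (Fin (m + 2)) (Fin (m + 2)) R) (a b : Fin (m + 2)) :
    (S.toMatrix R * Z) a b = ((S.sign a : ℤ) : R) * Z (S.perm a) b := by
  simp [Matrix.mul_apply, toMatrix]

theorem mul_transpose_apply (Z : Matrix (Fin (m + 2)) (Fin (m + 2)) R) (a b : Fin (m + 2)) :
    (Z * (S.toMatrix R)ᵀ) a b = ((S.sign b : ℤ) : R) * Z a (S.perm b) := by
  simp [Matrix.mul_apply, toMatrix, mul_comm]

theorem toMatrix_mul_transpose : S.toMatrix R * (S.toMatrix R)ᵀ = 1 := by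
  ext a b
  rw [mul_transpose_apply, toMatrix, Matrix.of_apply, Matrix.one_apply]
  simp only [S.perm_perm.injective.eq_iff]
  split_ifs with h
  · rw [h, cast_unit_mul_self]
  · simp

theorem transpose_mul_toMatrix : (S.toMatrix R)ᵀ * S.toMatrix R = 1 :=
  mul_eq_one_comm.mp (S.toMatrix_mul_transpose R)

/-- The entries of the conjugate of `Z` by the signed permutation matrix. -/
def conjFun (Z : Matrix (Fin (m + 2)) (Fin (m + 2)) R) : Matrix (Fin (m + 2)) (Fin (m + 2)) R :=
  Matrix.of fun a b =>
    ((S.sign a : ℤ) : R) * ((S.sign b : ℤ) : R) * Z (S.perm a) (S.perm b)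

theorem conjFun_eq (Z : Matrix (Fin (m + 2)) (Fin (m + 2)) R) :
    S.conjFun R Z = S.toMatrix R * Z * (S.toMatrix R)ᵀ := by
  ext a b
  rw [mul_transpose_apply, toMatrix_mul_apply, conjFun, Matrix.of_apply]
  ring

/-- Both sign products `sign a * sign (perm a)` equal the constant `square`, so they cancel. A
matrix squaring to `-1` therefore serves as well as one squaring to `1`. -/
theorem conjFun_conjFun (Z : Matrix (Fin (m + 2)) (Fin (m + 2)) R) :
    S.conjFun R (S.conjFun R Z) = Z := by
  ext a b
  simp only [conjFun, Matrix.of_apply, S.perm_perm a, S.perm_perm b]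
  have h : ∀ a, ((S.sign a : ℤ) : R) * ((S.sign (S.perm a) : ℤ) : R) = ((S.square : ℤ) : R) := by
    intro a
    rw [← S.sign_mul a]
    push_cast
    rfl
  calc _ = (((S.sign a : ℤ) : R) * ((S.sign (S.perm a) : ℤ) : R)) *
        (((S.sign b : ℤ) : R) * ((S.sign (S.perm b) : ℤ) : R)) * Z a b := by ring
    _ = Z a b := by rw [h, h, cast_unit_mul_self, one_mul]

/-- Conjugation by the signed permutation matrix. -/
def conj : Matrix (Fin (m + 2)) (Fin (m + 2)) R ≃ₐ[R] Matrix (Fin (m + 2)) (Fin (m + 2)) R where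
  toFun := S.conjFun R
  invFun := S.conjFun R
  left_inv := S.conjFun_conjFun R
  right_inv := S.conjFun_conjFun R
  map_mul' X Y := by
    simp only [conjFun_eq]
    calc _ = S.toMatrix R * X * 1 * Y * (S.toMatrix R)ᵀ := by
          simp only [Matrix.mul_assoc, Matrix.mul_one]
      _ = _ := by rw [← S.transpose_mul_toMatrix R]; simp only [Matrix.mul_assoc]
  map_add' X Y := by simp only [conjFun_eq, Matrix.mul_add, Matrix.add_mul]
  commutes' r := by
    simp only [conjFun_eq]
    rw [← Algebra.commutes, Matrix.mul_assoc, toMatrix_mul_transpose, Matrix.mul_one]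

theorem conj_apply (Z : Matrix (Fin (m + 2)) (Fin (m + 2)) R) (a b : Fin (m + 2)) :
    S.conj R Z a b = ((S.sign a : ℤ) : R) * ((S.sign b : ℤ) : R) * Z (S.perm a) (S.perm b) := rfl

theorem conj_eq (Z : Matrix (Fin (m + 2)) (Fin (m + 2)) R) :
    S.conj R Z = S.toMatrix R * Z * (S.toMatrix R)ᵀ := S.conjFun_eq R Z

theorem conj_conj (Z : Matrix (Fin (m + 2)) (Fin (m + 2)) R) : S.conj R (S.conj R Z) = Z :=
  S.conjFun_conjFun R Z

theorem conj_transpose (Z : Matrix (Fin (m + 2)) (Fin (m + 2)) R) :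
    S.conj R Zᵀ = (S.conj R Z)ᵀ := by
  ext a b
  simp only [conj_apply, Matrix.transpose_apply]
  ring

theorem conj_map {R' : Type*} [CommRing R'] (φ : R →+* R')
    (Z : Matrix (Fin (m + 2)) (Fin (m + 2)) R) :
    S.conj R' (Z.map φ) = (S.conj R Z).map φ := by
  ext a b
  simp [conj_apply]

theorem conj_formMatrix :
    S.conj R (formMatrix R m) = ((S.formSign : ℤ) : R) • formMatrix R m := by
  ext a b
  simp only [formMatrix_eq, conj_apply, Matrix.smul_apply, Matrix.diagonal_apply,
    S.perm_perm.injective.eq_iff]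
  split_ifs with h
  · rw [h, cast_unit_mul_self, one_mul, S.form_perm, Units.val_mul, Int.cast_mul, smul_eq_mul]
  · simp

theorem conj_det (Z : Matrix (Fin (m + 2)) (Fin (m + 2)) R) : (S.conj R Z).det = Z.det := by
  have h := congrArg Matrix.det (S.toMatrix_mul_transpose R)
  rw [Matrix.det_mul, Matrix.det_one] at h
  rw [conj_eq, Matrix.det_mul, Matrix.det_mul, mul_right_comm, h, one_mul]

/-- Writing the form as a multiple of its own conjugate lets multiplicativity of `conj` transport
any equation involving the form. The sign `formSign` is a common factor on both sides. -/
theorem form_eq : formMatrix R m = ((S.formSign : ℤ) : R) • S.conj R (formMatrix R m) := by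
  rw [conj_formMatrix, smul_smul, cast_unit_mul_self, one_smul]

/-! ### The automorphisms of `SO₀(2,m)` and of its Lie algebra -/

theorem conj_mem_so {X : Matrix (Fin (m + 2)) (Fin (m + 2)) R} (hX : X ∈ so R m) :
    S.conj R X ∈ so R m := by
  rw [mem_skewAdjointMatricesLieSubalgebra, mem_skewAdjointMatricesSubmodule] at hX ⊢
  change Xᵀ * formMatrix R m = formMatrix R m * -X at hX
  change (S.conj R X)ᵀ * formMatrix R m = formMatrix R m * -(S.conj R X)
  rw [S.form_eq, ← conj_transpose, ← map_neg, Matrix.mul_smul, Matrix.smul_mul, ← map_mul,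
    ← map_mul, hX]

/-- Conjugation by the signed permutation matrix as an automorphism of the Lie algebra. -/
def lieEquiv : so R m ≃ₗ⁅R⁆ so R m where
  toFun X := ⟨S.conj R X.1, S.conj_mem_so R X.2⟩
  invFun X := ⟨S.conj R X.1, S.conj_mem_so R X.2⟩
  left_inv X := Subtype.ext (S.conj_conj R X.1)
  right_inv X := Subtype.ext (S.conj_conj R X.1)
  map_add' X Y := Subtype.ext (map_add (S.conj R) X.1 Y.1)
  map_smul' r X := Subtype.ext (map_smul (S.conj R) r X.1)
  map_lie' {X Y} := Subtype.ext (by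
    change S.conj R (X.1 * Y.1 - Y.1 * X.1) = _
    rw [map_sub, map_mul, map_mul]
    rfl)

theorem lieEquiv_coe (X : so R m) : (S.lieEquiv R X).1 = S.conj R X.1 := rfl

theorem conj_mem_SO {g : Matrix.SpecialLinearGroup (Fin (m + 2)) ℝ} (hg : g ∈ SO m) :
    (S.conj ℝ g.1)ᵀ * formMatrix ℝ m * S.conj ℝ g.1 = formMatrix ℝ m := by
  change g.1ᵀ * formMatrix ℝ m * g.1 = formMatrix ℝ m at hg
  rw [S.form_eq, ← conj_transpose, Matrix.mul_smul, Matrix.smul_mul, ← map_mul, ← map_mul, hg]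

/-- Conjugation on `SO(2,m)`. -/
def conjSO (g : SO m) : SO m :=
  ⟨⟨S.conj ℝ g.1.1, by rw [conj_det, g.1.2]⟩, S.conj_mem_SO g.2⟩

theorem conjSO_conjSO (g : SO m) : S.conjSO (S.conjSO g) = g :=
  Subtype.ext (Subtype.ext (S.conj_conj ℝ g.1.1))

theorem conjSO_mul (g h : SO m) : S.conjSO (g * h) = S.conjSO g * S.conjSO h := by
  apply Subtype.ext
  apply Subtype.ext
  change S.conj ℝ (g.1 * h.1).1 = _
  rw [Matrix.SpecialLinearGroup.coe_mul, map_mul]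
  rfl

theorem conjSO_one : S.conjSO 1 = 1 := by
  apply Subtype.ext
  apply Subtype.ext
  change S.conj ℝ (1 : Matrix.SpecialLinearGroup (Fin (m + 2)) ℝ).1 = _
  rw [Matrix.SpecialLinearGroup.coe_one, map_one]
  rfl

theorem continuous_conjSO : Continuous S.conjSO := by
  have h0 : Continuous fun g : SO m => g.1.1 := continuous_subtype_val.comp continuous_subtype_val
  have h : Continuous fun g : SO m => S.conj ℝ g.1.1 := by
    refine continuous_matrix fun a b => ?_
    simp only [conj_apply]
    exact continuous_const.mul (h0.matrix_elem _ _)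
  exact (h.subtype_mk _).subtype_mk _

theorem conjSO_mem {g : SO m} (hg : g ∈ SO0 m) : S.conjSO g ∈ SO0 m := by
  have h := S.continuous_conjSO.image_connectedComponent_subset 1
  rw [conjSO_one] at h
  exact h ⟨g, hg, rfl⟩

/-- Conjugation on `SO₀(2,m)`. -/
def groupEquiv : SO0 m ≃ₜ* SO0 m where
  toFun g := ⟨S.conjSO g.1, S.conjSO_mem g.2⟩
  invFun g := ⟨S.conjSO g.1, S.conjSO_mem g.2⟩
  left_inv g := Subtype.ext (S.conjSO_conjSO g.1)
  right_inv g := Subtype.ext (S.conjSO_conjSO g.1)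
  map_mul' g h := Subtype.ext (S.conjSO_mul g.1 h.1)
  continuous_toFun := (S.continuous_conjSO.comp continuous_subtype_val).subtype_mk _
  continuous_invFun := (S.continuous_conjSO.comp continuous_subtype_val).subtype_mk _

theorem mat_groupEquiv (g : SO0 m) : mat (S.groupEquiv g) = S.conj ℝ (mat g) := rfl

theorem isMatrixConjugation : IsMatrixConjugation S.groupEquiv := by
  refine ⟨⟨S.toMatrix ℝ, (S.toMatrix ℝ)ᵀ, S.toMatrix_mul_transpose ℝ,
    S.transpose_mul_toMatrix ℝ⟩, fun g => ?_⟩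
  rw [mat_groupEquiv, conj_eq]
  rfl

end SignedPerm

/-! ### The Cartan involution, exponentials and the differential of a conjugation. -/

theorem mat_injective {m : ℕ} : Function.Injective (mat (m := m)) := fun _ _ h =>
  Subtype.ext (Subtype.ext (Subtype.ext h))

theorem mat_theta {m : ℕ} (g : SO0 m) :
    mat (theta g) = formMatrix ℝ m * mat g * formMatrix ℝ m := by
  have h1 : (formElt m)⁻¹ = formElt m := by
    rw [inv_eq_iff_mul_eq_one]
    apply Subtype.ext
    apply Subtype.ext
    change (((formElt m).1 * (formElt m).1 :
      Matrix.SpecialLinearGroup (Fin (m + 2)) ℝ)).1 = (1 : Matrix.SpecialLinearGroup _ ℝ).1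
    rw [Matrix.SpecialLinearGroup.coe_mul, Matrix.SpecialLinearGroup.coe_one]
    exact formMatrix_mul_self ℝ m
  unfold theta mat
  simp only [h1]
  change (((formElt m).1 * g.1.1 * (formElt m).1 :
    Matrix.SpecialLinearGroup (Fin (m + 2)) ℝ)).1 = _
  rw [Matrix.SpecialLinearGroup.coe_mul, Matrix.SpecialLinearGroup.coe_mul]
  rfl

/-- With `I = I_{2,m}`, membership in `𝔤₀` says `Xᵗ = I (-X) I⁻¹`. Exponentiating gives `exp(X)ᵗ = I
exp(X)⁻¹ I⁻¹`. -/
theorem exp_transpose_mul_form {m : ℕ} (X : so ℝ m) :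
    (NormedSpace.exp X.1)ᵀ * formMatrix ℝ m * NormedSpace.exp X.1 = formMatrix ℝ m := by
  have hX : X.1ᵀ * formMatrix ℝ m = formMatrix ℝ m * -X.1 := by
    have := X.2
    rwa [mem_skewAdjointMatricesLieSubalgebra, mem_skewAdjointMatricesSubmodule] at this
  have hI := formMatrix_mul_self ℝ m
  have hinv : (formMatrix ℝ m)⁻¹ = formMatrix ℝ m := Matrix.inv_eq_right_inv hI
  have hu : IsUnit (formMatrix ℝ m) := IsUnit.of_mul_eq_one _ hI
  have h1 : X.1ᵀ = formMatrix ℝ m * (-X.1) * (formMatrix ℝ m)⁻¹ := by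
    rw [hinv, ← hX, Matrix.mul_assoc, hI, Matrix.mul_one]
  have hu2 : IsUnit (NormedSpace.exp X.1).det := (Matrix.isUnit_iff_isUnit_det _).mp
    (Matrix.isUnit_exp X.1)
  rw [← Matrix.exp_transpose, h1, Matrix.exp_conj _ _ hu, Matrix.exp_neg, hinv]
  rw [Matrix.mul_assoc _ _ (formMatrix ℝ m), hI, Matrix.mul_one, Matrix.mul_assoc,
    Matrix.nonsing_inv_mul _ hu2, Matrix.mul_one]

/-- Preserving the form only gives `det² = 1`. Applied to `X/2` this is the claim, because `exp X =
exp(X/2)²`. -/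
theorem exp_det {m : ℕ} (X : so ℝ m) : (NormedSpace.exp X.1).det = 1 := by
  have h := congrArg Matrix.det (exp_transpose_mul_form ((1 / 2 : ℝ) • X))
  rw [Matrix.det_mul, Matrix.det_mul, formMatrix_det, Matrix.det_transpose, mul_one,
    ← Matrix.det_mul, ← Matrix.exp_add_of_commute _ _ (Commute.refl _)] at h
  have h2 : ((1 / 2 : ℝ) • X : so ℝ m).1 + ((1 / 2 : ℝ) • X : so ℝ m).1 = X.1 := by
    change (1 / 2 : ℝ) • X.1 + (1 / 2 : ℝ) • X.1 = X.1
    rw [← add_smul]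
    norm_num
  rwa [h2] at h

/-- The exponential of an element of `𝔤₀`. -/
noncomputable def expSO {m : ℕ} (X : so ℝ m) : SO m :=
  ⟨⟨NormedSpace.exp X.1, exp_det X⟩, exp_transpose_mul_form X⟩

theorem continuous_exp_smul {n : ℕ} (X : Matrix (Fin n) (Fin n) ℝ) :
    Continuous fun t : ℝ => NormedSpace.exp (t • X) := by
  open scoped Matrix.Norms.Operator in
  exact (NormedSpace.exp_continuous (𝔸 := Matrix (Fin n) (Fin n) ℝ)).comp
    (continuous_id.smul continuous_const)

/-- The path `t ↦ exp(tX)` joins the identity to `exp X` inside `SO(2,m)`. -/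
theorem expSO_mem {m : ℕ} (X : so ℝ m) : expSO X ∈ SO0 m := by
  have hc : Continuous fun t : ℝ => expSO (t • X) :=
    ((continuous_exp_smul X.1).subtype_mk _).subtype_mk _
  have h0 : expSO ((0 : ℝ) • X) = 1 := by
    apply Subtype.ext
    apply Subtype.ext
    change NormedSpace.exp ((0 : ℝ) • X.1) = (1 : Matrix.SpecialLinearGroup (Fin (m + 2)) ℝ).1
    rw [zero_smul, NormedSpace.exp_zero, Matrix.SpecialLinearGroup.coe_one]
  have h := (isPreconnected_range hc).subset_connectedComponent ⟨0, h0⟩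
  have h1 : expSO ((1 : ℝ) • X) ∈ connectedComponent 1 := h ⟨1, rfl⟩
  rw [one_smul] at h1
  exact h1

namespace SignedPerm

variable {m : ℕ} (S : SignedPerm m)

theorem conj_exp (X : Matrix (Fin (m + 2)) (Fin (m + 2)) ℝ) :
    S.conj ℝ (NormedSpace.exp X) = NormedSpace.exp (S.conj ℝ X) := by
  have h1 := S.toMatrix_mul_transpose ℝ
  have hinv : (S.toMatrix ℝ)⁻¹ = (S.toMatrix ℝ)ᵀ := Matrix.inv_eq_right_inv h1
  rw [conj_eq, conj_eq, ← hinv, Matrix.exp_conj _ _ (IsUnit.of_mul_eq_one _ h1)]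

theorem isDifferential : IsDifferential S.groupEquiv (S.lieEquiv ℝ) := by
  intro X t
  refine ⟨⟨expSO (t • X), expSO_mem _⟩, rfl, ?_⟩
  rw [mat_groupEquiv, lieEquiv_coe, ← map_smul, ← conj_exp]
  rfl

/-- The form occurs twice in `θ`, so the sign `formSign` enters squared. -/
theorem groupEquiv_theta (g : SO0 m) : S.groupEquiv (theta g) = theta (S.groupEquiv g) := by
  apply mat_injective
  rw [mat_groupEquiv, mat_theta, mat_theta, map_mul, map_mul, mat_groupEquiv, conj_formMatrix,
    Matrix.smul_mul, Matrix.smul_mul, Matrix.mul_smul, smul_smul, cast_unit_mul_self, one_smul]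

/-- Non-triviality is tested on the Lie algebra. If the group automorphism were the identity, the
one-parameter groups of `X` and of its conjugate would coincide, and so would their derivatives at
`0`. -/
theorem isInvolution {X : so ℝ m} (hX : S.conj ℝ X.1 ≠ X.1) : IsInvolution S.groupEquiv := by
  refine ⟨?_, fun g => mat_injective (S.conj_conj ℝ (mat g))⟩
  by_contra! hg
  apply hX
  have h : ∀ t : ℝ, NormedSpace.exp (t • S.conj ℝ X.1) = NormedSpace.exp (t • X.1) := by
    intro t
    have := congrArg mat (hg ⟨expSO (t • X), expSO_mem _⟩)
    rw [mat_groupEquiv] at this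
    change S.conj ℝ (NormedSpace.exp (t • X.1)) = NormedSpace.exp (t • X.1) at this
    rw [← map_smul, ← conj_exp, this]
  open scoped Matrix.Norms.Operator in
  have hd : ∀ Y : Matrix (Fin (m + 2)) (Fin (m + 2)) ℝ,
      HasDerivAt (fun t : ℝ => NormedSpace.exp (t • Y)) Y 0 := by
    intro Y
    have := hasDerivAt_exp_smul_const (𝕂 := ℝ) Y (0 : ℝ)
    rwa [zero_smul, NormedSpace.exp_zero, one_mul] at this
  have h1 := hd (S.conj ℝ X.1)
  simp only [h] at h1
  exact h1.unique (hd X.1)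

end SignedPerm

/-! ### A criterion for membership in the arithmetic lattice -/

/-- An integral linear involution preserving a full rank lattice acts on it by a unimodular
matrix. -/
theorem exists_unimodular {l : ℕ} (w : Fin l → Fin l → ℤ)
    (h2 : ∀ k, (2 : ℤ) • (Pi.single k 1 : Fin l → ℤ) ∈ Submodule.span ℤ (Set.range w))
    (T : Matrix (Fin l) (Fin l) ℤ) (hTT : T * T = 1)
    (hT : ∀ j, T *ᵥ w j ∈ Submodule.span ℤ (Set.range w)) :
    ∃ M : GL (Fin l) ℤ, ∀ j, T *ᵥ w j = ∑ i, M.1 i j • w i := by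
  simp only [Submodule.mem_span_range_iff_exists_fun] at h2 hT
  choose R hR using h2
  choose M hM using hT
  let W : Matrix (Fin l) (Fin l) ℤ := Matrix.of fun k j => w j k
  -- With the `w j` as columns of `W`, the hypotheses become `W R = 2` and `T W = W M`. The first
  -- gives `det W ≠ 0`; then the second gives `det M = det T`, a unit since `T² = 1`.
  have hWR : W * Matrix.of (fun i k => R k i) = (2 : ℤ) • (1 : Matrix (Fin l) (Fin l) ℤ) := by
    ext a k
    have := congrFun (hR k) a
    simp only [Finset.sum_apply, Pi.smul_apply, smul_eq_mul] at this
    rw [Matrix.mul_apply, Matrix.smul_apply, Matrix.one_apply]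
    simp only [W, Matrix.of_apply]
    rw [Finset.sum_congr rfl fun i _ => mul_comm _ _, this]
    simp [Pi.single_apply]
  have hWM : T * W = W * Matrix.of (fun i k => M k i) := by
    ext a k
    have := congrFun (hM k) a
    simp only [Finset.sum_apply, Pi.smul_apply, smul_eq_mul] at this
    rw [Matrix.mul_apply, Matrix.mul_apply]
    simp only [W, Matrix.of_apply]
    rw [Finset.sum_congr rfl fun i _ => mul_comm (w i a) _, this]
    rfl
  have hW : W.det ≠ 0 := by
    intro h0
    have := congrArg Matrix.det hWR
    rw [Matrix.det_mul, h0, zero_mul, Matrix.det_smul, Matrix.det_one, mul_one] at this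
    exact pow_ne_zero _ two_ne_zero this.symm
  have hdet := congrArg Matrix.det hWM
  rw [Matrix.det_mul, Matrix.det_mul, mul_comm] at hdet
  have hdet := mul_left_cancel₀ hW hdet
  have hu : IsUnit (Matrix.of (fun i k => M k i)).det := by
    rw [← hdet]
    have := congrArg Matrix.det hTT
    rw [Matrix.det_mul, Matrix.det_one] at this
    exact IsUnit.of_mul_eq_one _ this
  exact ⟨Matrix.GeneralLinearGroup.mk'' _ hu, fun j => (hM j).symm⟩

/-! ### Passage between `𝔤₀` and its complexification. -/

section Complexification

variable {m : ℕ}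

theorem mem_so_iff {R : Type*} [CommRing R] {X : Matrix (Fin (m + 2)) (Fin (m + 2)) R} :
    X ∈ so R m ↔ Xᵀ * formMatrix R m = -(formMatrix R m * X) := by
  rw [mem_skewAdjointMatricesLieSubalgebra, mem_skewAdjointMatricesSubmodule, ← Matrix.mul_neg]
  rfl

theorem mem_so_iff_apply {R : Type*} [CommRing R] {X : Matrix (Fin (m + 2)) (Fin (m + 2)) R} :
    X ∈ so R m ↔ ∀ a b, X b a * ((formUnit b : ℤ) : R) = -(((formUnit a : ℤ) : R) * X a b) := by
  rw [mem_so_iff, formMatrix_eq, ← Matrix.ext_iff]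
  simp only [Matrix.mul_diagonal, Matrix.diagonal_mul, Matrix.neg_apply, Matrix.transpose_apply]

theorem map_mem_so {R R' : Type*} [CommRing R] [CommRing R'] (φ : R →+* R')
    {X : Matrix (Fin (m + 2)) (Fin (m + 2)) R} (hX : X ∈ so R m) : X.map φ ∈ so R' m := by
  rw [mem_so_iff_apply] at hX ⊢
  intro a b
  have := congrArg φ (hX a b)
  simpa using this

theorem cplx_zero_right (X : so ℝ m) : cplx X 0 = X.1.map Complex.ofReal := by
  unfold cplx
  ext a b
  simp

theorem ofReal_map_injective {n : ℕ} : Function.Injective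
    fun X : Matrix (Fin n) (Fin n) ℝ => X.map Complex.ofReal := by
  intro X Y h
  ext a b
  have := congrFun (congrFun h a) b
  simpa using this

theorem exists_real_of_map_conj {Z : Matrix (Fin (m + 2)) (Fin (m + 2)) ℂ} (hZ : Z ∈ so ℂ m)
    (hr : Z.map (starRingEnd ℂ) = Z) : ∃ X : so ℝ m, cplx X 0 = Z := by
  have hre : (Z.map Complex.re).map Complex.ofReal = Z := by
    ext a b
    have := congrFun (congrFun hr a) b
    simp only [Matrix.map_apply] at this ⊢
    exact Complex.conj_eq_iff_re.mp this
  refine ⟨⟨Z.map Complex.re, ?_⟩, by rw [cplx_zero_right]; exact hre⟩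
  rw [mem_so_iff_apply] at hZ ⊢
  intro a b
  have := congrArg Complex.re (hZ a b)
  simpa using this

/-- The complex linear extension of the differential is the conjugation by the same matrix over `ℂ`.
Root vectors can therefore be treated by the entry formula of `conj`. -/
theorem SignedPerm.conj_cplx (S : SignedPerm m) (X Y : so ℝ m) :
    cplx (S.lieEquiv ℝ X) (S.lieEquiv ℝ Y) = S.conj ℂ (cplx X Y) := by
  unfold cplx
  rw [map_add, map_smul, lieEquiv_coe, lieEquiv_coe]
  rw [show X.1.map Complex.ofReal = X.1.map Complex.ofRealHom from rfl,
    show Y.1.map Complex.ofReal = Y.1.map Complex.ofRealHom from rfl, conj_map, conj_map]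
  rfl

theorem cplx_zero_sum {ι : Type*} (s : Finset ι) (c : ι → ℝ) (X : ι → so ℝ m) :
    cplx (∑ i ∈ s, c i • X i) 0 = ∑ i ∈ s, (c i : ℂ) • cplx (X i) 0 := by
  simp only [cplx_zero_right]
  ext a b
  have : (∑ i ∈ s, c i • X i : so ℝ m).1 = ∑ i ∈ s, c i • (X i).1 := by
    rw [AddSubmonoidClass.coe_finsetSum]
    rfl
  rw [this]
  simp [Matrix.sum_apply]

theorem cplx_mem_so (X Y : so ℝ m) : cplx X Y ∈ so ℂ m :=
  add_mem (map_mem_so Complex.ofRealHom X.2)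
    ((so ℂ m).smul_mem _ (map_mem_so Complex.ofRealHom Y.2))

end Complexification

/-! ### The action of a signed permutation on the basis of `𝔤₀`. -/

namespace CartanData

variable {m l : ℕ} {P : Type} (C : CartanData m l P)

/-- By the sign convention for `E_{-α}`, both `X_α` and `Y_α` are real for compact `α` and purely
imaginary for non-compact `α`. In the latter case the factor `v i` makes them real. -/
theorem basisVec_real {p : P} (hE : C.rootVec p ∈ so ℂ m) (v : ℝ) (b : Bool) :
    ∃ X : so ℝ m, cplx X 0 = C.basisVec v (.inr (p, b)) := by
  have hE' : (C.rootVec p).map (starRingEnd ℂ) ∈ so ℂ m := map_mem_so (starRingEnd ℂ) hE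
  apply exists_real_of_map_conj
  · unfold basisVec negRootVec
    refine (so ℂ m).smul_mem _ ?_
    split_ifs
    · exact sub_mem hE ((so ℂ m).smul_mem _ hE')
    · exact sub_mem hE ((so ℂ m).smul_mem _ hE')
    · exact (so ℂ m).smul_mem _ (add_mem hE ((so ℂ m).smul_mem _ hE'))
    · exact (so ℂ m).smul_mem _ (add_mem hE ((so ℂ m).smul_mem _ hE'))
  · ext x y
    unfold basisVec negRootVec
    simp only [Matrix.map_apply, Matrix.smul_apply]
    split_ifs <;>
    simp only [Matrix.sub_apply, Matrix.add_apply, Matrix.smul_apply, Matrix.map_apply,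
      smul_eq_mul, map_mul, map_sub, map_add, map_neg, map_one, Complex.conj_conj,
      Complex.conj_I, Complex.conj_ofReal] <;> ring

theorem conj_negRootVec (S : SignedPerm m) (p : P) :
    S.conj ℂ (C.negRootVec p) = (open Classical in
      (if IsNoncompact (C.posRoot p) then (1 : ℂ) else -1) •
        (S.conj ℂ (C.rootVec p)).map (starRingEnd ℂ)) := by
  unfold negRootVec
  rw [map_smul, ← SignedPerm.conj_map]

theorem map_negRootVec (p : P) :
    (C.negRootVec p).map (starRingEnd ℂ) = (open Classical in
      (if IsNoncompact (C.posRoot p) then (1 : ℂ) else -1) • C.rootVec p) := by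
  unfold negRootVec
  ext a b
  split_ifs <;> simp

theorem units_smul_map_conj {n : ℕ} (η : ℤˣ) (Z : Matrix (Fin n) (Fin n) ℂ) :
    (((η : ℤ) : ℂ) • Z).map (starRingEnd ℂ) = ((η : ℤ) : ℂ) • Z.map (starRingEnd ℂ) := by
  ext a b
  simp

/-- Conjugation permutes the root part of the basis up to signs. -/
theorem conj_basisVec (S : SignedPerm m) {p p' : P}
    (hn : IsNoncompact (C.posRoot p') ↔ IsNoncompact (C.posRoot p)) (η : ℤˣ)
    (h : S.conj ℂ (C.rootVec p) = ((η : ℤ) : ℂ) • C.rootVec p' ∨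
      S.conj ℂ (C.rootVec p) = ((η : ℤ) : ℂ) • C.negRootVec p') (b : Bool) :
    ∃ η' : ℤˣ, ∀ v, S.conj ℂ (C.basisVec v (.inr (p, b))) =
      ((η' : ℤ) : ℂ) • C.basisVec v (.inr (p', b)) := by
  classical
  rcases h with h | h
  · have h' : S.conj ℂ (C.negRootVec p) = ((η : ℤ) : ℂ) • C.negRootVec p' := by
      rw [conj_negRootVec, h, units_smul_map_conj, negRootVec]
      simp only [hn]
      rw [smul_comm]
    refine ⟨η, fun v => ?_⟩
    unfold basisVec
    simp only [hn]
    rw [map_smul, smul_comm]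
    congr 1
    cases b
    · simp only [Bool.false_eq_true, if_false]
      rw [map_smul, map_add, h, h', ← smul_add, smul_comm]
    · simp only [if_true]
      rw [map_sub, h, h', smul_sub]
  -- The matrix is real, so the complex conjugate of the hypothesis gives the image of `E_{-α}`. The
  -- compactness signs of `p` and `p'` agree and cancel.
  · have h' : S.conj ℂ (C.negRootVec p) = ((η : ℤ) : ℂ) • C.rootVec p' := by
      rw [conj_negRootVec, h, units_smul_map_conj, map_negRootVec]
      simp only [hn]
      rw [smul_comm, smul_smul _ _ (C.rootVec p')]
      split_ifs <;> simp
    -- Exchanging `E_β` and `E_{-β}` negates `X_β` and fixes `Y_β`.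
    refine ⟨if b then -η else η, fun v => ?_⟩
    unfold basisVec
    simp only [hn]
    rw [map_smul, smul_comm]
    congr 1
    cases b
    · simp only [Bool.false_eq_true, if_false]
      rw [map_smul, map_add, h, h', ← smul_add, smul_comm, add_comm (C.rootVec p')]
    · simp only [if_true]
      rw [map_sub, h, h', ← smul_sub, Units.val_neg, Int.cast_neg, neg_smul, ← smul_neg, neg_sub]

theorem coroot_eq {α w : Fin l → ℤ} (hκ : ∀ j, C.kappa j = -Complex.I)
    (hw : ∀ k, 2 * (α k : ℂ) / (pairing α α : ℂ) = (w k : ℂ)) :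
    C.coroot α = ∑ k, ((w k : ℂ) * Complex.I) • cplx (C.T k) 0 := by
  unfold coroot
  simp only [hw, hκ, cplx_zero_right, inv_neg, Complex.inv_I, neg_neg]

/-- The matrix is block diagonal. The torus block is `M`, expressing the action `T` in the simple
coroots `w j`, and the root block is a signed permutation matrix, whose inverse is its transpose.
`hπ` ensures that vectors carrying the factor `v i` go to vectors carrying it. -/
theorem mem_lattice [Fintype P] [DecidableEq P] (S : SignedPerm m)
    (hκ : ∀ j, C.kappa j = -Complex.I) (hE : ∀ p, C.rootVec p ∈ so ℂ m)
    (T : Matrix (Fin l) (Fin l) ℤ)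
    (hT : ∀ k, S.lieEquiv ℝ (C.T k) = ∑ k', (T k' k : ℝ) • C.T k')
    (w : Fin l → Fin l → ℤ)
    (hw : ∀ j k, 2 * (C.simple j k : ℂ) / (pairing (C.simple j) (C.simple j) : ℂ) = (w j k : ℂ))
    (hM : ∃ M : GL (Fin l) ℤ, ∀ j, T *ᵥ w j = ∑ i, M.1 i j • w i)
    (π : Equiv.Perm P)
    (hπ : ∀ p, IsNoncompact (C.posRoot (π p)) ↔ IsNoncompact (C.posRoot p))
    (hr : ∀ p, ∃ η : ℤˣ, S.conj ℂ (C.rootVec p) = ((η : ℤ) : ℂ) • C.rootVec (π p) ∨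
      S.conj ℂ (C.rootVec p) = ((η : ℤ) : ℂ) • C.negRootVec (π p))
    {K : Type*} [Field K] (ι : K →+* ℝ) (u : K) :
    S.lieEquiv ℝ ∈ C.lattice ι u := by
  obtain ⟨M, hM⟩ := hM
  have hcor : ∀ j, C.coroot (C.simple j) = ∑ k, ((w j k : ℂ) * Complex.I) • cplx (C.T k) 0 :=
    fun j => C.coroot_eq hκ (hw j)
  have hb : ∀ i, ∃ X : so ℝ m, cplx X 0 = C.basisVec (Real.sqrt (ι u)) i := by
    rintro (j | ⟨p, b⟩)
    -- Since `κ⁻¹ = i`, the basis vector `i H_φ^*` has torus coordinates `i · i · w j k = -w j k`.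
    · refine ⟨∑ k, (-(w j k : ℝ)) • C.T k, ?_⟩
      rw [cplx_zero_sum, basisVec, hcor, Finset.smul_sum]
      refine Finset.sum_congr rfl fun k _ => ?_
      rw [smul_smul]
      congr 1
      push_cast
      linear_combination -(w j k : ℂ) * Complex.I_mul_I
    · exact C.basisVec_real (hE p) _ b
  choose b hb using hb
  have hsign : ∀ x : P × Bool, ∃ η : ℤˣ, ∀ v, S.conj ℂ (C.basisVec v (.inr x)) =
      ((η : ℤ) : ℂ) • C.basisVec v (.inr (π x.1, x.2)) := fun x => by
    obtain ⟨η, hη⟩ := hr x.1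
    exact C.conj_basisVec S (hπ x.1) η hη x.2
  choose η hη using hsign
  let ρ : P × Bool ≃ P × Bool := π.prodCongr (Equiv.refl Bool)
  let N : Matrix (P × Bool) (P × Bool) (𝓞 K) :=
    Matrix.of fun x y => if x = ρ y then ((η y : ℤ) : 𝓞 K) else 0
  have hNN : Nᵀ * N = 1 := by
    ext x y
    simp only [Matrix.mul_apply, Matrix.transpose_apply, N, Matrix.of_apply, Matrix.one_apply]
    rw [Finset.sum_eq_single (ρ x) (fun z _ hz => by rw [if_neg hz, zero_mul])
      (fun h => absurd (Finset.mem_univ _) h), if_pos rfl]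
    simp only [ρ.injective.eq_iff]
    split_ifs with h
    · rw [h, cast_unit_mul_self]
    · simp
  have hNN' : N * Nᵀ = 1 := mul_eq_one_comm.mp hNN
  let M' : GL (Fin l) (𝓞 K) := Matrix.GeneralLinearGroup.map (Int.castRingHom (𝓞 K)) M
  let G : GL (Fin l ⊕ P × Bool) (𝓞 K) :=
    ⟨Matrix.fromBlocks M'.1 0 0 N, Matrix.fromBlocks (M'⁻¹).1 0 0 Nᵀ,
      by rw [Matrix.fromBlocks_multiply]; simp [hNN'],
      by rw [Matrix.fromBlocks_multiply]; simp [hNN]⟩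
  have hG : ∀ i j, G.1 i j = Matrix.fromBlocks M'.1 0 0 N i j := fun _ _ => rfl
  refine ⟨b, hb, G, ?_⟩
  · intro x
    simp only [hG]
    apply Subtype.ext
    apply ofReal_map_injective
    dsimp only
    have key := S.conj_cplx (b x) 0
    rw [map_zero, hb] at key
    rw [← cplx_zero_right, ← cplx_zero_right, cplx_zero_sum, key]
    simp only [hb]
    rcases x with j | x
    · rw [Fintype.sum_sum_type]
      simp only [Matrix.fromBlocks_apply₁₁, Matrix.fromBlocks_apply₂₁, Matrix.zero_apply,
        map_zero, Complex.ofReal_zero, zero_smul, Finset.sum_const_zero, add_zero]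
      have hM' : ∀ i, ((ι (algebraMap (𝓞 K) K (M'.1 i j)) : ℝ) : ℂ) = ((M.1 i j : ℤ) : ℂ) := by
        intro i
        simp [M']
      simp only [hM', basisVec, map_smul, hcor, map_sum]
      have hc : ∀ k, S.conj ℂ (cplx (C.T k) 0) = ∑ k', (T k' k : ℂ) • cplx (C.T k') 0 := by
        intro k
        have := S.conj_cplx (C.T k) 0
        rw [map_zero, hT, cplx_zero_sum] at this
        rw [← this]
        push_cast
        rfl
      simp only [hc, Finset.smul_sum, smul_smul]
      -- Collecting the coefficient of each `T_k` on both sides reduces the identity to the `k`-th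
      -- coordinate of `hM j`.
      rw [Finset.sum_comm]
      conv_rhs => rw [Finset.sum_comm]
      refine Finset.sum_congr rfl fun k _ => ?_
      rw [← Finset.sum_smul, ← Finset.sum_smul]
      congr 1
      have := congrArg (Int.cast : ℤ → ℂ) (congrFun (hM j) k)
      simp only [Matrix.mulVec, dotProduct, Finset.sum_apply, Pi.smul_apply, smul_eq_mul,
        Int.cast_sum, Int.cast_mul] at this
      calc _ = Complex.I * Complex.I * ∑ x, (T k x : ℂ) * (w j x : ℂ) := by
            rw [Finset.mul_sum]
            exact Finset.sum_congr rfl fun x _ => by ring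
        _ = _ := by
            rw [this, Finset.mul_sum]
            exact Finset.sum_congr rfl fun x _ => by ring
    · rw [Fintype.sum_sum_type]
      simp only [Matrix.fromBlocks_apply₁₂, Matrix.fromBlocks_apply₂₂, Matrix.zero_apply,
        map_zero, Complex.ofReal_zero, zero_smul, Finset.sum_const_zero, zero_add]
      rw [Finset.sum_eq_single (ρ x), hη]
      · have hρ : ρ x = (π x.1, x.2) := rfl
        rw [← hρ]
        simp [N]
      · intro y _ hy
        simp [N, hy]
      · exact fun h => absurd (Finset.mem_univ _) h

end CartanData

/-! ### Elementary matrices and the map `f` -/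

section Elementary

variable {n : ℕ}

theorem E_succ (R : Type*) [CommRing R] (a b : Fin n) :
    E R n (a.val + 1) (b.val + 1) = Matrix.single a b 1 := by
  ext x y
  simp only [E, Matrix.of_apply, Matrix.single_apply, add_left_inj, Fin.ext_iff, eq_comm]

theorem F_succ (R : Type*) [CommRing R] (a b : Fin n) :
    F R n (a.val + 1) (b.val + 1) = Matrix.single a b 1 - Matrix.single b a 1 := by
  rw [F, E_succ, E_succ]

theorem F_transpose (R : Type*) [CommRing R] (i j : ℕ) : (F R n i j)ᵀ = -F R n i j := by
  ext a b
  simp [F, E, and_comm]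

theorem F_swap (R : Type*) [CommRing R] (i j : ℕ) : F R n i j = -F R n j i := by
  simp [F]

theorem F_map {R R' : Type*} [CommRing R] [CommRing R'] (φ : R →+* R') (i j : ℕ) :
    (F R n i j).map φ = F R' n i j := by
  ext a b
  simp only [F, E, Matrix.map_apply, Matrix.sub_apply, Matrix.of_apply, map_sub]
  split_ifs <;> simp

end Elementary

section MapF

variable {m : ℕ} (Z W : Matrix (Fin (m + 2)) (Fin (m + 2)) ℂ)

theorem f_add : f (Z + W) = f Z + f W := by
  ext a b
  simp only [f, Matrix.of_apply, Matrix.add_apply]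
  split_ifs <;> ring

theorem f_smul (c : ℂ) : f (c • Z) = c • f Z := by
  ext a b
  simp only [f, Matrix.of_apply, Matrix.smul_apply, smul_eq_mul]
  split_ifs <;> ring

theorem f_neg : f (-Z) = -f Z := by
  rw [← neg_one_smul ℂ, f_smul, neg_one_smul]

theorem f_sub : f (Z - W) = f Z - f W := by
  rw [sub_eq_add_neg, f_add, f_neg, ← sub_eq_add_neg]

theorem f_mem_so (hZ : Zᵀ = -Z) : f Z ∈ so ℂ m := by
  rw [mem_so_iff_apply]
  intro a b
  have h : Z b a = -Z a b := congrFun (congrFun hZ a) b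
  simp only [f, formUnit, Matrix.of_apply, h]
  split_ifs <;> first | omega | (push_cast; ring)

theorem f_F_map_conj_of_noncompact {i j : ℕ} (hi : i ≤ 2) (hj : 2 < j) :
    (f (F ℂ (m + 2) i j)).map (starRingEnd ℂ) = -f (F ℂ (m + 2) i j) := by
  ext a b
  simp only [f, F, E, Matrix.map_apply, Matrix.of_apply, Matrix.neg_apply, Matrix.sub_apply]
  split_ifs <;> first | omega | simp

theorem f_F_map_conj_of_compact {i j : ℕ} (hi : 2 < i) (hj : 2 < j) :
    (f (F ℂ (m + 2) i j)).map (starRingEnd ℂ) = f (F ℂ (m + 2) i j) := by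
  ext a b
  simp only [f, F, E, Matrix.map_apply, Matrix.of_apply, Matrix.sub_apply]
  split_ifs <;> first | omega | simp

/-- `f` depends only on the block decomposition `2 + m`, which such a permutation respects. -/
theorem SignedPerm.conj_f (S : SignedPerm m) (hS : ∀ a, (S.perm a).val < 2 ↔ a.val < 2) :
    S.conj ℂ (f Z) = f (S.conj ℂ Z) := by
  ext a b
  simp only [f, conj_apply, Matrix.of_apply]
  have ha := hS a
  have hb := hS b
  split_ifs <;> first | omega | ring

/-- The signs are taken at the images because the entry of `conj` at `(x, y)` reads position `(perm
x, perm y)`: the unit entry at `(a, b)` reappears at `(perm a, perm b)`. -/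
theorem SignedPerm.conj_F (R : Type*) [CommRing R] (S : SignedPerm m) (a b : Fin (m + 2)) :
    S.conj R (F R (m + 2) (a.val + 1) (b.val + 1)) =
      (((S.sign (S.perm a) * S.sign (S.perm b) : ℤˣ) : ℤ) : R) •
        F R (m + 2) ((S.perm a).val + 1) ((S.perm b).val + 1) := by
  have h : ∀ a b : Fin (m + 2), S.conj R (Matrix.single a b 1) =
      (((S.sign (S.perm a) * S.sign (S.perm b) : ℤˣ) : ℤ) : R) •
        Matrix.single (S.perm a) (S.perm b) 1 := by
    intro a b
    ext x y
    simp only [conj_apply, Matrix.single_apply, Matrix.smul_apply, smul_eq_mul]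
    have ha : a = S.perm x ↔ S.perm a = x := (S.perm_eq_comm).symm
    have hb : b = S.perm y ↔ S.perm b = y := (S.perm_eq_comm).symm
    simp only [ha, hb]
    split_ifs with hc
    · rw [hc.1, hc.2, Units.val_mul, Int.cast_mul]
    · simp
  rw [F_succ, F_succ, map_sub, h, h, smul_sub, mul_comm (S.sign (S.perm b))]

end MapF

/-! ### The root vectors for `𝔱₀` -/

/-- The antisymmetric matrix whose image under `½ f` is a root vector of `e_j ∓ e_k` (`ω = i`) or
its conjugate transpose (`ω = -i`); `j`, `k` are numbered from `0`. -/
def longCore (m j k : ℕ) (s : ℤˣ) (ω : ℂ) : Matrix (Fin (m + 2)) (Fin (m + 2)) ℂ :=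
  ((s : ℤ) : ℂ) • F ℂ (m + 2) (2 * j + 1) (2 * k + 1) + F ℂ (m + 2) (2 * j + 2) (2 * k + 2) +
    ω • (F ℂ (m + 2) (2 * j + 1) (2 * k + 2) -
      ((s : ℤ) : ℂ) • F ℂ (m + 2) (2 * j + 2) (2 * k + 1))

/-- The antisymmetric matrix whose image under `f` is a root vector of `e_j` (`ω = i`) or its
conjugate transpose (`ω = -i`); `j` is numbered from `0`. -/
def shortCore (m l j : ℕ) (ω : ℂ) : Matrix (Fin (m + 2)) (Fin (m + 2)) ℂ :=
  -F ℂ (m + 2) (2 * j + 1) (2 * l + 1) + ω • F ℂ (m + 2) (2 * j + 2) (2 * l + 1)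

/-- The sign `∓` of the root `e_j ∓ e_k`. -/
def longSign {l : ℕ} (p : LongRoot l) : ℤˣ := if p.2 then -1 else 1

theorem longVec_eq (m : ℕ) {l : ℕ} (p : LongRoot l) :
    longVec m p =
      (1 / 2 : ℂ) • f (longCore m p.1.1.1.val p.1.1.2.val (longSign p) Complex.I) := by
  unfold longVec longSign longCore
  congr 1
  split_ifs
  · unfold Gminus
    congr 1
    simp [mul_add]
  · unfold Gplus
    congr 1
    simp [mul_add]

theorem Dplus_eq (m l j : ℕ) : Dplus m l (j + 1) = f (shortCore m l j Complex.I) := by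
  unfold Dplus shortCore
  simp [mul_add]

theorem longCore_transpose (m j k : ℕ) (s : ℤˣ) (ω : ℂ) :
    (longCore m j k s ω)ᵀ = -longCore m j k s ω := by
  unfold longCore
  simp only [Matrix.transpose_add, Matrix.transpose_sub, Matrix.transpose_smul, F_transpose]
  module

theorem shortCore_transpose (m l j : ℕ) (ω : ℂ) :
    (shortCore m l j ω)ᵀ = -shortCore m l j ω := by
  unfold shortCore
  simp only [Matrix.transpose_add, Matrix.transpose_neg, Matrix.transpose_smul, F_transpose]
  module

theorem longVec_mem_so (m : ℕ) {l : ℕ} (p : LongRoot l) : longVec m p ∈ so ℂ m := by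
  rw [longVec_eq]
  exact (so ℂ m).smul_mem _ (f_mem_so _ (longCore_transpose _ _ _ _ _))

theorem Dplus_mem_so (m l j : ℕ) : Dplus m l (j + 1) ∈ so ℂ m := by
  rw [Dplus_eq]
  exact f_mem_so _ (shortCore_transpose _ _ _ _)

/-- The images under `f` of the matrices `F` are imaginary across the blocks and real inside the
compact block. The compactness sign in `E_{-α}` compensates exactly for this, so passing from `E_α`
to `E_{-α}` is uniformly `i ↦ -i` together with an overall sign. -/
theorem f_longCore_map_conj {m j k : ℕ} (hjk : j < k) (s : ℤˣ) :
    (if j = 0 then (1 : ℂ) else -1) • (f (longCore m j k s Complex.I)).map (starRingEnd ℂ) =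
      -f (longCore m j k s (-Complex.I)) := by
  have hs : (starRingEnd ℂ) ((s : ℤ) : ℂ) = ((s : ℤ) : ℂ) := by simp
  have hsmul : ∀ (c : ℂ) (Z : Matrix (Fin (m + 2)) (Fin (m + 2)) ℂ),
      (c • Z).map (starRingEnd ℂ) = (starRingEnd ℂ) c • Z.map (starRingEnd ℂ) := by
    intro c Z
    ext
    simp
  unfold longCore
  simp only [f_add, f_sub, f_smul, Matrix.map_add _ (map_add (starRingEnd ℂ)),
    Matrix.map_sub _ (map_sub (starRingEnd ℂ)), hsmul, hs, Complex.conj_I]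
  split_ifs with h
  · subst h
    rw [f_F_map_conj_of_noncompact (by omega) (by omega),
      f_F_map_conj_of_noncompact (by omega) (by omega),
      f_F_map_conj_of_noncompact (by omega) (by omega),
      f_F_map_conj_of_noncompact (by omega) (by omega)]
    module
  · rw [f_F_map_conj_of_compact (by omega) (by omega),
      f_F_map_conj_of_compact (by omega) (by omega),
      f_F_map_conj_of_compact (by omega) (by omega),
      f_F_map_conj_of_compact (by omega) (by omega)]
    module

theorem f_shortCore_map_conj {m l j : ℕ} (hl : 1 ≤ l) :
    (if j = 0 then (1 : ℂ) else -1) • (f (shortCore m l j Complex.I)).map (starRingEnd ℂ) =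
      -f (shortCore m l j (-Complex.I)) := by
  have hsmul : ∀ (c : ℂ) (Z : Matrix (Fin (m + 2)) (Fin (m + 2)) ℂ),
      (c • Z).map (starRingEnd ℂ) = (starRingEnd ℂ) c • Z.map (starRingEnd ℂ) := by
    intro c Z
    ext
    simp
  have hneg : ∀ Z : Matrix (Fin (m + 2)) (Fin (m + 2)) ℂ,
      (-Z).map (starRingEnd ℂ) = -Z.map (starRingEnd ℂ) := by
    intro Z
    ext
    simp
  unfold shortCore
  simp only [f_add, f_neg, f_smul, Matrix.map_add _ (map_add (starRingEnd ℂ)), hsmul, hneg,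
    Complex.conj_I]
  split_ifs with h
  · subst h
    rw [f_F_map_conj_of_noncompact (by omega) (by omega),
      f_F_map_conj_of_noncompact (by omega) (by omega)]
    module
  · rw [f_F_map_conj_of_compact (by omega) (by omega),
      f_F_map_conj_of_compact (by omega) (by omega)]
    module

theorem e_noncompact {l : ℕ} (j : Fin l) : IsNoncompact (e l (j.val + 1)) ↔ j.val = 0 := by
  unfold IsNoncompact
  simp only [e_apply]
  constructor
  · rintro ⟨i, hi, h⟩
    by_contra hj
    exact h (if_neg (by omega))
  · intro hj
    exact ⟨j, hj, by simp⟩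

theorem longRoot_noncompact {l : ℕ} (p : LongRoot l) :
    IsNoncompact (longRoot p) ↔ p.1.1.1.val = 0 := by
  have hp : p.1.1.1.val < p.1.1.2.val := p.1.2
  have hk : ∀ i : Fin l, i.val = 0 → e l (p.1.1.2.val + 1) i = 0 := fun i hi => by
    rw [e_apply, if_neg (by omega)]
  rw [← e_noncompact]
  unfold IsNoncompact longRoot
  refine exists_congr fun i => and_congr_right fun hi => ?_
  split_ifs <;> simp [hk i hi]

namespace CartanData

variable {m l : ℕ} {P : Type} (C : CartanData m l P)

theorem negRootVec_of_long {x : P} {p : LongRoot l} (hv : C.rootVec x = longVec m p)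
    (hr : C.posRoot x = longRoot p) :
    C.negRootVec x =
      -((1 / 2 : ℂ) • f (longCore m p.1.1.1.val p.1.1.2.val (longSign p) (-Complex.I))) := by
  classical
  unfold negRootVec
  rw [hv, hr, longVec_eq, ← smul_neg, ← f_longCore_map_conj p.1.2]
  simp only [longRoot_noncompact]
  split_ifs <;> ext a b <;> simp [map_ofNat]

theorem negRootVec_of_short {x : P} {j : Fin l} (hv : C.rootVec x = Dplus m l (j.val + 1))
    (hr : C.posRoot x = e l (j.val + 1)) :
    C.negRootVec x = -f (shortCore m l j.val (-Complex.I)) := by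
  classical
  unfold negRootVec
  rw [hv, hr, Dplus_eq, ← f_shortCore_map_conj (Nat.one_le_of_lt j.isLt)]
  simp only [e_noncompact]

end CartanData

/-! ### Sign changes and rotations of the coordinate planes -/

/-- The diagonal matrix with entries `ε 0, ε 1, …`. -/
def diagPerm (m : ℕ) (ε : ℕ → ℤˣ) : SignedPerm m where
  perm := id
  sign a := ε a.val
  perm_perm _ := rfl
  square := 1
  sign_mul _ := Int.units_mul_self _
  formSign := 1
  form_perm _ := (one_mul _).symm

/-- The block diagonal matrix `∑ c_j H_j` for signs `c_j`. -/
def rotPerm {m l : ℕ} (h : m + 2 = 2 * l) (c : ℕ → ℤˣ) : SignedPerm m where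
  perm a := ⟨if a.val % 2 = 0 then a.val + 1 else a.val - 1, by
    have := a.isLt
    split_ifs <;> omega⟩
  sign a := if a.val % 2 = 0 then c (a.val / 2) else -c (a.val / 2)
  perm_perm a := by
    apply Fin.ext
    dsimp only
    split_ifs <;> omega
  square := -1
  sign_mul a := by
    dsimp only
    split_ifs with h1 h2 h2
    · omega
    · rw [show (a.val + 1) / 2 = a.val / 2 by omega, mul_neg, Int.units_mul_self]
    · rw [show (a.val - 1) / 2 = a.val / 2 by omega, neg_mul, Int.units_mul_self]
    · omega
  formSign := 1
  form_perm a := by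
    rw [one_mul]
    unfold formUnit
    dsimp only
    congr 1
    split_ifs <;> simp only [eq_iff_iff] <;> omega

theorem diagPerm_conj_F {m : ℕ} (R : Type*) [CommRing R] (ε : ℕ → ℤˣ) {i j : ℕ} (hi : i < m + 2)
    (hj : j < m + 2) :
    (diagPerm m ε).conj R (F R (m + 2) (i + 1) (j + 1)) =
      (((ε i * ε j : ℤˣ) : ℤ) : R) • F R (m + 2) (i + 1) (j + 1) :=
  (diagPerm m ε).conj_F R ⟨i, hi⟩ ⟨j, hj⟩

section RotF

variable {m l : ℕ} (h : m + 2 = 2 * l) (c : ℕ → ℤˣ) (R : Type*) [CommRing R] {j k : ℕ}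

theorem rotPerm_perm_even (hj : 2 * j < m + 2) :
    (rotPerm h c).perm ⟨2 * j, hj⟩ = ⟨2 * j + 1, by omega⟩ := by
  simp [rotPerm]

theorem rotPerm_perm_odd (hj : 2 * j + 1 < m + 2) :
    (rotPerm h c).perm ⟨2 * j + 1, hj⟩ = ⟨2 * j, by omega⟩ := by
  apply Fin.ext
  dsimp only [rotPerm]
  split_ifs <;> omega

theorem rotPerm_sign_even (hj : 2 * j < m + 2) : (rotPerm h c).sign ⟨2 * j, hj⟩ = c j := by
  simp [rotPerm]

theorem rotPerm_sign_odd (hj : 2 * j + 1 < m + 2) :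
    (rotPerm h c).sign ⟨2 * j + 1, hj⟩ = -c j := by
  dsimp only [rotPerm]
  rw [if_neg (by omega)]
  congr 2
  omega

theorem rotPerm_conj_F_even_even (hj : j < l) (hk : k < l) :
    (rotPerm h c).conj R (F R (m + 2) (2 * j + 1) (2 * k + 1)) =
      (((c j * c k : ℤˣ) : ℤ) : R) • F R (m + 2) (2 * j + 2) (2 * k + 2) := by
  have := (rotPerm h c).conj_F R ⟨2 * j, by omega⟩ ⟨2 * k, by omega⟩
  rwa [rotPerm_perm_even, rotPerm_perm_even, rotPerm_sign_odd, rotPerm_sign_odd, neg_mul_neg]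
    at this

theorem rotPerm_conj_F_odd_odd (hj : j < l) (hk : k < l) :
    (rotPerm h c).conj R (F R (m + 2) (2 * j + 2) (2 * k + 2)) =
      (((c j * c k : ℤˣ) : ℤ) : R) • F R (m + 2) (2 * j + 1) (2 * k + 1) := by
  have := (rotPerm h c).conj_F R ⟨2 * j + 1, by omega⟩ ⟨2 * k + 1, by omega⟩
  rwa [rotPerm_perm_odd, rotPerm_perm_odd, rotPerm_sign_even, rotPerm_sign_even] at this

theorem rotPerm_conj_F_even_odd (hj : j < l) (hk : k < l) :
    (rotPerm h c).conj R (F R (m + 2) (2 * j + 1) (2 * k + 2)) =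
      -((((c j * c k : ℤˣ) : ℤ) : R) • F R (m + 2) (2 * j + 2) (2 * k + 1)) := by
  have := (rotPerm h c).conj_F R ⟨2 * j, by omega⟩ ⟨2 * k + 1, by omega⟩
  rwa [rotPerm_perm_even, rotPerm_perm_odd, rotPerm_sign_odd, rotPerm_sign_even, neg_mul,
    Units.val_neg, Int.cast_neg, neg_smul] at this

theorem rotPerm_conj_F_odd_even (hj : j < l) (hk : k < l) :
    (rotPerm h c).conj R (F R (m + 2) (2 * j + 2) (2 * k + 1)) =
      -((((c j * c k : ℤˣ) : ℤ) : R) • F R (m + 2) (2 * j + 1) (2 * k + 2)) := by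
  have := (rotPerm h c).conj_F R ⟨2 * j + 1, by omega⟩ ⟨2 * k, by omega⟩
  rwa [rotPerm_perm_odd, rotPerm_perm_even, rotPerm_sign_even, rotPerm_sign_odd, mul_neg,
    Units.val_neg, Int.cast_neg, neg_smul] at this

end RotF

/-- The action of a diagonal sign matrix on `H_j`. -/
def planeSign (ε : ℕ → ℤˣ) (j : ℕ) : ℤˣ := ε (2 * j) * ε (2 * j + 1)

theorem diagPerm_H {m l : ℕ} (h : 2 * l ≤ m + 2) (ε : ℕ → ℤˣ) (j : Fin l) :
    (diagPerm m ε).lieEquiv ℝ (H m j) = ((planeSign ε j.val : ℤ) : ℝ) • H m j := by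
  apply Subtype.ext
  exact diagPerm_conj_F ℝ ε (i := 2 * j.val) (j := 2 * j.val + 1) (by omega) (by omega)

/-- The conjugating matrix is itself a combination of the commuting `H_k`. -/
theorem rotPerm_H {m l : ℕ} (h : m + 2 = 2 * l) (c : ℕ → ℤˣ) (j : Fin l) :
    (rotPerm h c).lieEquiv ℝ (H m j) = H m j := by
  apply Subtype.ext
  refine (rotPerm_conj_F_even_odd h c ℝ j.isLt j.isLt).trans ?_
  rw [Int.units_mul_self, F_swap]
  simp [H]

/-- The core is normalised to have coefficient `1` at `F_{2j+2,2k+2}`, whence the scalar. The new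
relative sign is the image of `e_j ∓ e_k` up to sign, and the sign of `ω` tells whether the image is
positive. -/
theorem diagPerm_longCore {m l : ℕ} (h : 2 * l ≤ m + 2) (ε : ℕ → ℤˣ) {j k : ℕ} (hj : j < l)
    (hk : k < l) (s : ℤˣ) (ω : ℂ) :
    (diagPerm m ε).conj ℂ (longCore m j k s ω) =
      (((ε (2 * j + 1) * ε (2 * k + 1) : ℤˣ) : ℤ) : ℂ) •
        longCore m j k (s * (planeSign ε j * planeSign ε k))
          (((planeSign ε j : ℤ) : ℂ) * ω) := by
  unfold longCore planeSign
  simp only [map_add, map_sub, map_smul]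
  rw [diagPerm_conj_F ℂ ε (by omega) (by omega), diagPerm_conj_F ℂ ε (by omega) (by omega),
    diagPerm_conj_F ℂ ε (by omega) (by omega), diagPerm_conj_F ℂ ε (by omega) (by omega)]
  rcases Int.units_eq_one_or (ε (2 * j)) with h1 | h1 <;>
  rcases Int.units_eq_one_or (ε (2 * j + 1)) with h2 | h2 <;>
  rcases Int.units_eq_one_or (ε (2 * k)) with h3 | h3 <;>
  rcases Int.units_eq_one_or (ε (2 * k + 1)) with h4 | h4 <;>
  simp only [h1, h2, h3, h4, mul_one, one_mul, neg_mul, mul_neg, neg_neg, Units.val_neg,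
    Units.val_one, Int.cast_neg, Int.cast_one] <;> module

theorem diagPerm_shortCore {m l : ℕ} (h : 2 * l < m + 2) (ε : ℕ → ℤˣ) {j : ℕ} (hj : j < l)
    (ω : ℂ) :
    (diagPerm m ε).conj ℂ (shortCore m l j ω) =
      (((ε (2 * j) * ε (2 * l) : ℤˣ) : ℤ) : ℂ) •
        shortCore m l j (((planeSign ε j : ℤ) : ℂ) * ω) := by
  unfold shortCore planeSign
  simp only [map_add, map_neg, map_smul]
  rw [diagPerm_conj_F ℂ ε (by omega) (by omega), diagPerm_conj_F ℂ ε (by omega) (by omega)]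
  rcases Int.units_eq_one_or (ε (2 * j)) with h1 | h1 <;>
  rcases Int.units_eq_one_or (ε (2 * j + 1)) with h2 | h2 <;>
  simp only [h1, h2, mul_one, one_mul, neg_mul, mul_neg, neg_neg, Units.val_neg,
    Units.val_one, Int.cast_neg, Int.cast_one] <;> module

theorem rotPerm_longCore {m l : ℕ} (h : m + 2 = 2 * l) (c : ℕ → ℤˣ) {j k : ℕ} (hj : j < l)
    (hk : k < l) (s : ℤˣ) (ω : ℂ) :
    (rotPerm h c).conj ℂ (longCore m j k s ω) =
      (((s * (c j * c k) : ℤˣ) : ℤ) : ℂ) • longCore m j k s ω := by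
  unfold longCore
  simp only [map_add, map_sub, map_smul]
  rw [rotPerm_conj_F_even_even h c ℂ hj hk, rotPerm_conj_F_odd_odd h c ℂ hj hk,
    rotPerm_conj_F_even_odd h c ℂ hj hk, rotPerm_conj_F_odd_even h c ℂ hj hk]
  rcases Int.units_eq_one_or s with h1 | h1 <;>
  simp only [h1, one_mul, neg_mul, Units.val_neg, Units.val_one, Int.cast_neg, Int.cast_one] <;>
  module

theorem diagPerm_perm_lt {m : ℕ} (ε : ℕ → ℤˣ) (a : Fin (m + 2)) :
    ((diagPerm m ε).perm a).val < 2 ↔ a.val < 2 := Iff.rfl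

theorem rotPerm_perm_lt {m l : ℕ} (h : m + 2 = 2 * l) (c : ℕ → ℤˣ) (a : Fin (m + 2)) :
    ((rotPerm h c).perm a).val < 2 ↔ a.val < 2 := by
  dsimp only [rotPerm]
  split_ifs <;> omega

/-- The permutation of the pairs of opposite roots `±(e_j ± e_k)` induced by a diagonal sign
matrix. -/
def flipLong (l : ℕ) (ε : ℕ → ℤˣ) : Equiv.Perm (LongRoot l) :=
  Function.Involutive.toPerm (fun p =>
    (p.1, xor p.2 (decide (planeSign ε p.1.1.1.val ≠ planeSign ε p.1.1.2.val))))
    (fun p => by simp)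

theorem longSign_flipLong {l : ℕ} (ε : ℕ → ℤˣ) (p : LongRoot l) :
    longSign (flipLong l ε p) =
      longSign p * (planeSign ε p.1.1.1.val * planeSign ε p.1.1.2.val) := by
  obtain ⟨q, b⟩ := p
  rcases Int.units_eq_one_or (planeSign ε q.1.1.val) with h1 | h1 <;>
  rcases Int.units_eq_one_or (planeSign ε q.1.2.val) with h2 | h2 <;>
  cases b <;> simp [longSign, flipLong, h1, h2]

theorem flipLong_fst {l : ℕ} (ε : ℕ → ℤˣ) (p : LongRoot l) : (flipLong l ε p).1 = p.1 := rfl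

namespace CartanData

variable {m l : ℕ} {P : Type} (C : CartanData m l P)

theorem diagPerm_rootVec_long (h : 2 * l ≤ m + 2) (ε : ℕ → ℤˣ) {x x' : P} {p : LongRoot l}
    (hv : C.rootVec x = longVec m p) (hv' : C.rootVec x' = longVec m (flipLong l ε p))
    (hr' : C.posRoot x' = longRoot (flipLong l ε p)) :
    ∃ η : ℤˣ, (diagPerm m ε).conj ℂ (C.rootVec x) = ((η : ℤ) : ℂ) • C.rootVec x' ∨
      (diagPerm m ε).conj ℂ (C.rootVec x) = ((η : ℤ) : ℂ) • C.negRootVec x' := by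
  have key := diagPerm_longCore h ε p.1.1.1.isLt p.1.1.2.isLt (longSign p) Complex.I
  rw [hv, longVec_eq, map_smul, SignedPerm.conj_f _ _ (diagPerm_perm_lt ε), key, f_smul,
    smul_comm, C.negRootVec_of_long hv' hr', hv', longVec_eq, longSign_flipLong, flipLong_fst]
  rcases Int.units_eq_one_or (planeSign ε p.1.1.1.val) with h1 | h1
  · refine ⟨ε (2 * p.1.1.1.val + 1) * ε (2 * p.1.1.2.val + 1), Or.inl ?_⟩
    rw [h1]
    simp
  · refine ⟨-(ε (2 * p.1.1.1.val + 1) * ε (2 * p.1.1.2.val + 1)), Or.inr ?_⟩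
    rw [h1]
    simp

theorem diagPerm_rootVec_short (h : 2 * l < m + 2) (ε : ℕ → ℤˣ) {x : P} {j : Fin l}
    (hv : C.rootVec x = Dplus m l (j.val + 1)) (hr : C.posRoot x = e l (j.val + 1)) :
    ∃ η : ℤˣ, (diagPerm m ε).conj ℂ (C.rootVec x) = ((η : ℤ) : ℂ) • C.rootVec x ∨
      (diagPerm m ε).conj ℂ (C.rootVec x) = ((η : ℤ) : ℂ) • C.negRootVec x := by
  have key := diagPerm_shortCore h ε j.isLt Complex.I
  rw [C.negRootVec_of_short hv hr, hv, Dplus_eq, SignedPerm.conj_f _ _ (diagPerm_perm_lt ε),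
    key, f_smul]
  rcases Int.units_eq_one_or (planeSign ε j.val) with h1 | h1
  · refine ⟨ε (2 * j.val) * ε (2 * l), Or.inl ?_⟩
    rw [h1]
    simp
  · refine ⟨-(ε (2 * j.val) * ε (2 * l)), Or.inr ?_⟩
    rw [h1]
    simp

end CartanData

/-! ### The coroot lattice -/

theorem pairing_e {l : ℕ} (a : ℕ) (α : Fin l → ℤ) (i : Fin l) (hi : i.val + 1 = a) :
    pairing (e l a) α = α i := by
  unfold pairing
  rw [Finset.sum_eq_single i]
  · rw [e_apply, if_pos hi, one_mul]
  · intro k _ hk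
    rw [e_apply, if_neg fun h => hk (Fin.ext (by omega)), zero_mul]
  · exact fun h => absurd (Finset.mem_univ _) h

theorem pairing_add_left {l : ℕ} (α β γ : Fin l → ℤ) :
    pairing (α + β) γ = pairing α γ + pairing β γ := by
  simp [pairing, add_mul, Finset.sum_add_distrib]

theorem pairing_sub_left {l : ℕ} (α β γ : Fin l → ℤ) :
    pairing (α - β) γ = pairing α γ - pairing β γ := by
  simp [pairing, sub_mul, Finset.sum_sub_distrib]

theorem pairing_e_sub_e {l a b : ℕ} (ha : 1 ≤ a) (hab : a < b) (hb : b ≤ l) :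
    pairing (e l a - e l b) (e l a - e l b) = 2 := by
  rw [pairing_sub_left, pairing_e a _ ⟨a - 1, by omega⟩ (Nat.sub_add_cancel ha),
    pairing_e b _ ⟨b - 1, by omega⟩ (by dsimp only; omega)]
  simp only [Pi.sub_apply, e_apply]
  rw [if_pos (by omega), if_neg (by omega), if_neg (by omega), if_pos (by omega)]
  norm_num

theorem pairing_e_add_e {l a b : ℕ} (ha : 1 ≤ a) (hab : a < b) (hb : b ≤ l) :
    pairing (e l a + e l b) (e l a + e l b) = 2 := by
  rw [pairing_add_left, pairing_e a _ ⟨a - 1, by omega⟩ (Nat.sub_add_cancel ha),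
    pairing_e b _ ⟨b - 1, by omega⟩ (by dsimp only; omega)]
  simp only [Pi.add_apply, e_apply]
  rw [if_pos (by omega), if_neg (by omega), if_neg (by omega), if_pos (by omega)]
  norm_num

/-- The coordinates of the simple coroots for `m = 2l-1`. -/
def corootB (l : ℕ) (j : Fin l) : Fin l → ℤ :=
  if j.val + 1 < l then rootB l j.succ else 2 • e l l

theorem corootB_eq {l : ℕ} (j k : Fin l) :
    2 * (rootB l j.succ k : ℂ) / (pairing (rootB l j.succ) (rootB l j.succ) : ℂ) =
      (corootB l j k : ℂ) := by
  unfold corootB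
  have hj := j.isLt
  split_ifs with h
  · have : pairing (rootB l j.succ) (rootB l j.succ) = 2 := by
      unfold rootB
      rw [if_neg (by simp), if_pos (by simpa using h)]
      exact pairing_e_sub_e (by simp) (by simp) (by simp; omega)
    rw [this]
    push_cast
    ring
  · have hr : rootB l j.succ = e l l := by
      unfold rootB
      rw [if_neg (by simp), if_neg (by simpa using h)]
    rw [hr, pairing_e l _ j (by omega), e_apply l l j, if_pos (by omega)]
    simp

theorem rootD_pairing {l : ℕ} (hl : 2 ≤ l) (j : Fin l) :
    pairing (rootD l j.succ) (rootD l j.succ) = 2 := by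
  have hj := j.isLt
  unfold rootD
  rw [if_neg (by simp)]
  split_ifs with h
  · rw [Fin.val_succ] at h ⊢
    exact pairing_e_sub_e (by omega) (by omega) (by omega)
  · exact pairing_e_add_e (by omega) (by omega) (by omega)

/-- Descending induction: `2e_l` is the coroot of the short simple root, and `2e_k = 2(e_k -
e_{k+1}) + 2e_{k+1}`. -/
theorem two_e_mem_corootB {l : ℕ} (k : ℕ) (h1 : 1 ≤ k) (hk : k ≤ l) :
    (2 : ℤ) • e l k ∈ Submodule.span ℤ (Set.range (corootB l)) := by
  have hmem : ∀ j : Fin l, corootB l j ∈ Submodule.span ℤ (Set.range (corootB l)) :=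
    fun j => Submodule.subset_span ⟨j, rfl⟩
  refine Nat.decreasingInduction'
    (P := fun k => 1 ≤ k → (2 : ℤ) • e l k ∈ Submodule.span ℤ (Set.range (corootB l)))
    (fun k hk _ ih h1 => ?_) hk (fun h1 => ?_) h1
  · have hr : corootB l ⟨k - 1, by omega⟩ = e l k - e l (k + 1) := by
      unfold corootB rootB
      rw [if_pos (by dsimp only; omega), if_neg (by simp), if_pos (by simp; omega)]
      simp only [Fin.val_succ, Nat.sub_add_cancel h1]
    have h2 := Submodule.smul_mem _ (2 : ℤ) (hmem ⟨k - 1, by omega⟩)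
    rw [hr] at h2
    have h3 := add_mem h2 (ih (by omega))
    rwa [← smul_add, sub_add_cancel] at h3
  · have hr : corootB l ⟨l - 1, by omega⟩ = (2 : ℤ) • e l l := by
      unfold corootB
      rw [if_neg (by dsimp only; omega)]
      module
    exact hr ▸ hmem ⟨l - 1, by omega⟩

theorem rootD_of_lt {l k : ℕ} (h1 : 1 ≤ k) (hk : k < l) :
    rootD l (⟨k - 1, by omega⟩ : Fin l).succ = e l k - e l (k + 1) := by
  unfold rootD
  rw [if_neg (by simp), if_pos (by simp; omega)]
  simp only [Fin.val_succ, Nat.sub_add_cancel h1]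

/-- The same descent, now starting from `2e_l = φ_l - φ_{l-1}`. -/
theorem two_e_mem_rootD {l : ℕ} (hl : 2 ≤ l) (k : ℕ) (h1 : 1 ≤ k) (hk : k ≤ l) :
    (2 : ℤ) • e l k ∈ Submodule.span ℤ (Set.range fun j : Fin l => rootD l j.succ) := by
  have hmem : ∀ j : Fin l, rootD l j.succ ∈
      Submodule.span ℤ (Set.range fun j : Fin l => rootD l j.succ) :=
    fun j => Submodule.subset_span ⟨j, rfl⟩
  have hdiff : ∀ k, 1 ≤ k → k < l → e l k - e l (k + 1) ∈
      Submodule.span ℤ (Set.range fun j : Fin l => rootD l j.succ) :=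
    fun k h1 hk => rootD_of_lt h1 hk ▸ hmem ⟨k - 1, by omega⟩
  refine Nat.decreasingInduction'
    (P := fun k => 1 ≤ k → (2 : ℤ) • e l k ∈
      Submodule.span ℤ (Set.range fun j : Fin l => rootD l j.succ))
    (fun k hk _ ih h1 => ?_) hk (fun h1 => ?_) h1
  · have h3 := add_mem (Submodule.smul_mem _ (2 : ℤ) (hdiff k h1 hk)) (ih (by omega))
    rwa [← smul_add, sub_add_cancel] at h3
  · have hr : rootD l (⟨l - 1, by omega⟩ : Fin l).succ = e l (l - 1) + e l l := by
      unfold rootD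
      rw [if_neg (by simp), if_neg (by simp; omega)]
    have h2 := hmem ⟨l - 1, by omega⟩
    have h3 := hdiff (l - 1) (by omega) (by omega)
    rw [hr] at h2
    rw [show l - 1 + 1 = l by omega] at h3
    have h4 := sub_mem h2 h3
    rwa [show e l (l - 1) + e l l - (e l (l - 1) - e l l) = (2 : ℤ) • e l l by module] at h4

theorem single_eq_e {l : ℕ} (k : Fin l) : (Pi.single k 1 : Fin l → ℤ) = e l (k.val + 1) := by
  ext i
  rw [Pi.single_apply, e_apply]
  simp [Fin.ext_iff]

/-- Sign changes of the coordinates act on a lattice containing all `2e_k` by a unimodular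
matrix. -/
theorem exists_unimodular_of_signs {l : ℕ} (w : Fin l → Fin l → ℤ)
    (h2 : ∀ k, 1 ≤ k → k ≤ l → (2 : ℤ) • e l k ∈ Submodule.span ℤ (Set.range w))
    (t : Fin l → ℤˣ) :
    ∃ M : GL (Fin l) ℤ, ∀ j,
      Matrix.diagonal (fun k => (t k : ℤ)) *ᵥ w j = ∑ i, M.1 i j • w i := by
  have h2' : ∀ k : Fin l,
      (2 : ℤ) • (Pi.single k 1 : Fin l → ℤ) ∈ Submodule.span ℤ (Set.range w) := by
    intro k
    rw [single_eq_e]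
    exact h2 _ (by omega) k.isLt
  refine exists_unimodular w h2' _ ?_ fun j => ?_
  · rw [Matrix.diagonal_mul_diagonal, ← Matrix.diagonal_one]
    congr 1
    funext k
    rw [← Units.val_mul, Int.units_mul_self, Units.val_one]
  -- Changing the sign of some coordinates subtracts an integral combination of the `2e_k`, which
  -- belong to the lattice.
  · have hsum : Matrix.diagonal (fun k => (t k : ℤ)) *ᵥ w j =
        w j - ∑ k, ((if t k = 1 then 0 else w j k) : ℤ) •
          ((2 : ℤ) • (Pi.single k 1 : Fin l → ℤ)) := by
      ext a
      rw [Matrix.mulVec_diagonal, Pi.sub_apply, Finset.sum_apply, Finset.sum_eq_single a]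
      · rcases Int.units_eq_one_or (t a) with h | h
        · simp [h]
        · simp [h, show (-1 : ℤˣ) ≠ 1 by decide]
          ring
      · intro b _ hb
        simp [hb.symm]
      · exact fun h => absurd (Finset.mem_univ _) h
    rw [hsum]
    exact sub_mem (Submodule.subset_span ⟨j, rfl⟩)
      (sum_mem fun k _ => Submodule.smul_mem _ _ (h2' k))

/-! ### Lattice membership of sign changes and rotations -/

theorem diagPerm_mem_latticeB {m l : ℕ} (h : m + 1 = 2 * l) (ε : ℕ → ℤˣ) {K : Type*} [Field K]
    (ι : K →+* ℝ) (u : K) : (diagPerm m ε).lieEquiv ℝ ∈ (dataB m l).lattice ι u := by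
  refine CartanData.mem_lattice (dataB m l) (diagPerm m ε) (fun _ => rfl) ?_
    (Matrix.diagonal fun k => (planeSign ε k.val : ℤ)) ?_ (corootB l) corootB_eq
    (exists_unimodular_of_signs _ two_e_mem_corootB fun k => planeSign ε k.val)
    (Equiv.sumCongr (flipLong l ε) (Equiv.refl _)) ?_ ?_ ι u
  · rintro (p | j)
    · exact longVec_mem_so m p
    · exact Dplus_mem_so m l j.val
  · intro k
    refine (diagPerm_H (by omega) ε k).trans ?_
    simp [Matrix.diagonal_apply, dataB]
  · rintro (p | j)
    · exact (longRoot_noncompact _).trans (longRoot_noncompact p).symm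
    · exact Iff.rfl
  · rintro (p | j)
    · exact (dataB m l).diagPerm_rootVec_long (by omega) ε (p := p) rfl rfl rfl
    · exact (dataB m l).diagPerm_rootVec_short (by omega) ε (j := j) rfl rfl

theorem rootD_coroot_eq {l : ℕ} (hl : 2 ≤ l) (j k : Fin l) :
    2 * (rootD l j.succ k : ℂ) / (pairing (rootD l j.succ) (rootD l j.succ) : ℂ) =
      (rootD l j.succ k : ℂ) := by
  rw [rootD_pairing hl]
  push_cast
  ring

theorem diagPerm_mem_latticeD {m l : ℕ} (h : m + 2 = 2 * l) (hl : 2 ≤ l) (ε : ℕ → ℤˣ)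
    {K : Type*} [Field K] (ι : K →+* ℝ) (u : K) :
    (diagPerm m ε).lieEquiv ℝ ∈ (dataD m l).lattice ι u := by
  refine CartanData.mem_lattice (dataD m l) (diagPerm m ε) (fun _ => rfl) (longVec_mem_so m)
    (Matrix.diagonal fun k => (planeSign ε k.val : ℤ)) ?_ (fun j => rootD l j.succ)
    (rootD_coroot_eq hl)
    (exists_unimodular_of_signs _ (two_e_mem_rootD hl) fun k => planeSign ε k.val)
    (flipLong l ε) ?_ ?_ ι u
  · intro k
    refine (diagPerm_H (by omega) ε k).trans ?_
    simp [Matrix.diagonal_apply, dataD]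
  · intro p
    exact (longRoot_noncompact _).trans (longRoot_noncompact p).symm
  · intro p
    exact (dataD m l).diagPerm_rootVec_long (by omega) ε (p := p) rfl rfl rfl

/-- Here the torus block is the identity, and every root vector is only multiplied by a sign. -/
theorem rotPerm_mem_latticeD {m l : ℕ} (h : m + 2 = 2 * l) (hl : 2 ≤ l) (c : ℕ → ℤˣ)
    {K : Type*} [Field K] (ι : K →+* ℝ) (u : K) :
    (rotPerm h c).lieEquiv ℝ ∈ (dataD m l).lattice ι u := by
  refine CartanData.mem_lattice (dataD m l) (rotPerm h c) (fun _ => rfl) (longVec_mem_so m)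
    (Matrix.diagonal fun _ => ((1 : ℤˣ) : ℤ)) ?_ (fun j => rootD l j.succ)
    (rootD_coroot_eq hl)
    (exists_unimodular_of_signs _ (two_e_mem_rootD hl) fun _ => 1)
    (Equiv.refl _) (fun _ => Iff.rfl) ?_ ι u
  · intro k
    refine (rotPerm_H h c k).trans ?_
    simp [Matrix.diagonal_apply, dataD]
  · intro p
    refine ⟨longSign p * (c p.1.1.1.val * c p.1.1.2.val), Or.inl ?_⟩
    change (rotPerm h c).conj ℂ (longVec m p) = _ • longVec m p
    rw [longVec_eq, map_smul, SignedPerm.conj_f _ _ (rotPerm_perm_lt h c),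
      rotPerm_longCore h c p.1.1.1.isLt p.1.1.2.isLt, f_smul, smul_comm]

/-! ### Root spaces and diagrams -/

theorem cplx_apply_self {m : ℕ} (X Y : so ℝ m) (a : Fin (m + 2)) : cplx X Y a a = 0 := by
  have h := mem_so_iff_apply.mp (cplx_mem_so X Y) a a
  rcases Int.units_eq_one_or (formUnit a) with h1 | h1 <;> rw [h1] at h <;>
  simp only [Units.val_neg, Units.val_one, Int.cast_neg, Int.cast_one, mul_neg, mul_one, neg_mul,
    one_mul, neg_neg] at h
  · exact self_eq_neg.mp h
  · exact neg_eq_self.mp h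

theorem single_mul_apply {n : ℕ} (p q a b : Fin n) (Z : Matrix (Fin n) (Fin n) ℂ) :
    (Matrix.single p q (1 : ℂ) * Z) a b = if a = p then Z q b else 0 := by
  split_ifs with h
  · rw [h, Matrix.single_mul_apply_same, one_mul]
  · rw [Matrix.single_mul_apply_of_ne _ _ _ _ _ h]

theorem mul_single_apply {n : ℕ} (p q a b : Fin n) (Z : Matrix (Fin n) (Fin n) ℂ) :
    (Z * Matrix.single p q (1 : ℂ)) a b = if b = q then Z a p else 0 := by
  split_ifs with h
  · rw [h, Matrix.mul_single_apply_same, mul_one]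
  · rw [Matrix.mul_single_apply_of_ne _ _ _ _ _ h]

theorem F_mul_apply {n j : ℕ} (hj : 2 * j + 1 < n) (Z : Matrix (Fin n) (Fin n) ℂ) (a b : Fin n) :
    (F ℂ n (2 * j + 1) (2 * j + 2) * Z) a b =
      if a.val = 2 * j then Z ⟨2 * j + 1, hj⟩ b
      else if a.val = 2 * j + 1 then -Z ⟨2 * j, by omega⟩ b else 0 := by
  have hF := F_succ ℂ (⟨2 * j, by omega⟩ : Fin n) ⟨2 * j + 1, hj⟩
  dsimp only at hF
  rw [hF, sub_mul, Matrix.sub_apply, single_mul_apply, single_mul_apply]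
  simp only [Fin.ext_iff]
  split_ifs <;> first | omega | simp

theorem mul_F_apply {n j : ℕ} (hj : 2 * j + 1 < n) (Z : Matrix (Fin n) (Fin n) ℂ) (a b : Fin n) :
    (Z * F ℂ n (2 * j + 1) (2 * j + 2)) a b =
      if b.val = 2 * j + 1 then Z a ⟨2 * j, by omega⟩
      else if b.val = 2 * j then -Z a ⟨2 * j + 1, hj⟩ else 0 := by
  have hF := F_succ ℂ (⟨2 * j, by omega⟩ : Fin n) ⟨2 * j + 1, hj⟩
  dsimp only at hF
  rw [hF, mul_sub, Matrix.sub_apply, mul_single_apply, mul_single_apply]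
  simp only [Fin.ext_iff]
  split_ifs <;> first | omega | simp

namespace CartanData

variable {m l : ℕ} {P : Type} {C : CartanData m l P}

theorem torusElt_eq (C : CartanData m l P) (hT : C.T = H m) (c : Fin l → ℝ) :
    cplx (C.torusElt c) 0 =
      ∑ j, (c j : ℂ) • F ℂ (m + 2) (2 * j.val + 1) (2 * j.val + 2) := by
  unfold torusElt
  rw [cplx_zero_sum, hT]
  refine Finset.sum_congr rfl fun j _ => ?_
  rw [cplx_zero_right]
  congr 1
  exact F_map Complex.ofRealHom _ _

theorem rootVal_eq (C : CartanData m l P) (hκ : ∀ j, C.kappa j = -Complex.I) (α : Fin l → ℤ)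
    (c : Fin l → ℝ) :
    C.rootVal α c = -Complex.I * ∑ j, (α j : ℂ) * (c j : ℂ) := by
  unfold rootVal
  rw [Finset.mul_sum]
  exact Finset.sum_congr rfl fun j _ => by rw [hκ]; ring

theorem InRootSpace.bracket_H {α : Fin l → ℤ} {X Y : so ℝ m} (hXY : C.InRootSpace α X Y)
    (hT : C.T = H m) (hκ : ∀ j, C.kappa j = -Complex.I) (j : Fin l) :
    F ℂ (m + 2) (2 * j.val + 1) (2 * j.val + 2) * cplx X Y -
      cplx X Y * F ℂ (m + 2) (2 * j.val + 1) (2 * j.val + 2) =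
      (-Complex.I * (α j : ℂ)) • cplx X Y := by
  have h := hXY (Pi.single j 1)
  rw [C.torusElt_eq hT, C.rootVal_eq hκ, Finset.sum_eq_single j, Finset.sum_eq_single j] at h
  · simp only [Pi.single_eq_same, Complex.ofReal_one, one_smul, mul_one] at h
    exact h
  · intro k _ hk
    simp [hk]
  · exact fun h => absurd (Finset.mem_univ _) h
  · intro k _ hk
    simp [hk]
  · exact fun h => absurd (Finset.mem_univ _) h

/-- The entries of `[H_j, Z] = -i α_j Z`. -/
theorem InRootSpace.bracket_apply (h : 2 * l ≤ m + 2) {α : Fin l → ℤ} {X Y : so ℝ m}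
    (hXY : C.InRootSpace α X Y) (hT : C.T = H m) (hκ : ∀ j, C.kappa j = -Complex.I) (j : Fin l)
    (a b : Fin (m + 2)) :
    (if a.val = 2 * j.val then cplx X Y ⟨2 * j.val + 1, by omega⟩ b
      else if a.val = 2 * j.val + 1 then -cplx X Y ⟨2 * j.val, by omega⟩ b else 0) -
    (if b.val = 2 * j.val + 1 then cplx X Y a ⟨2 * j.val, by omega⟩
      else if b.val = 2 * j.val then -cplx X Y a ⟨2 * j.val + 1, by omega⟩ else 0) =
      -Complex.I * (α j : ℂ) * cplx X Y a b := by
  have := congrFun (congrFun (hXY.bracket_H hT hκ j) a) b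
  rwa [Matrix.sub_apply, F_mul_apply (by omega), mul_F_apply (by omega)] at this

/-- The support of the elements of a root space. -/
theorem InRootSpace.support (h : 2 * l ≤ m + 2) {α : Fin l → ℤ} {X Y : so ℝ m}
    (hXY : C.InRootSpace α X Y) (hT : C.T = H m) (hκ : ∀ j, C.kappa j = -Complex.I)
    (hα : ∃ j, α j ≠ 0) {a b : Fin (m + 2)} (hab : cplx X Y a b ≠ 0) :
    (∀ j, α j ≠ 0 → a.val / 2 = j.val ∨ b.val / 2 = j.val) ∧
    (∀ j, α j = 0 → (a.val / 2 = j.val ↔ b.val / 2 = j.val)) ∧ a.val / 2 ≠ b.val / 2 := by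
  have hbr := fun j => hXY.bracket_apply h hT hκ j
  -- `[H_j, Z]` vanishes outside the rows and columns of block `j`, so a non-zero eigenvalue forces
  -- `Z` to vanish there too.
  have h1 : ∀ j, α j ≠ 0 → a.val / 2 = j.val ∨ b.val / 2 = j.val := by
    intro j hj
    by_contra! hc
    have := hbr j a b
    rw [if_neg (by omega), if_neg (by omega), if_neg (by omega), if_neg (by omega), sub_zero,
      eq_comm] at this
    simp [hj, hab] at this
  -- `H_j` exchanges the two rows of block `j` up to sign, so `[H_j, Z] = 0`, read in the other row
  -- of the block, is the vanishing of `Z a b`.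
  have h2 : ∀ j : Fin l, α j = 0 → ∀ a b : Fin (m + 2), a.val / 2 = j.val → b.val / 2 ≠ j.val →
      cplx X Y a b = 0 := by
    intro j hj a b ha hb
    rcases Nat.mod_two_eq_zero_or_one a.val with ha2 | ha2
    · have h3 := hbr j ⟨2 * j.val + 1, by omega⟩ b
      rw [if_neg (by simp), if_pos rfl, if_neg (by omega), if_neg (by omega), hj] at h3
      simp only [sub_zero, Int.cast_zero, mul_zero, zero_mul, neg_eq_zero] at h3
      rwa [show a = ⟨2 * j.val, by omega⟩ from Fin.ext (by dsimp only; omega)]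
    · have h3 := hbr j ⟨2 * j.val, by omega⟩ b
      rw [if_pos rfl, if_neg (by omega), if_neg (by omega), hj] at h3
      simp only [sub_zero, Int.cast_zero, mul_zero, zero_mul] at h3
      rwa [show a = ⟨2 * j.val + 1, by omega⟩ from Fin.ext (by dsimp only; omega)]
  have hskew : ∀ a b, cplx X Y b a = 0 → cplx X Y a b = 0 := by
    intro a b h0
    have h3 := mem_so_iff_apply.mp (cplx_mem_so X Y) a b
    rw [h0, zero_mul, eq_comm, neg_eq_zero, mul_eq_zero] at h3
    refine h3.resolve_left ?_
    exact Int.cast_ne_zero.mpr (Units.ne_zero _)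
  refine ⟨h1, fun j hj => ⟨fun ha => ?_, fun hb => ?_⟩, fun hblk => ?_⟩
  · by_contra hb
    exact hab (h2 j hj a b ha hb)
  · by_contra ha
    exact hab (hskew _ _ (h2 j hj b a hb ha))
  -- Both indices would lie in a block `j` with `α_j ≠ 0`. The off-diagonal entry of the bracket
  -- there is a difference of diagonal entries of `Z`, all zero, so that whole block of `Z`
  -- vanishes.
  · obtain ⟨j, hj⟩ := hα
    have haj : a.val / 2 = j.val := by
      have := h1 j hj
      omega
    have hj2 : 2 * j.val + 1 < m + 2 := by
      have := j.isLt
      omega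
    obtain ⟨p, hp⟩ : ∃ p : Fin (m + 2), p.val = 2 * j.val := ⟨⟨_, Nat.lt_of_succ_lt hj2⟩, rfl⟩
    obtain ⟨q, hq⟩ : ∃ q : Fin (m + 2), q.val = 2 * j.val + 1 := ⟨⟨_, hj2⟩, rfl⟩
    have h3 := hbr j p q
    have hp' : (⟨2 * j.val, Nat.lt_of_succ_lt hj2⟩ : Fin (m + 2)) = p := Fin.ext hp.symm
    have hq' : (⟨2 * j.val + 1, hj2⟩ : Fin (m + 2)) = q := Fin.ext hq.symm
    rw [if_pos hp, if_pos hq, hp', hq', cplx_apply_self, cplx_apply_self, sub_self, eq_comm] at h3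
    have h4 : cplx X Y p q = 0 := by
      simpa [hj] using h3
    have ha : a = p ∨ a = q := by
      simp only [Fin.ext_iff, hp, hq]
      omega
    have hb : b = p ∨ b = q := by
      simp only [Fin.ext_iff, hp, hq]
      omega
    rcases ha with rfl | rfl <;> rcases hb with rfl | rfl
    · exact hab (cplx_apply_self X Y _)
    · exact hab h4
    · exact hab (hskew _ _ h4)
    · exact hab (cplx_apply_self X Y _)

/-- By `InRootSpace.support` only the index pairs admitted in `hcirc` carry non-zero entries of a
root vector, so a common value of `ε a * ε b` on those pairs decides the action. -/
theorem diagPerm_hasDiagram (C : CartanData m l P) (h : 2 * l ≤ m + 2) (hT : C.T = H m)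
    (hκ : ∀ j, C.kappa j = -Complex.I) (ε : ℕ → ℤˣ) {V : Type} {root : V → Fin l → ℤ}
    (D : AlmostDoubleVoganDiagram root) (hne : ∀ v, ∃ j, root v j ≠ 0)
    (haut : ∀ v (j : Fin l), root (D.aut v) j = (planeSign ε j.val : ℤ) * root v j)
    (hcirc : ∀ v, D.aut v = v → ∀ a b : ℕ,
      (∀ j : Fin l, root v j ≠ 0 → a / 2 = j.val ∨ b / 2 = j.val) →
      (∀ j : Fin l, root v j = 0 → (a / 2 = j.val ↔ b / 2 = j.val)) → a / 2 ≠ b / 2 →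
      a < m + 2 → b < m + 2 →
      (v ∈ D.circled → ε a * ε b = -1) ∧ (v ∉ D.circled → ε a * ε b = 1)) :
    C.HasDiagram ((diagPerm m ε).lieEquiv ℝ) D := by
  have hsp : ∀ v, D.aut v = v → ∀ X Y : so ℝ m, C.InRootSpace (root v) X Y → ∀ a b,
      cplx X Y a b ≠ 0 → (v ∈ D.circled → ε a.val * ε b.val = -1) ∧
        (v ∉ D.circled → ε a.val * ε b.val = 1) := by
    intro v hv X Y hXY a b hab
    obtain ⟨h1, h2, h3⟩ := hXY.support h hT hκ (hne v) hab
    exact hcirc v hv a.val b.val h1 h2 h3 a.isLt b.isLt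
  refine ⟨fun c => ⟨fun j => (planeSign ε j.val : ℤ) * c j, ?_, fun v => ?_⟩, ?_, ?_⟩
  · unfold torusElt
    rw [map_sum]
    refine Finset.sum_congr rfl fun j _ => ?_
    rw [map_smul, hT, diagPerm_H h, smul_smul, mul_comm]
  · unfold rootVal
    refine Finset.sum_congr rfl fun j _ => ?_
    rw [haut]
    push_cast
    linear_combination (root v j : ℂ) * (c j : ℂ) * C.kappa j *
      cast_unit_mul_self ℂ (planeSign ε j.val)
  · intro v hv hvc X Y hXY
    rw [SignedPerm.conj_cplx]
    ext a b
    change ((ε a.val : ℤ) : ℂ) * ((ε b.val : ℤ) : ℂ) * cplx X Y a b = -cplx X Y a b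
    by_cases hab : cplx X Y a b = 0
    · simp [hab]
    · rw [← Int.cast_mul, ← Units.val_mul, (hsp v hv X Y hXY a b hab).1 hvc]
      simp
  · intro v hv hvc X Y hXY
    rw [SignedPerm.conj_cplx]
    ext a b
    change ((ε a.val : ℤ) : ℂ) * ((ε b.val : ℤ) : ℂ) * cplx X Y a b = cplx X Y a b
    by_cases hab : cplx X Y a b = 0
    · simp [hab]
    · rw [← Int.cast_mul, ← Units.val_mul, (hsp v hv X Y hXY a b hab).2 hvc]
      simp

theorem rotPerm_toMatrix (C : CartanData m l P) (h : m + 2 = 2 * l) (hT : C.T = H m)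
    (c : ℕ → ℤˣ) :
    (rotPerm h c).toMatrix ℂ = cplx (C.torusElt fun j => ((c j.val : ℤ) : ℝ)) 0 := by
  rw [C.torusElt_eq hT]
  ext a b
  rw [Matrix.sum_apply, Finset.sum_eq_single ⟨a.val / 2, by omega⟩]
  · simp only [Matrix.smul_apply, F, E, Matrix.sub_apply, Matrix.of_apply, SignedPerm.toMatrix,
      rotPerm, Fin.ext_iff]
    split_ifs <;> first | omega | simp
  · intro j _ hj
    have hj' : a.val / 2 ≠ j.val := fun h => hj (Fin.ext h.symm)
    simp only [Matrix.smul_apply, F, E, Matrix.sub_apply, Matrix.of_apply]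
    rw [if_neg (by omega), if_neg (by omega)]
    simp
  · exact fun h => absurd (Finset.mem_univ _) h

theorem rotPerm_hasDiagram (C : CartanData m l P) (h : m + 2 = 2 * l) (hT : C.T = H m)
    (hκ : ∀ j, C.kappa j = -Complex.I) (c : ℕ → ℤˣ) {V : Type} {root : V → Fin l → ℤ}
    (D : AlmostDoubleVoganDiagram root) (haut : ∀ v, D.aut v = v)
    (hcirc : ∀ v, v ∈ D.circled ↔ ∑ j : Fin l, root v j * (c j.val : ℤ) ≠ 0) :
    C.HasDiagram ((rotPerm h c).lieEquiv ℝ) D := by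
  have hbr : ∀ v (X Y : so ℝ m), C.InRootSpace (root v) X Y →
      (rotPerm h c).toMatrix ℂ * cplx X Y - cplx X Y * (rotPerm h c).toMatrix ℂ =
        (-Complex.I * ((∑ j : Fin l, root v j * (c j.val : ℤ) : ℤ) : ℂ)) • cplx X Y := by
    intro v X Y hXY
    have := hXY fun j => ((c j.val : ℤ) : ℝ)
    rw [← C.rotPerm_toMatrix h hT, C.rootVal_eq hκ] at this
    rw [Int.cast_sum]
    simp only [Int.cast_mul]
    exact this
  have hsq : (rotPerm h c).toMatrix ℂ * (rotPerm h c).toMatrix ℂ = -1 := by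
    ext a b
    rw [SignedPerm.toMatrix_mul_apply, SignedPerm.toMatrix, Matrix.of_apply,
      (rotPerm h c).perm_perm a, mul_ite, mul_zero, ← Int.cast_mul, ← Units.val_mul,
      (rotPerm h c).sign_mul]
    simp only [rotPerm, Matrix.neg_apply, Matrix.one_apply]
    split_ifs <;> simp
  have hA := (rotPerm h c).toMatrix_mul_transpose ℂ
  refine ⟨fun t => ⟨t, ?_, fun v => by rw [haut]⟩, ?_, ?_⟩
  · unfold torusElt
    rw [map_sum]
    refine Finset.sum_congr rfl fun j _ => ?_
    rw [map_smul, hT, rotPerm_H]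
  · intro v _ hv X Y hXY
    have h1 := hbr v X Y hXY
    have hne := (hcirc v).mp hv
    rw [SignedPerm.conj_cplx, SignedPerm.conj_eq]
    generalize (rotPerm h c).toMatrix ℂ = A at *
    generalize cplx X Y = Z at *
    -- The left side is `A²Z - ZA²`, and `A² = -1` is central. As `AZ - ZA` is a non-zero multiple
    -- of `Z`, this gives `AZ + ZA = 0`.
    have h2 : A * (A * Z - Z * A) + (A * Z - Z * A) * A = 0 := by
      have : A * (A * Z - Z * A) + (A * Z - Z * A) * A = (A * A) * Z - Z * (A * A) := by
        noncomm_ring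
      rw [this, hsq]
      noncomm_ring
    rw [h1, Matrix.mul_smul, Matrix.smul_mul, ← smul_add, smul_eq_zero] at h2
    have h3 : A * Z = -(Z * A) := by
      refine eq_neg_of_add_eq_zero_left (h2.resolve_left ?_)
      exact mul_ne_zero (neg_ne_zero.mpr Complex.I_ne_zero) (Int.cast_ne_zero.mpr hne)
    rw [h3, Matrix.neg_mul, Matrix.mul_assoc, hA, Matrix.mul_one]
  · intro v _ hv X Y hXY
    have h1 := hbr v X Y hXY
    have h0 := not_not.mp (mt (hcirc v).mpr hv)
    rw [h0, Int.cast_zero, mul_zero, zero_smul, sub_eq_zero] at h1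
    rw [SignedPerm.conj_cplx, SignedPerm.conj_eq, h1, Matrix.mul_assoc, hA, Matrix.mul_one]

end CartanData

/-! ### Involutions from signed permutation matrices -/

theorem skew_mem_so {m : ℕ} (a b : Fin (m + 2)) :
    Matrix.single a b 1 -
      (((formUnit a * formUnit b : ℤˣ) : ℤ) : ℝ) • Matrix.single b a (1 : ℝ) ∈ so ℝ m := by
  rw [mem_so_iff_apply]
  intro x y
  simp only [Matrix.sub_apply, Matrix.smul_apply, Matrix.single_apply, smul_eq_mul,
    Units.val_mul, Int.cast_mul]
  have ha := cast_unit_mul_self ℝ (formUnit a)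
  have hb := cast_unit_mul_self ℝ (formUnit b)
  have hx : b = y ∧ a = x ↔ a = x ∧ b = y := and_comm
  have hy : b = x ∧ a = y ↔ a = y ∧ b = x := and_comm
  simp only [hx, hy]
  by_cases h1 : a = x ∧ b = y <;> by_cases h2 : a = y ∧ b = x
  · obtain ⟨rfl, rfl⟩ := h1
    obtain ⟨rfl, -⟩ := h2
    simp only [and_self, if_true]
    linear_combination (-2 * ((formUnit a : ℤ) : ℝ)) * ha
  · obtain ⟨rfl, rfl⟩ := h1
    simp only [and_self, if_true, if_neg h2]
    linear_combination (-((formUnit a : ℤ) : ℝ)) * hb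
  · obtain ⟨rfl, rfl⟩ := h2
    simp only [and_self, if_true, if_neg h1]
    linear_combination (-((formUnit a : ℤ) : ℝ)) * hb
  · simp only [if_neg h1, if_neg h2]
    ring

/-- The test element has non-zero entries only at `(a, b)` and `(b, a)`. Its conjugate has entry `0`
or `-1` at `(a, b)`, where the element itself has `1`. -/
theorem SignedPerm.isInvolution_of_ne {m : ℕ} (S : SignedPerm m) {a b : Fin (m + 2)}
    (hab : a ≠ b) (h1 : S.perm a ≠ b)
    (h2 : S.perm a = a → S.perm b = b → S.sign a ≠ S.sign b) : IsInvolution S.groupEquiv := by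
  refine S.isInvolution (X := ⟨_, skew_mem_so a b⟩) fun h => ?_
  have h := congrFun (congrFun h a) b
  rw [SignedPerm.conj_apply] at h
  simp only [Matrix.sub_apply, Matrix.smul_apply, Matrix.single_apply, smul_eq_mul] at h
  rw [if_neg (fun hc : b = S.perm a ∧ a = S.perm b => h1 hc.1.symm),
    if_neg (fun hc : b = a ∧ a = b => hab hc.2)] at h
  simp only [and_self, if_true] at h
  split_ifs at h with hc
  · have hne := h2 hc.1.symm hc.2.symm
    rcases Int.units_eq_one_or (S.sign a) with ha | ha <;>
    rcases Int.units_eq_one_or (S.sign b) with hb | hb <;> rw [ha, hb] at h hne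
    · exact hne rfl
    · norm_num at h
    · norm_num at h
    · exact hne rfl
  · norm_num at h

theorem SignedPerm.exists_involution {m l : ℕ} {P : Type} [Fintype P] [DecidableEq P]
    {C : CartanData m l P} (S : SignedPerm m) (hS : IsInvolution S.groupEquiv) {K : Type*}
    [Field K] {ι : K →+* ℝ} {u : K} (hlat : S.lieEquiv ℝ ∈ C.lattice ι u) {V : Type}
    {root : V → Fin l → ℤ} {D : AlmostDoubleVoganDiagram root}
    (hD : C.HasDiagram (S.lieEquiv ℝ) D) :
    ∃ (σ : SO0 m ≃ₜ* SO0 m) (dσ : so ℝ m ≃ₗ⁅ℝ⁆ so ℝ m),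
      IsInvolution σ ∧ (∀ g, σ (theta g) = theta (σ g)) ∧ IsMatrixConjugation σ ∧
      IsDifferential σ dσ ∧ dσ ∈ C.lattice ι u ∧ C.HasDiagram dσ D :=
  ⟨S.groupEquiv, S.lieEquiv ℝ, hS, S.groupEquiv_theta, S.isMatrixConjugation, S.isDifferential,
    hlat, hD⟩

/-- The sign `-1` on the numbers satisfying `Q`. -/
def signOf (Q : ℕ → Prop) [DecidablePred Q] (n : ℕ) : ℤˣ := if Q n then -1 else 1

theorem signOf_mul (Q : ℕ → Prop) [DecidablePred Q] (a b : ℕ) :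
    signOf Q a * signOf Q b = if (Q a ↔ Q b) then 1 else -1 := by
  unfold signOf
  by_cases ha : Q a <;> by_cases hb : Q b <;> simp [ha, hb]

theorem signOf_circled {Q : ℕ → Prop} [DecidablePred Q] {a b : ℕ} {c : Prop}
    (h : c ↔ ¬(Q a ↔ Q b)) :
    (c → signOf Q a * signOf Q b = -1) ∧ (¬c → signOf Q a * signOf Q b = 1) := by
  rw [signOf_mul]
  exact ⟨fun hc => if_neg (h.mp hc), fun hc => if_pos (not_not.mp (mt h.mpr hc))⟩

theorem diagPerm_isInvolution {m : ℕ} {Q : ℕ → Prop} [DecidablePred Q] {a b : ℕ}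
    (ha : a < m + 2) (hb : b < m + 2) (hQa : Q a) (hQb : ¬Q b) :
    IsInvolution (diagPerm m (signOf Q)).groupEquiv := by
  have hab : (⟨a, ha⟩ : Fin (m + 2)) ≠ ⟨b, hb⟩ := fun h => hQb (Fin.mk.inj h ▸ hQa)
  refine (diagPerm m (signOf Q)).isInvolution_of_ne hab hab fun _ _ => ?_
  simp only [diagPerm, signOf, if_pos hQa, if_neg hQb]
  decide

theorem rotPerm_isInvolution {m l : ℕ} (h : m + 2 = 2 * l) (hl : 2 ≤ l) (c : ℕ → ℤˣ) :
    IsInvolution (rotPerm h c).groupEquiv := by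
  refine (rotPerm h c).isInvolution_of_ne (a := ⟨0, by omega⟩) (b := ⟨2, by omega⟩) ?_ ?_ ?_ <;>
  simp [rotPerm]

/-! ### The involutions of `𝔰𝔬(2,2l-1)` -/

/-- The two coordinate blocks joined by a vertex of the affine diagram. -/
theorem rootB_support {l : ℕ} {v : Fin (l + 1)} {a b : ℕ}
    (h1 : ∀ j : Fin l, rootB l v j ≠ 0 → a / 2 = j.val ∨ b / 2 = j.val)
    (h2 : ∀ j : Fin l, rootB l v j = 0 → (a / 2 = j.val ↔ b / 2 = j.val)) (hne : a / 2 ≠ b / 2)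
    (ha : a < 2 * l + 1) (hb : b < 2 * l + 1) :
    (a / 2 = v.val - 1 ∧ b / 2 = v.val - 1 + 1) ∨ (b / 2 = v.val - 1 ∧ a / 2 = v.val - 1 + 1) := by
  have hv := v.isLt
  -- Truncated subtraction treats `-δ` like `φ₁`: both involve blocks `0` and `1`. The short root
  -- `e_l` involves block `l - 1` and the unpaired last coordinate, whose index `2l` lies in block
  -- `l`.
  have key : ∀ j, j < l →
      (j = v.val - 1 ∨ j = v.val - 1 + 1 → a / 2 = j ∨ b / 2 = j) ∧
      (j ≠ v.val - 1 ∧ j ≠ v.val - 1 + 1 → (a / 2 = j ↔ b / 2 = j)) := by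
    intro j hj
    have h1' := h1 ⟨j, hj⟩
    have h2' := h2 ⟨j, hj⟩
    unfold rootB at h1' h2'
    dsimp only at h1' h2'
    constructor
    · intro hc
      apply h1'
      split_ifs <;> simp only [Pi.neg_apply, Pi.add_apply, Pi.sub_apply, e_apply] <;>
        split_ifs <;> omega
    · intro hc
      apply h2'
      split_ifs <;> simp only [Pi.neg_apply, Pi.add_apply, Pi.sub_apply, e_apply] <;>
        split_ifs <;> omega
  have k1 := key (v.val - 1)
  have k2 := key (v.val - 1 + 1)
  have k3 := key (a / 2)
  have k4 := key (b / 2)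
  omega

theorem rootB_ne_zero {l : ℕ} (hl : 1 ≤ l) (v : Fin (l + 1)) : ∃ j, rootB l v j ≠ 0 := by
  have hv := v.isLt
  refine ⟨⟨v.val - 1, by omega⟩, ?_⟩
  unfold rootB
  split_ifs <;> simp only [Pi.neg_apply, Pi.add_apply, Pi.sub_apply, e_apply] <;>
    split_ifs <;> omega

/-- `Q` marks the coordinates with entry `-1`. A plane with exactly one marked coordinate reverses
its `e_j`, and a fixed vertex is circled when `Q` distinguishes the two blocks it joins. -/
theorem exists_involutionB {m l : ℕ} (h : m + 1 = 2 * l) {K : Type*} [Field K] (ι : K →+* ℝ)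
    (u : K) (D : AlmostDoubleVoganDiagram (rootB l)) (Q : ℕ → Prop) [DecidablePred Q]
    (haut : ∀ v (j : Fin l), rootB l (D.aut v) j =
      (if (Q (2 * j.val) ↔ Q (2 * j.val + 1)) then 1 else -1) * rootB l v j)
    (hcirc : ∀ v, D.aut v = v → ∀ a b,
      (a / 2 = v.val - 1 ∧ b / 2 = v.val - 1 + 1) ∨
        (b / 2 = v.val - 1 ∧ a / 2 = v.val - 1 + 1) → (v ∈ D.circled ↔ ¬(Q a ↔ Q b)))
    (hQ : ∃ a < m + 2, ∃ b < m + 2, Q a ∧ ¬Q b) :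
    ∃ (σ : SO0 m ≃ₜ* SO0 m) (dσ : so ℝ m ≃ₗ⁅ℝ⁆ so ℝ m),
      IsInvolution σ ∧ (∀ g, σ (theta g) = theta (σ g)) ∧ IsMatrixConjugation σ ∧
      IsDifferential σ dσ ∧ dσ ∈ (dataB m l).lattice ι u ∧ (dataB m l).HasDiagram dσ D := by
  obtain ⟨a, ha, b, hb, hQa, hQb⟩ := hQ
  refine (diagPerm m (signOf Q)).exists_involution (diagPerm_isInvolution ha hb hQa hQb)
    (diagPerm_mem_latticeB h _ ι u) ?_
  refine (dataB m l).diagPerm_hasDiagram (by omega) rfl (fun _ => rfl) _ D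
    (rootB_ne_zero (by omega)) (fun v j => ?_) fun v hv a b h1 h2 h3 h4 h5 => ?_
  · rw [haut, planeSign, signOf_mul]
    split_ifs <;> simp
  · exact signOf_circled (hcirc v hv a b (rootB_support h1 h2 h3 (by omega) (by omega)))

theorem swapBlack_fixed {l : ℕ} (hl : 1 ≤ l) {v : Fin (l + 1)} (hv : swapBlack l v = v) :
    2 ≤ v.val := by
  have := congrArg Fin.val hv
  rw [swapBlack_val hl] at this
  split_ifs at this <;> omega

theorem swapEnd_fixed {l : ℕ} (hl : 1 ≤ l) {v : Fin (l + 1)} (hv : swapEnd l v = v) :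
    v.val + 1 < l := by
  have hlt := v.isLt
  have := congrArg Fin.val hv
  rw [swapEnd_val] at this
  split_ifs at this <;> omega

theorem swapBoth_fixed {l : ℕ} (hl : 3 ≤ l) {v : Fin (l + 1)}
    (hv : (swapBlack l * swapEnd l) v = v) : 2 ≤ v.val ∧ v.val + 1 < l := by
  have hlt := v.isLt
  have := congrArg Fin.val hv
  rw [Equiv.Perm.mul_apply, swapBlack_val (by omega), swapEnd_val] at this
  split_ifs at this <;> omega

theorem EntryB.exists_involution {m l : ℕ} (h : m + 1 = 2 * l) {K : Type*} [Field K]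
    (ι : K →+* ℝ) (u : K) (t : EntryB l) :
    ∃ (σ : SO0 m ≃ₜ* SO0 m) (dσ : so ℝ m ≃ₗ⁅ℝ⁆ so ℝ m),
      IsInvolution σ ∧ (∀ g, σ (theta g) = theta (σ g)) ∧ IsMatrixConjugation σ ∧
      IsDifferential σ dσ ∧ dσ ∈ (dataB m l).lattice ι u ∧
      (dataB m l).HasDiagram dσ t.diagram := by
  rcases t with ⟨p, hp⟩ | ⟨p, hp⟩ | ⟨p, hp⟩
  · refine exists_involutionB h ι u _ (fun n => n < 2 * p) (fun v j => ?_)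
      (fun v hv a b hab => ?_) ⟨0, by omega, 2 * p, by omega, by omega, by omega⟩
    · rw [if_pos (by omega), one_mul]
      rfl
    · change v.val = p ↔ _
      omega
  -- Composing with `θ` flips both signs of the first plane, which toggles the circles at `φ₁` and
  -- `-δ`.
  · refine exists_involutionB h ι u _ (fun n => 2 ≤ n ∧ n < 2 * p) (fun v j => ?_)
      (fun v hv a b hab => ?_) ⟨2, by omega, 0, by omega, by omega, by omega⟩
    · rw [if_pos (by omega), one_mul]
      rfl
    · change v.val = p ∨ v.val = 1 ∨ v.val = 0 ↔ _
      omega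
  -- A reflection in the first plane reverses `e₁`, hence exchanges `φ₁` and `-δ`. For `p = 1`
  -- nothing else is marked.
  · refine exists_involutionB h ι u _ (fun n => n = 1 ∨ 2 ≤ n ∧ n < 2 * p) (fun v j => ?_)
      (fun v hv a b hab => ?_) ⟨1, by omega, 0, by omega, by omega, by omega⟩
    · refine (rootB_swapBlack (by omega) v j).trans ?_
      unfold sgnFirst
      congr 1
      split_ifs <;> first | rfl | omega
    · have := swapBlack_fixed (by omega) hv
      change v.val = p ∧ 2 ≤ p ↔ _
      omega

/-! ### The involutions of `𝔰𝔬(2,2l-2)` -/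

/-- Every vertex joins two adjacent blocks; `φ_l` joins the same two as `φ_{l-1}`, which is the
exceptional value of `p`. -/
theorem rootD_support {l : ℕ} (hl : 2 ≤ l) {v : Fin (l + 1)} {a b : ℕ}
    (h1 : ∀ j : Fin l, rootD l v j ≠ 0 → a / 2 = j.val ∨ b / 2 = j.val)
    (p : ℕ) (hp : p = if v.val = l then l - 2 else v.val - 1) :
    (a / 2 = p ∧ b / 2 = p + 1) ∨ (b / 2 = p ∧ a / 2 = p + 1) := by
  have hv := v.isLt
  have key : ∀ j, j < l → (j = p ∨ j = p + 1) → a / 2 = j ∨ b / 2 = j := by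
    intro j hj hc
    apply h1 ⟨j, hj⟩
    unfold rootD
    split_ifs at hp <;> split_ifs <;>
      simp only [Pi.neg_apply, Pi.add_apply, Pi.sub_apply, e_apply] <;>
      split_ifs <;> omega
  have hpl : p + 1 < l := by
    split_ifs at hp <;> omega
  have k1 := key p
  have k2 := key (p + 1)
  omega

theorem rootD_ne_zero {l : ℕ} (hl : 2 ≤ l) (v : Fin (l + 1)) : ∃ j, rootD l v j ≠ 0 := by
  have hv := v.isLt
  refine ⟨⟨v.val - 1, by omega⟩, ?_⟩
  unfold rootD
  split_ifs <;> simp only [Pi.neg_apply, Pi.add_apply, Pi.sub_apply, e_apply] <;>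
    split_ifs <;> omega

theorem exists_diagInvolutionD {m l : ℕ} (h : m + 2 = 2 * l) (hl : 2 ≤ l) {K : Type*} [Field K]
    (ι : K →+* ℝ) (u : K) (D : AlmostDoubleVoganDiagram (rootD l)) (Q : ℕ → Prop)
    [DecidablePred Q]
    (haut : ∀ v (j : Fin l), rootD l (D.aut v) j =
      (if (Q (2 * j.val) ↔ Q (2 * j.val + 1)) then 1 else -1) * rootD l v j)
    (hcirc : ∀ v, D.aut v = v → ∀ p, p = (if v.val = l then l - 2 else v.val - 1) → ∀ a b,
      (a / 2 = p ∧ b / 2 = p + 1) ∨ (b / 2 = p ∧ a / 2 = p + 1) →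
      (v ∈ D.circled ↔ ¬(Q a ↔ Q b)))
    (hQ : ∃ a < m + 2, ∃ b < m + 2, Q a ∧ ¬Q b) :
    ∃ (σ : SO0 m ≃ₜ* SO0 m) (dσ : so ℝ m ≃ₗ⁅ℝ⁆ so ℝ m),
      IsInvolution σ ∧ (∀ g, σ (theta g) = theta (σ g)) ∧ IsMatrixConjugation σ ∧
      IsDifferential σ dσ ∧ dσ ∈ (dataD m l).lattice ι u ∧ (dataD m l).HasDiagram dσ D := by
  obtain ⟨a, ha, b, hb, hQa, hQb⟩ := hQ
  refine (diagPerm m (signOf Q)).exists_involution (diagPerm_isInvolution ha hb hQa hQb)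
    (diagPerm_mem_latticeD h hl _ ι u) ?_
  refine (dataD m l).diagPerm_hasDiagram (by omega) rfl (fun _ => rfl) _ D
    (rootD_ne_zero hl) (fun v j => ?_) fun v hv a b h1 _ _ _ _ => ?_
  · rw [haut, planeSign, signOf_mul]
    split_ifs <;> simp
  · exact signOf_circled (hcirc v hv _ rfl a b (rootD_support hl h1 _ rfl))

theorem signOf_sub_ne_zero {Q : ℕ → Prop} [DecidablePred Q] {a b : ℕ} :
    (signOf Q a : ℤ) - (signOf Q b : ℤ) ≠ 0 ↔ ¬(Q a ↔ Q b) := by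
  unfold signOf
  by_cases ha : Q a <;> by_cases hb : Q b <;> simp [ha, hb]

theorem signOf_add_ne_zero {Q : ℕ → Prop} [DecidablePred Q] {a b : ℕ} :
    (signOf Q a : ℤ) + (signOf Q b : ℤ) ≠ 0 ↔ (Q a ↔ Q b) := by
  unfold signOf
  by_cases ha : Q a <;> by_cases hb : Q b <;> simp [ha, hb]

/-- A difference `e_a - e_b` pairs non-trivially with the sign vector exactly when the two signs
differ, and a sum exactly when they agree. -/
theorem exists_rotInvolutionD {m l : ℕ} (h : m + 2 = 2 * l) (hl : 2 ≤ l) {K : Type*} [Field K]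
    (ι : K →+* ℝ) (u : K) (c : ℕ → Prop) (Q : ℕ → Prop) [DecidablePred Q]
    (h0 : c 0 ↔ (Q 0 ↔ Q 1))
    (h1 : ∀ v, 1 ≤ v → v < l → (c v ↔ ¬(Q (v - 1) ↔ Q v)))
    (h2 : c l ↔ (Q (l - 2) ↔ Q (l - 1))) :
    ∃ (σ : SO0 m ≃ₜ* SO0 m) (dσ : so ℝ m ≃ₗ⁅ℝ⁆ so ℝ m),
      IsInvolution σ ∧ (∀ g, σ (theta g) = theta (σ g)) ∧ IsMatrixConjugation σ ∧
      IsDifferential σ dσ ∧ dσ ∈ (dataD m l).lattice ι u ∧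
      (dataD m l).HasDiagram dσ (fixDiagram (root := rootD l) {v | c v.val}) := by
  refine (rotPerm h (signOf Q)).exists_involution (rotPerm_isInvolution h hl _)
    (rotPerm_mem_latticeD h hl _ ι u) ?_
  refine (dataD m l).rotPerm_hasDiagram h rfl (fun _ => rfl) _ _ (fun _ => rfl) fun v => ?_
  change c v.val ↔ pairing (rootD l v) (fun j : Fin l => (signOf Q j.val : ℤ)) ≠ 0
  have hv := v.isLt
  have he : ∀ a (ha : a < l), pairing (e l (a + 1)) (fun j : Fin l => (signOf Q j.val : ℤ)) =
      (signOf Q a : ℤ) := fun a ha => pairing_e (a + 1) _ ⟨a, ha⟩ rfl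
  have hneg : ∀ α β : Fin l → ℤ, pairing (-α) β = -pairing α β := by
    intro α β
    simp [pairing]
  unfold rootD
  split_ifs with hv0 hvl
  · rw [hv0, h0, hneg, pairing_add_left, he 0 (by omega), he 1 (by omega), neg_ne_zero,
      signOf_add_ne_zero]
  · have h3 := he (v.val - 1) (by omega)
    rw [Nat.sub_add_cancel (by omega)] at h3
    rw [h1 v.val (by omega) hvl, pairing_sub_left, h3, he v.val hvl, signOf_sub_ne_zero]
  · have h3 := he (l - 2) (by omega)
    have h4 := he (l - 1) (by omega)
    rw [show l - 2 + 1 = l - 1 by omega] at h3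
    rw [show l - 1 + 1 = l by omega] at h4
    rw [show v.val = l by omega, h2, pairing_add_left, h3, h4, signOf_add_ne_zero]

theorem EntryD.exists_involution {m l : ℕ} (h : m + 2 = 2 * l) {K : Type*} [Field K]
    (ι : K →+* ℝ) (u : K) (t : EntryD l) :
    ∃ (σ : SO0 m ≃ₜ* SO0 m) (dσ : so ℝ m ≃ₗ⁅ℝ⁆ so ℝ m),
      IsInvolution σ ∧ (∀ g, σ (theta g) = theta (σ g)) ∧ IsMatrixConjugation σ ∧
      IsDifferential σ dσ ∧ dσ ∈ (dataD m l).lattice ι u ∧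
      (dataD m l).HasDiagram dσ t.diagram := by
  rcases t with ⟨p, hp⟩ | ⟨p, hp⟩ | ⟨p, hp⟩ | ⟨p, hp⟩ | ⟨p, hp⟩ | ⟨p, hp⟩ | hl | hl | hl | hl |
    hl | hl | hl
  · refine exists_diagInvolutionD h (by omega) ι u _ (fun n => n < 2 * p) (fun v j => ?_)
      (fun v hv q hq a b hab => ?_) ⟨0, by omega, 2 * p, by omega, by omega, by omega⟩
    · rw [if_pos (by omega), one_mul]
      rfl
    · change v.val = p ↔ _
      split_ifs at hq <;> omega
  · refine exists_diagInvolutionD h (by omega) ι u _ (fun n => 2 ≤ n ∧ n < 2 * p)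
      (fun v j => ?_) (fun v hv q hq a b hab => ?_)
      ⟨2, by omega, 0, by omega, by omega, by omega⟩
    · rw [if_pos (by omega), one_mul]
      rfl
    · change v.val = p ∨ v.val = 1 ∨ v.val = 0 ↔ _
      split_ifs at hq <;> omega
  · refine exists_diagInvolutionD h (by omega) ι u _ (fun n => n = 1 ∨ 2 ≤ n ∧ n < 2 * p)
      (fun v j => ?_) (fun v hv q hq a b hab => ?_)
      ⟨1, by omega, 0, by omega, by omega, by omega⟩
    · refine (rootD_swapBlack (by omega) v j).trans ?_
      unfold sgnFirst
      congr 1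
      split_ifs <;> first | rfl | omega
    · have := swapBlack_fixed (by omega) hv
      change v.val = p ∧ 2 ≤ p ↔ _
      split_ifs at hq <;> omega
  · refine exists_diagInvolutionD h (by omega) ι u _
      (fun n => n = 1 ∨ 2 ≤ n ∧ n < 2 * p ∨ n + 1 = 2 * l)
      (fun v j => ?_) (fun v hv q hq a b hab => ?_)
      ⟨1, by omega, 0, by omega, by omega, by omega⟩
    · refine ((congrFun (congrArg (rootD l) (Equiv.Perm.mul_apply _ _ v)) j).trans
        (rootD_swapBlack (by omega) _ j)).trans ?_
      rw [rootD_swapEnd (by omega), ← mul_assoc]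
      unfold sgnFirst sgnLast
      congr 1
      have := j.isLt
      split_ifs <;> first | rfl | omega
    · have := swapBoth_fixed (by omega) hv
      change v.val = p ∧ 2 ≤ p ↔ _
      split_ifs at hq <;> omega
  -- The last coordinate carries the reflection reversing `e_l`. The guard `2 ≤ p` is needed because
  -- for `p = 1` the set `n < 2` would circle `φ₁` and `-δ`.
  · refine exists_diagInvolutionD h (by omega) ι u _
      (fun n => 2 ≤ p ∧ n < 2 * p ∨ n + 1 = 2 * l)
      (fun v j => ?_) (fun v hv q hq a b hab => ?_)
      ⟨2 * l - 1, by omega, 2 * l - 2, by omega, by omega, by omega⟩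
    · refine (rootD_swapEnd (by omega) v j).trans ?_
      unfold sgnLast
      congr 1
      have := j.isLt
      split_ifs <;> first | rfl | omega
    · have := swapEnd_fixed (by omega) hv
      change v.val = p ∧ 2 ≤ p ↔ _
      split_ifs at hq <;> omega
  -- The preceding choice with both signs of the first plane flipped: for `p = 1` this marks that
  -- plane, for `p ≥ 2` it unmarks it.
  · refine exists_diagInvolutionD h (by omega) ι u _
      (fun n => 2 ≤ p ∧ 2 ≤ n ∧ n < 2 * p ∨ p = 1 ∧ n < 2 ∨ n + 1 = 2 * l)
      (fun v j => ?_) (fun v hv q hq a b hab => ?_)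
      ⟨2 * l - 1, by omega, 2 * l - 2, by omega, by omega, by omega⟩
    · refine (rootD_swapEnd (by omega) v j).trans ?_
      unfold sgnLast
      congr 1
      have := j.isLt
      split_ifs <;> first | rfl | omega
    · have := swapEnd_fixed (by omega) hv
      change v.val = p ∧ 2 ≤ p ∨ v.val = 1 ∨ v.val = 0 ↔ _
      split_ifs at hq <;> omega
  -- In the four rotation cases, flipping the first sign moves a circle between `φ₁` and `-δ`, and
  -- flipping the last moves one between `φ_l` and `φ_{l-1}`.
  · refine exists_rotInvolutionD h (by omega) ι u (fun n => n = l ∨ n = 1)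
      (fun n => n = 0) ?_ ?_ ?_ <;> intros <;> omega
  · refine exists_rotInvolutionD h (by omega) ι u (fun n => n = l ∨ n = 0)
      (fun n => n < 0) ?_ ?_ ?_ <;> intros <;> omega
  · refine exists_rotInvolutionD h (by omega) ι u (fun n => n = l - 1 ∨ n = 1)
      (fun n => n = 0 ∨ n = l - 1) ?_ ?_ ?_ <;> intros <;> omega
  · refine exists_rotInvolutionD h (by omega) ι u (fun n => n = l - 1 ∨ n = 0)
      (fun n => n = l - 1) ?_ ?_ ?_ <;> intros <;> omega
  -- For `l = 3` the marked plane is the last one. Both `φ₂` and `φ₃` join it to the middle plane,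
  -- so both are circled.
  · refine exists_diagInvolutionD h (by omega) ι u _ (fun n => 4 ≤ n) (fun v j => ?_)
      (fun v hv q hq a b hab => ?_) ⟨4, by omega, 0, by omega, by omega, by omega⟩
    · rw [if_pos (by omega), one_mul]
      rfl
    · change v.val = 2 ∨ v.val = 3 ↔ _
      split_ifs at hq <;> omega
  · refine exists_diagInvolutionD h (by omega) ι u _ (fun n => n < 2 ∨ 4 ≤ n) (fun v j => ?_)
      (fun v hv q hq a b hab => ?_) ⟨0, by omega, 2, by omega, by omega, by omega⟩
    · rw [if_pos (by omega), one_mul]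
      rfl
    · refine iff_of_true trivial ?_
      have := v.isLt
      split_ifs at hq <;> omega
  · refine exists_diagInvolutionD h (by omega) ι u _ (fun n => n = 1 ∨ 4 ≤ n) (fun v j => ?_)
      (fun v hv q hq a b hab => ?_) ⟨1, by omega, 0, by omega, by omega, by omega⟩
    · refine (rootD_swapBlack (by omega) v j).trans ?_
      unfold sgnFirst
      congr 1
      split_ifs <;> first | rfl | omega
    · have := swapBlack_fixed (by omega) hv
      change v.val = 2 ∨ v.val = 3 ↔ _
      split_ifs at hq <;> omega

/-! ### The involutions of `𝔰𝔬(2,2)` -/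

/-- The signed permutation matrices interchanging the two coordinate planes of signature `(2,0)`
and `(0,2)`. -/
def swapPerm (x y : ℤˣ) : SignedPerm 2 where
  perm := ![2, 3, 0, 1]
  -- `x` is the sign in `H₁ ↦ x H₂`, and `y` is the square of the matrix, which will be the scalar
  -- on the root spaces of fixed vertices.
  sign := ![1, x, y, x * y]
  perm_perm := by
    intro a
    fin_cases a <;> rfl
  square := y
  sign_mul := by
    have hx := Int.units_mul_self x
    intro a
    fin_cases a
    · exact one_mul y
    · change x * (x * y) = y
      rw [← mul_assoc, hx, one_mul]
    · exact mul_one y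
    · change x * y * x = y
      rw [mul_right_comm, hx, one_mul]
  formSign := -1
  form_perm := by decide

theorem swapPerm_H (x y : ℤˣ) (j : Fin 2) :
    (swapPerm x y).lieEquiv ℝ (H 2 j) = ((x : ℤ) : ℝ) • H 2 j.rev := by
  apply Subtype.ext
  change (swapPerm x y).conj ℝ (F ℝ 4 (2 * j.val + 1) (2 * j.val + 2)) =
    ((x : ℤ) : ℝ) • F ℝ 4 (2 * j.rev.val + 1) (2 * j.rev.val + 2)
  fin_cases j
  · refine ((swapPerm x y).conj_F ℝ 0 1).trans ?_
    change (((y * (x * y) : ℤˣ) : ℤ) : ℝ) • F ℝ 4 3 4 = _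
    rw [mul_left_comm, Int.units_mul_self, mul_one]
    rfl
  · refine ((swapPerm x y).conj_F ℝ 2 3).trans ?_
    change (((1 * x : ℤˣ) : ℤ) : ℝ) • F ℝ 4 1 2 = _
    rw [one_mul]
    rfl

theorem F_offDiagonal {n i j : ℕ} (hi : i ≤ 2) (hj : 2 < j) (a b : Fin n)
    (h : a.val < 2 ↔ b.val < 2) : F ℂ n i j a b = 0 := by
  simp only [F, E, Matrix.sub_apply, Matrix.of_apply]
  rw [if_neg (by omega), if_neg (by omega), sub_zero]

/-- Exchanging the planes exchanges the blocks that `f` multiplies by `i` and `-i`, whence the sign.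
The diagonal blocks acquire no sign, so `Z` has to vanish there. -/
theorem swapPerm_conj_f (x y : ℤˣ) (Z : Matrix (Fin (2 + 2)) (Fin (2 + 2)) ℂ)
    (hZ : ∀ a b : Fin (2 + 2), (a.val < 2 ↔ b.val < 2) → Z a b = 0) :
    (swapPerm x y).conj ℂ (f Z) = -f ((swapPerm x y).conj ℂ Z) := by
  have hp : ∀ a, ((swapPerm x y).perm a).val < 2 ↔ ¬a.val < 2 := by decide +revert
  ext a b
  simp only [SignedPerm.conj_apply, f, Matrix.of_apply, Matrix.neg_apply]
  have ha := hp a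
  have hb := hp b
  have h0 : (a.val < 2 ↔ b.val < 2) → Z ((swapPerm x y).perm a) ((swapPerm x y).perm b) = 0 :=
    fun h => hZ _ _ (by omega)
  split_ifs <;> first | omega | (rw [h0 (by omega)]; ring) | ring

/-- The root with relative sign `s` is kept if `s x = -1` and reversed if `s x = 1`, as `e₁ ↔ x e₂`
predicts. -/
theorem swapPerm_longCore (x y s : ℤˣ) (ω : ℂ) :
    (swapPerm x y).conj ℂ (f (longCore 2 0 1 s ω)) =
      ((y : ℤ) : ℂ) • f (longCore 2 0 1 s (-((s * x : ℤˣ) : ℤ) * ω)) := by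
  have h1 := (swapPerm x y).conj_F ℂ 0 2
  have h2 := (swapPerm x y).conj_F ℂ 1 3
  have h3 := (swapPerm x y).conj_F ℂ 0 3
  have h4 := (swapPerm x y).conj_F ℂ 1 2
  change (swapPerm x y).conj ℂ (F ℂ (2 + 2) 1 3) =
    (((y * 1 : ℤˣ) : ℤ) : ℂ) • F ℂ (2 + 2) 3 1 at h1
  change (swapPerm x y).conj ℂ (F ℂ (2 + 2) 2 4) =
    (((x * y * x : ℤˣ) : ℤ) : ℂ) • F ℂ (2 + 2) 4 2 at h2
  change (swapPerm x y).conj ℂ (F ℂ (2 + 2) 1 4) =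
    (((y * x : ℤˣ) : ℤ) : ℂ) • F ℂ (2 + 2) 3 2 at h3
  change (swapPerm x y).conj ℂ (F ℂ (2 + 2) 2 3) =
    (((x * y * 1 : ℤˣ) : ℤ) : ℂ) • F ℂ (2 + 2) 4 1 at h4
  rw [swapPerm_conj_f, ← f_neg, ← f_smul]
  · congr 1
    unfold longCore
    simp only [map_add, map_sub, map_smul, Nat.mul_zero, Nat.mul_one, Nat.zero_add]
    rw [h1, h2, h3, h4, F_swap ℂ 3 1, F_swap ℂ 4 2, F_swap ℂ 3 2, F_swap ℂ 4 1]
    rcases Int.units_eq_one_or x with rfl | rfl <;>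
    rcases Int.units_eq_one_or s with rfl | rfl <;>
    simp only [mul_one, one_mul, neg_mul, mul_neg, neg_neg, Units.val_neg,
      Units.val_one, Int.cast_neg, Int.cast_one] <;> module
  · intro a b hab
    unfold longCore
    simp only [Matrix.add_apply, Matrix.sub_apply, Matrix.smul_apply]
    rw [F_offDiagonal (by omega) (by omega) a b hab, F_offDiagonal (by omega) (by omega) a b hab,
      F_offDiagonal (by omega) (by omega) a b hab, F_offDiagonal (by omega) (by omega) a b hab]
    simp

theorem longRoot_two_fst (p : LongRoot 2) : p.1.1.1.val = 0 ∧ p.1.1.2.val = 1 := by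
  have h1 : p.1.1.1.val < p.1.1.2.val := p.1.2
  have h2 := p.1.1.2.isLt
  omega

theorem swapPerm_rootVec (x y : ℤˣ) (p : LongRoot 2) :
    ∃ η : ℤˣ, (swapPerm x y).conj ℂ ((dataD 2 2).rootVec p) =
        ((η : ℤ) : ℂ) • (dataD 2 2).rootVec p ∨
      (swapPerm x y).conj ℂ ((dataD 2 2).rootVec p) =
        ((η : ℤ) : ℂ) • (dataD 2 2).negRootVec p := by
  rw [(dataD 2 2).negRootVec_of_long (p := p) rfl rfl]
  change ∃ η : ℤˣ, (swapPerm x y).conj ℂ (longVec 2 p) = ((η : ℤ) : ℂ) • longVec 2 p ∨ _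
  change ∃ η : ℤˣ, _ ∨ (swapPerm x y).conj ℂ (longVec 2 p) = _
  rw [longVec_eq, (longRoot_two_fst p).1, (longRoot_two_fst p).2, map_smul, swapPerm_longCore]
  rcases Int.units_eq_one_or (longSign p * x) with h | h
  · refine ⟨-y, Or.inr ?_⟩
    rw [h]
    simp only [Units.val_neg, Units.val_one, Int.cast_neg, Int.cast_one, neg_mul, one_mul]
    module
  · refine ⟨y, Or.inl ?_⟩
    rw [h]
    simp only [Units.val_neg, Units.val_one, Int.cast_neg, Int.cast_one, neg_neg, one_mul]
    module

theorem swapPerm_mem_lattice (x y : ℤˣ) {K : Type*} [Field K] (ι : K →+* ℝ) (u : K) :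
    (swapPerm x y).lieEquiv ℝ ∈ (dataD 2 2).lattice ι u := by
  refine CartanData.mem_lattice (dataD 2 2) (swapPerm x y) (fun _ => rfl) (longVec_mem_so 2)
    ((x : ℤ) • !![0, 1; 1, 0]) ?_ (fun j => rootD 2 j.succ) (rootD_coroot_eq le_rfl)
    (exists_unimodular _ ?_ _ ?_ ?_)
    (Equiv.refl _) (fun _ => Iff.rfl) (swapPerm_rootVec x y) ι u
  · intro k
    refine (swapPerm_H x y k).trans ?_
    fin_cases k <;> simp [dataD, Fin.sum_univ_two]
  · intro k
    rw [single_eq_e]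
    exact two_e_mem_rootD le_rfl _ (by omega) k.isLt
  · rcases Int.units_eq_one_or x with rfl | rfl <;> decide
  · intro j
    -- The simple coroots are eigenvectors: `e₁ - e₂` for `-x` and `e₁ + e₂` for `x`.
    have hj : ∃ z : ℤ, ((x : ℤ) • !![0, 1; 1, 0]) *ᵥ rootD 2 j.succ = z • rootD 2 j.succ := by
      refine ⟨if j = 0 then -x else x, ?_⟩
      rcases Int.units_eq_one_or x with rfl | rfl <;> fin_cases j <;> decide
    obtain ⟨z, hz⟩ := hj
    rw [hz]
    exact Submodule.smul_mem _ _ (Submodule.subset_span ⟨j, rfl⟩)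

theorem swapPerm_isInvolution (x y : ℤˣ) : IsInvolution (swapPerm x y).groupEquiv :=
  (swapPerm x y).isInvolution_of_ne (a := 0) (b := 1) (by decide) (by decide +revert)
    (fun h => absurd h (by decide +revert))

theorem swapPerm_hasDiagram (x y : ℤˣ) {V : Type} {root : V → Fin 2 → ℤ}
    (D : AlmostDoubleVoganDiagram root)
    (haut : ∀ v j, root (D.aut v) j = (x : ℤ) * root v j.rev)
    (hne : ∀ v, ∃ j, root v j ≠ 0)
    (hcirc : ∀ v, D.aut v = v → (v ∈ D.circled ↔ y = -1)) :
    (dataD 2 2).HasDiagram ((swapPerm x y).lieEquiv ℝ) D := by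
  have hx := cast_unit_mul_self ℂ x
  have key : ∀ v, D.aut v = v → ∀ X Y : so ℝ 2, (dataD 2 2).InRootSpace (root v) X Y →
      (swapPerm x y).conj ℂ (cplx X Y) = ((y : ℤ) : ℂ) • cplx X Y := by
    intro v hv X Y hXY
    have hbr := fun j => hXY.bracket_apply (le_refl _) rfl (fun _ => rfl) j
    -- Entry `(0, 2)` of the brackets with `H₁` and `H₂` expresses `Z 1 2` and `Z 0 3` through `Z 0
    -- 2`. A fixed vertex has coordinates `α₁ = x α₂`, so these two entries agree up to `x`, and the
    -- conjugation is multiplication by `y`.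
    have h12 := hbr 0 0 2
    have h03 := hbr 1 0 2
    have hroot : (root v 0 : ℂ) = ((x : ℤ) : ℂ) * (root v 1 : ℂ) := by
      have := haut v 0
      rw [hv] at this
      rw [this]
      push_cast
      rfl
    replace h12 : cplx X Y 1 2 = -Complex.I * (root v 0 : ℂ) * cplx X Y 0 2 := by
      simpa using h12
    replace h03 : cplx X Y 0 3 = -Complex.I * (root v 1 : ℂ) * cplx X Y 0 2 := by
      simpa using h03
    have hsym : ∀ a b : Fin (2 + 2), a.val < 2 → ¬b.val < 2 → cplx X Y b a = cplx X Y a b := by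
      intro a b ha hb
      have := mem_so_iff_apply.mp (cplx_mem_so X Y) a b
      simpa [formUnit, ha, hb] using this
    have hdiag : ∀ a b : Fin (2 + 2), a.val / 2 = b.val / 2 → cplx X Y a b = 0 := by
      intro a b hab
      by_contra h0
      exact (hXY.support (le_refl _) rfl (fun _ => rfl) (hne v) h0).2.2 hab
    have h : cplx X Y 1 2 = ((x : ℤ) : ℂ) * cplx X Y 0 3 := by
      rw [h12, h03, hroot]
      ring
    have h' : cplx X Y 0 3 = ((x : ℤ) : ℂ) * cplx X Y 1 2 := by
      rw [h, ← mul_assoc, hx, one_mul]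
    ext a b
    rw [SignedPerm.conj_apply, Matrix.smul_apply, smul_eq_mul]
    by_cases hab : a.val / 2 = b.val / 2
    · have hp : ∀ a b : Fin (2 + 2), a.val / 2 = b.val / 2 →
          ((swapPerm x y).perm a).val / 2 = ((swapPerm x y).perm b).val / 2 := by
        change ∀ a b : Fin 4, a.val / 2 = b.val / 2 →
          ((![2, 3, 0, 1] : Fin 4 → Fin 4) a).val / 2 = ((![2, 3, 0, 1] : Fin 4 → Fin 4) b).val / 2
        decide
      rw [hdiag _ _ hab, hdiag _ _ (hp _ _ hab), mul_zero, mul_zero]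
    · have h20 := hsym 0 2 (by decide) (by decide)
      have h30 := hsym 0 3 (by decide) (by decide)
      have h21 := hsym 1 2 (by decide) (by decide)
      have h31 := hsym 1 3 (by decide) (by decide)
      fin_cases a <;> fin_cases b <;> first | exact absurd rfl hab | skip
      all_goals simp [swapPerm]
      all_goals simp only [h20, h30, h21, h31]
      all_goals first
        | linear_combination -((y : ℤ) : ℂ) * h
        | linear_combination -((y : ℤ) : ℂ) * h'
        | linear_combination ((y : ℤ) : ℂ) * cplx X Y 1 3 * hx
  refine ⟨fun c => ⟨fun j => (x : ℤ) * c j.rev, ?_, fun v => ?_⟩, ?_, ?_⟩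
  · unfold CartanData.torusElt
    rw [map_sum, ← Equiv.sum_comp Fin.revPerm]
    refine Finset.sum_congr rfl fun j _ => ?_
    change (swapPerm x y).lieEquiv ℝ (c j.rev • H 2 j.rev) = ((x : ℤ) * c j.rev) • H 2 j
    rw [map_smul, swapPerm_H, Fin.rev_rev, smul_smul, mul_comm]
  · unfold CartanData.rootVal
    rw [← Equiv.sum_comp Fin.revPerm]
    refine Finset.sum_congr rfl fun j _ => ?_
    change (root (D.aut v) j.rev : ℂ) * ((((x : ℤ) : ℝ) * c j.rev.rev : ℝ) : ℂ) * -Complex.I =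
      (root v j : ℂ) * (c j : ℂ) * -Complex.I
    rw [haut, Fin.rev_rev]
    push_cast
    linear_combination -(root v j : ℂ) * (c j : ℂ) * Complex.I * hx
  · intro v hv hvc X Y hXY
    rw [SignedPerm.conj_cplx, key v hv X Y hXY, (hcirc v hv).mp hvc]
    simp
  · intro v hv hvc X Y hXY
    have hy : y = 1 := (Int.units_eq_one_or y).resolve_right (mt (hcirc v hv).mpr hvc)
    rw [SignedPerm.conj_cplx, key v hv X Y hXY, hy]
    simp

theorem rootD2_ne_zero (v : Fin 2 × Bool) : ∃ j, rootD2 v j ≠ 0 := by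
  decide +revert

theorem EntryD2.exists_involution {K : Type*} [Field K] (ι : K →+* ℝ) (u : K) (t : EntryD2) :
    ∃ (σ : SO0 2 ≃ₜ* SO0 2) (dσ : so ℝ 2 ≃ₗ⁅ℝ⁆ so ℝ 2),
      IsInvolution σ ∧ (∀ g, σ (theta g) = theta (σ g)) ∧ IsMatrixConjugation σ ∧
      IsDifferential σ dσ ∧ dσ ∈ (dataD 2 2).lattice ι u ∧
      (dataD 2 2).HasDiagram dσ t.diagram := by
  have hswap : ∀ (x y : ℤˣ) (D : AlmostDoubleVoganDiagram rootD2)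
      (_ : ∀ v j, rootD2 (D.aut v) j = (x : ℤ) * rootD2 v j.rev)
      (_ : ∀ v, D.aut v = v → (v ∈ D.circled ↔ y = -1)),
      ∃ (σ : SO0 2 ≃ₜ* SO0 2) (dσ : so ℝ 2 ≃ₗ⁅ℝ⁆ so ℝ 2),
        IsInvolution σ ∧ (∀ g, σ (theta g) = theta (σ g)) ∧ IsMatrixConjugation σ ∧
        IsDifferential σ dσ ∧ dσ ∈ (dataD 2 2).lattice ι u ∧ (dataD 2 2).HasDiagram dσ D :=
    fun x y D haut hcirc => (swapPerm x y).exists_involution (swapPerm_isInvolution x y)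
      (swapPerm_mem_lattice x y ι u) (swapPerm_hasDiagram x y D haut rootD2_ne_zero hcirc)
  have hrot : ∀ (c : ℕ → ℤˣ) (circled : Set (Fin 2 × Bool))
      (_ : ∀ v, v ∈ circled ↔ ∑ j : Fin 2, rootD2 v j * (c j.val : ℤ) ≠ 0),
      ∃ (σ : SO0 2 ≃ₜ* SO0 2) (dσ : so ℝ 2 ≃ₗ⁅ℝ⁆ so ℝ 2),
        IsInvolution σ ∧ (∀ g, σ (theta g) = theta (σ g)) ∧ IsMatrixConjugation σ ∧
        IsDifferential σ dσ ∧ dσ ∈ (dataD 2 2).lattice ι u ∧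
        (dataD 2 2).HasDiagram dσ (fixDiagram (root := rootD2) circled) :=
    fun c circled hcirc => (rotPerm (l := 2) rfl c).exists_involution
      (rotPerm_isInvolution rfl le_rfl c) (rotPerm_mem_latticeD rfl le_rfl c ι u)
      ((dataD 2 2).rotPerm_hasDiagram rfl rfl (fun _ => rfl) c _ (fun _ => rfl) hcirc)
  have hdiag : ∀ (Q : ℕ → Prop) [DecidablePred Q] (D : AlmostDoubleVoganDiagram rootD2)
      (_ : ∀ v (j : Fin 2), rootD2 (D.aut v) j =
        (planeSign (signOf Q) j.val : ℤ) * rootD2 v j)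
      (_ : ∀ v, D.aut v ≠ v) (_ : ∃ a < 4, ∃ b < 4, Q a ∧ ¬Q b),
      ∃ (σ : SO0 2 ≃ₜ* SO0 2) (dσ : so ℝ 2 ≃ₗ⁅ℝ⁆ so ℝ 2),
        IsInvolution σ ∧ (∀ g, σ (theta g) = theta (σ g)) ∧ IsMatrixConjugation σ ∧
        IsDifferential σ dσ ∧ dσ ∈ (dataD 2 2).lattice ι u ∧ (dataD 2 2).HasDiagram dσ D := by
    intro Q _ D haut hfix ⟨a, ha, b, hb, hQa, hQb⟩
    exact (diagPerm 2 (signOf Q)).exists_involution (diagPerm_isInvolution ha hb hQa hQb)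
      (diagPerm_mem_latticeD rfl le_rfl _ ι u)
      ((dataD 2 2).diagPerm_hasDiagram le_rfl rfl (fun _ => rfl) _ D rootD2_ne_zero haut
        fun v hv => absurd hv (hfix v))
  cases t
  · refine hrot (signOf fun n => n = 0) _ fun v => ?_
    change v.1 = 0 ↔ _
    revert v
    decide
  -- The planes are numbered `0` and `1`, so both signs are `+1` here and only `±φ₂` pair
  -- non-trivially with them.
  · refine hrot (signOf fun n => n = 2) _ fun v => ?_
    change v.1 = 1 ↔ _
    revert v
    decide
  · refine hswap 1 1 _ (show ∀ v j, rootD2 (negFirst v) j = _ by decide) fun v hv => ?_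
    exact iff_of_false (fun h => h.2) (by decide)
  · refine hswap 1 (-1) _ (show ∀ v j, rootD2 (negFirst v) j = _ by decide) fun v hv => ?_
    have : ∀ v : Fin 2 × Bool, negFirst v = v → v.1 = 1 := by decide
    exact iff_of_true ⟨this v hv, trivial⟩ rfl
  · refine hswap (-1) 1 _ (show ∀ v j, rootD2 (negSecond v) j = _ by decide) fun v hv => ?_
    exact iff_of_false (fun h => h.2) (by decide)
  · refine hswap (-1) (-1) _ (show ∀ v j, rootD2 (negSecond v) j = _ by decide) fun v hv => ?_
    have : ∀ v : Fin 2 × Bool, negSecond v = v → v.1 = 0 := by decide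
    exact iff_of_true ⟨this v hv, trivial⟩ rfl
  -- The last three diagrams fix no vertex, so reflections in one or both planes suffice and the
  -- circling conditions are vacuous.
  · exact hdiag (fun n => n = 1 ∨ n = 3) _
      (show ∀ v (j : Fin 2), rootD2 ((negFirst * negSecond) v) j = _ by decide)
      (show ∀ v, (negFirst * negSecond) v ≠ v by decide) ⟨1, by decide, 0, by decide, by decide⟩
  · exact hdiag (fun n => n = 3) _ (show ∀ v (j : Fin 2), rootD2 (exchange v) j = _ by decide)
      (show ∀ v, exchange v ≠ v by decide) ⟨3, by decide, 0, by decide, by decide⟩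
  · exact hdiag (fun n => n = 1) _ (show ∀ v (j : Fin 2), rootD2 (exchangeNeg v) j = _ by decide)
      (show ∀ v, exchangeNeg v ≠ v by decide) ⟨1, by decide, 0, by decide, by decide⟩

end SO2m

theorem proposition3p1 {K : Type*} [Field K] [NumberField K] [NumberField.IsTotallyReal K]
    (hdeg : 1 < Module.finrank ℚ K) (ι : K →+* ℝ) (u : K) (hu : 0 < ι u)
    (hneg : ∀ s : K →+* ℝ, s ≠ ι → s u < 0) (hgen : IntermediateField.adjoin ℚ {u} = ⊤) :
    (∀ m l : ℕ, m + 1 = 2 * l → ∀ t : SO2m.EntryB l,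
      ∃ (σ : SO2m.SO0 m ≃ₜ* SO2m.SO0 m) (dσ : SO2m.so ℝ m ≃ₗ⁅ℝ⁆ SO2m.so ℝ m),
        SO2m.IsInvolution σ ∧ (∀ g, σ (SO2m.theta g) = SO2m.theta (σ g)) ∧
        SO2m.IsMatrixConjugation σ ∧ SO2m.IsDifferential σ dσ ∧
        dσ ∈ (SO2m.dataB m l).lattice ι u ∧ (SO2m.dataB m l).HasDiagram dσ t.diagram) ∧
    (∀ m l : ℕ, m + 2 = 2 * l → ∀ t : SO2m.EntryD l,
      ∃ (σ : SO2m.SO0 m ≃ₜ* SO2m.SO0 m) (dσ : SO2m.so ℝ m ≃ₗ⁅ℝ⁆ SO2m.so ℝ m),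
        SO2m.IsInvolution σ ∧ (∀ g, σ (SO2m.theta g) = SO2m.theta (σ g)) ∧
        SO2m.IsMatrixConjugation σ ∧ SO2m.IsDifferential σ dσ ∧
        ((dσ ∈ (SO2m.dataD m l).lattice ι u ∧ (SO2m.dataD m l).HasDiagram dσ t.diagram) ∨
          (dσ ∈ (SO2m.dataD' m l).lattice ι u ∧ (SO2m.dataD' m l).HasDiagram dσ t.diagram))) ∧
    (∀ t : SO2m.EntryD2,
      ∃ (σ : SO2m.SO0 2 ≃ₜ* SO2m.SO0 2) (dσ : SO2m.so ℝ 2 ≃ₗ⁅ℝ⁆ SO2m.so ℝ 2),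
        SO2m.IsInvolution σ ∧ (∀ g, σ (SO2m.theta g) = SO2m.theta (σ g)) ∧
        SO2m.IsMatrixConjugation σ ∧ SO2m.IsDifferential σ dσ ∧
        ((dσ ∈ (SO2m.dataD 2 2).lattice ι u ∧ (SO2m.dataD 2 2).HasDiagram dσ t.diagram) ∨
          (dσ ∈ (SO2m.dataD' 2 2).lattice ι u ∧ (SO2m.dataD' 2 2).HasDiagram dσ t.diagram))) := by
  refine ⟨fun m l h t => t.exists_involution h ι u, fun m l h t => ?_, fun t => ?_⟩
  · obtain ⟨σ, dσ, h1, h2, h3, h4, h5⟩ := t.exists_involution h ι u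
    -- The rotations `∑ c_j H_j` already give the circlings of a single end vertex with respect to
    -- `𝔱₀`, so the first alternative always holds.
    exact ⟨σ, dσ, h1, h2, h3, h4, Or.inl h5⟩
  · obtain ⟨σ, dσ, h1, h2, h3, h4, h5⟩ := t.exists_involution ι u
    exact ⟨σ, dσ, h1, h2, h3, h4, Or.inl h5⟩
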